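/- Let $n\ge 2$, let $S^{n-1}\subset\mathbb R^n$ be the unit sphere with its surface measure (the $(n-1)$-dimensional Hausdorff measure), and let $\Delta_{S}$ be the Laplacian on the sphere: $\Delta_{S}v$ is the restriction to $S^{n-1}$ of $\Delta\tilde v$, where $\tilde v(X)=v(X/|X|)$ for $X\neq0$; a function $v$ on $S^{n-1}$ is of class $C^m$ if $\tilde v$ is $C^m$ in a neighbourhood of $S^{n-1}$. For each $k\ge 0$ let $\{Y_{k,l}\}_{l}$ be an $L^2(S^{n-1})$-orthonormal basis of the space of real spherical harmonics of degree $k$ (restrictions to the sphere of harmonic homogeneous polynomials of degree $k$), put $\lambda_k=k(k+n-2)$ and $P_kv=\sum_l\big(\int_{S^{n-1}}v\,Y_{k,l}\big)Y_{k,l}$, and define $$(-\Delta_S)^s v=\sum_{k\ge0}\lambda_k^{s}P_kv,\qquad e^{t\Delta_S}v=\sum_{k\ge0}e^{-t\lambda_k}P_kv .$$ Let $0<s<1$ and let $u$ be a smooth real function on $S^{n-1}$. For $x\in S^{n-1}$ and $y>0$ define $$U(x,y)=\frac{y^{2s}}{4^s\Gamma(s)}\int_0^\infty e^{-y^2/(4t)}\,e^{t\Delta_S}u(x)\,\frac{dt}{t^{1+s}}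 .$$ Then the series for $(-\Delta_S)^su(x)$ and, for $t>0$, those for $e^{t\Delta_S}u(x)$ and $e^{t\Delta_S}\big((-\Delta_S)^su\big)(x)$, as well as the integral above, converge absolutely; $(-\Delta_S)^su$ is continuous; $U(\cdot,y)$ is $C^2$ on $S^{n-1}$ for every $y>0$, $U(x,\cdot)$ is $C^2$ on $(0,\infty)$ for every $x\in S^{n-1}$; and for every $x\in S^{n-1}$ $$\Delta_{S}U(x,y)+\frac{1-2s}{y}\,\partial_yU(x,y)+\partial_{yy}U(x,y)=0\quad(y>0),$$ $$\lim_{y\to0^+}U(x,y)=u(x),\qquad \lim_{y\to0^+}\big(-y^{1-2s}\,\partial_yU(x,y)\big)=\frac{\Gamma(1-s)}{4^{s-1/2}\,\Gamma(s)}\,(-\Delta_S)^su(x).$$ Moreover, if $\int_{S^{n-1}}u=0$, then for all $x\in S^{n-1}$ and $y>0$ $$U(x,y)=\frac1{\Gamma(s)}\int_0^\infty e^{-y^2/(4t)}\,e^{t\Delta_S}\big((-\Delta_S)^su\big)(x)\,\frac{dt}{t^{1-s}},$$ the integral being absolutely convergent. -/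

import Mathlib

open Set Filter Topology MeasureTheory
open scoped ContDiff

noncomputable section

/-- The unit sphere `S^{n-1}` of `ℝⁿ`. -/
abbrev Sph (n : ℕ) : Type := Metric.sphere (0 : EuclideanSpace ℝ (Fin n)) 1

/-- The surface measure on `S^{n-1}`, i.e. the (classically normalized) `(n-1)`-dimensional
Hausdorff measure restricted to the sphere; its total mass is `n * |B_1| = 2 π^{n/2} / Γ(n/2)`. -/
def surfaceMeasure (n : ℕ) : Measure (Sph n) :=
  (volume : Measure (EuclideanSpace ℝ (Fin n))).toSphere

open Classical in
/-- The extension `ũ(X) = u(X/|X|)`, `X ≠ 0`, of a function on the sphere that is constant along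
the lines normal to the sphere (with the irrelevant value `0` at the origin). -/
def normalExt {n : ℕ} (u : Sph n → ℝ) (X : EuclideanSpace ℝ (Fin n)) : ℝ :=
  if hX : X ≠ 0 then
    u ⟨‖X‖⁻¹ • X, by
      rw [mem_sphere_zero_iff_norm, norm_smul, norm_inv, norm_norm]
      exact inv_mul_cancel₀ (norm_ne_zero_iff.mpr hX)⟩
  else 0

/-- `u ∈ C^m(S^{n-1})`: the extension `ũ` along normal lines is `C^m` off the origin. Since `ũ` is
constant on rays, this is the same as being `C^m` in a neighbourhood of the sphere. -/
def SphContDiff {n : ℕ} (m : WithTop ℕ∞) (u : Sph n → ℝ) : Prop :=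
  ContDiffOn ℝ m (normalExt u) {X | X ≠ 0}

/-- The Laplacian on the sphere: `Δ_{S^{n-1}} u` is the restriction of `Δ ũ` to the sphere. -/
def sphLaplacian {n : ℕ} (u : Sph n → ℝ) (x : Sph n) : ℝ :=
  Laplacian.laplacian (normalExt u) (x : EuclideanSpace ℝ (Fin n))

/-- The space `SH^k` of real spherical harmonics of degree `k` on `S^{n-1}`: restrictions to the
sphere of homogeneous polynomials of degree `k` that are harmonic. -/
def sphericalHarmonics (n k : ℕ) : Submodule ℝ (Sph n → ℝ) where
  carrier := {f | ∃ p : MvPolynomial (Fin n) ℝ, p.IsHomogeneous k ∧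
    ∑ i, MvPolynomial.pderiv i (MvPolynomial.pderiv i p) = 0 ∧
    ∀ x : Sph n, f x = MvPolynomial.eval (fun i => (x : EuclideanSpace ℝ (Fin n)) i) p}
  zero_mem' := ⟨0, MvPolynomial.isHomogeneous_zero _ _ _, by simp, by simp⟩
  add_mem' := by
    rintro f g ⟨p, hp, hp', hpf⟩ ⟨q, hq, hq', hqg⟩
    refine ⟨p + q, hp.add hq, ?_, ?_⟩
    · simp only [map_add, Finset.sum_add_distrib, hp', hq', add_zero]
    · intro x
      simp [hpf, hqg]
  smul_mem' := by
    rintro c f ⟨p, hp, hp', hpf⟩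
    refine ⟨c • p, (MvPolynomial.homogeneousSubmodule (Fin n) ℝ k).smul_mem c hp, ?_, ?_⟩
    · simp only [Derivation.map_smul, ← Finset.smul_sum, hp', smul_zero]
    · intro x
      simp [hpf]

/-- A choice, for every degree `k`, of an orthonormal basis `{Y_{k,l}}_l` of `SH^k` for the inner
product of `L²(S^{n-1})`. -/
structure SphericalHarmonicBasis (n : ℕ) where
  /-- the dimension `d_k` of `SH^k` -/
  dim : ℕ → ℕ
  /-- the basis functions `Y_{k,l}` -/
  Y : (k : ℕ) → Fin (dim k) → Sph n → ℝ
  orthonormal : ∀ (k : ℕ) (l m : Fin (dim k)),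
    ∫ x, Y k l x * Y k m x ∂(surfaceMeasure n) = if l = m then 1 else 0
  span_eq : ∀ k : ℕ, Submodule.span ℝ (Set.range (Y k)) = sphericalHarmonics n k

/-- The eigenvalue `λ_k = k (k + n - 2)` of `-Δ_{S^{n-1}}` on `SH^k`. -/
def sphEigenvalue (n k : ℕ) : ℝ := (k : ℝ) * ((k : ℝ) + (n : ℝ) - 2)

namespace SphericalHarmonicBasis

variable {n : ℕ}

/-- The coefficient `c_{k,l}(u) = ∫ u Y_{k,l}`. -/
def coeff (B : SphericalHarmonicBasis n) (u : Sph n → ℝ) (k : ℕ) (l : Fin (B.dim k)) : ℝ :=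
  ∫ z, u z * B.Y k l z ∂(surfaceMeasure n)

/-- The projector `P_k u = ∑_l c_{k,l}(u) Y_{k,l}` onto `SH^k`. -/
def proj (B : SphericalHarmonicBasis n) (k : ℕ) (u : Sph n → ℝ) (x : Sph n) : ℝ :=
  ∑ l, B.coeff u k l * B.Y k l x

/-- The fractional Laplacian `(-Δ)^s u = ∑_k λ_k^s P_k u`, `s > 0`. -/
def fracLaplacian (B : SphericalHarmonicBasis n) (s : ℝ) (u : Sph n → ℝ) (x : Sph n) : ℝ :=
  ∑' k : ℕ, sphEigenvalue n k ^ s * B.proj k u x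

/-- The heat semigroup `e^{tΔ} u = ∑_k e^{-t λ_k} P_k u`. -/
def heat (B : SphericalHarmonicBasis n) (t : ℝ) (u : Sph n → ℝ) (x : Sph n) : ℝ :=
  ∑' k : ℕ, Real.exp (-t * sphEigenvalue n k) * B.proj k u x

/-- The integrand `e^{-y²/(4t)} e^{tΔ}u(x) / t^{1+s}` of the extension. -/
def extensionIntegrand (B : SphericalHarmonicBasis n) (s : ℝ) (u : Sph n → ℝ) (x : Sph n)
    (y t : ℝ) : ℝ :=
  Real.exp (-y ^ 2 / (4 * t)) * B.heat t u x / t ^ (1 + s)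

/-- The extension
`U(x,y) = y^{2s} / (4^s Γ(s)) ∫_0^∞ e^{-y²/(4t)} e^{tΔ}u(x) dt / t^{1+s}`, for `y > 0`. -/
def extension (B : SphericalHarmonicBasis n) (s : ℝ) (u : Sph n → ℝ) (x : Sph n) (y : ℝ) : ℝ :=
  y ^ (2 * s) / (4 ^ s * Real.Gamma s) * ∫ t in Ioi (0 : ℝ), B.extensionIntegrand s u x y t

end SphericalHarmonicBasis

end

/-! ### Coordinate calculus in `ℝⁿ`: products, radial functions, scaling. -/

noncomputable section

variable {n : ℕ}

/-! Everything reduces to one scalar function of the eigenvalue. The substitution `w = y²/(4t)` in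
the heat integral, applied degree by degree, turns `U` into `∑ φ(λ_k, y) P_k u`, where `φ(μ, y) =
Γ(s)⁻¹ ∫₀^∞ exp(-w - μy²/(4w)) w^(s-1) dw` is `extProfile`. Differentiation under the integral
(`hasDerivAt_macdonald`), one integration by parts (`macdonald_recurrence`) and the inversion `w ↦
z/w` (`macdonald_symm`) give `φ'' + ((1-2s)/y) φ' = μφ`, the limits of `φ` and `-y^(1-2s) φ'` at
`0`, and the second heat formula for `μ > 0`. Mean zero removes exactly the degree `0`, where that
last formula fails.

Summing over `k` needs rapid decay of `P_k u`. The Laplacian on the sphere is symmetric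
(`integral_mul_sphLaplacian_comm`: Green's identity in `ℝⁿ` with a radial cutoff, then polar
coordinates), so `λ_k^m |P_k u|` is `|P_k (Δ^m u)|`. Bessel's inequality bounds the latter in `L²`,
and a sup bound follows because the reproducing kernel of each degree is constant on the diagonal by
rotation invariance, with dimension at most `(k+1)^n` (`sq_le_of_mem`). That the expansion sums to
`u` is completeness: homogeneous polynomials restrict to sums of harmonics
(`polyFun_mem_iSup_sphericalHarmonics`), and Stone–Weierstrass does the rest.

For fixed `y > 0`, `φ(λ_k, y)` decays like `exp(-ky/2)`, so the series of solid harmonics converges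
with its derivatives on a ball larger than the unit ball; this is the regularity in `x`
(`contDiffOn_tsum_polyFun`). The Laplacian of the sum is then identified by its coefficients
(`sphLaplacian_tsum_mul_proj`), and the extension equation becomes the scalar equation for `φ`. -/

/-- The `i`-th partial derivative of a function on `ℝⁿ`. -/
def partialDeriv (i : Fin n) (f : EuclideanSpace ℝ (Fin n) → ℝ) (X : EuclideanSpace ℝ (Fin n)) : ℝ :=
  fderiv ℝ f X (EuclideanSpace.single i 1)

lemma ContDiffAt.partialDeriv {m k : WithTop ℕ∞} {f : EuclideanSpace ℝ (Fin n) → ℝ}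
    {X : EuclideanSpace ℝ (Fin n)} (hf : ContDiffAt ℝ m f X) (i : Fin n) (hmk : k + 1 ≤ m) :
    ContDiffAt ℝ k (partialDeriv i f) X :=
  (hf.fderiv_right hmk).clm_apply contDiffAt_const

lemma laplacian_eq_sum_partialDeriv {f : EuclideanSpace ℝ (Fin n) → ℝ}
    {X : EuclideanSpace ℝ (Fin n)} (hf : ContDiffAt ℝ 2 f X) :
    Laplacian.laplacian f X = ∑ i, partialDeriv i (partialDeriv i f) X := by
  rw [InnerProductSpace.laplacian_eq_iteratedFDeriv_orthonormalBasis f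
    (EuclideanSpace.basisFun (Fin n) ℝ)]
  refine Finset.sum_congr rfl fun i _ => ?_
  have hd : DifferentiableAt ℝ (fderiv ℝ f) X :=
    (hf.fderiv_right (m := 1) (by norm_num)).differentiableAt (by norm_num)
  rw [iteratedFDeriv_two_apply]
  unfold partialDeriv
  rw [fderiv_clm_apply hd (by fun_prop)]
  simp

lemma partialDeriv_congr {f g : EuclideanSpace ℝ (Fin n) → ℝ} {X : EuclideanSpace ℝ (Fin n)}
    (h : f =ᶠ[𝓝 X] g) (i : Fin n) : partialDeriv i f X = partialDeriv i g X := by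
  unfold partialDeriv; rw [h.fderiv_eq]

lemma partialDeriv_mul {f g : EuclideanSpace ℝ (Fin n) → ℝ} {X : EuclideanSpace ℝ (Fin n)}
    (hf : DifferentiableAt ℝ f X) (hg : DifferentiableAt ℝ g X) (i : Fin n) :
    partialDeriv i (fun Z => f Z * g Z) X = f X * partialDeriv i g X + g X * partialDeriv i f X := by
  unfold partialDeriv
  rw [fderiv_fun_mul hf hg]
  simp

lemma partialDeriv_add {f g : EuclideanSpace ℝ (Fin n) → ℝ} {X : EuclideanSpace ℝ (Fin n)}
    (hf : DifferentiableAt ℝ f X) (hg : DifferentiableAt ℝ g X) (i : Fin n) :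
    partialDeriv i (fun Z => f Z + g Z) X = partialDeriv i f X + partialDeriv i g X := by
  unfold partialDeriv
  rw [fderiv_fun_add hf hg]
  simp

lemma laplacian_mul {f g : EuclideanSpace ℝ (Fin n) → ℝ} {X : EuclideanSpace ℝ (Fin n)}
    (hf : ContDiffAt ℝ 2 f X) (hg : ContDiffAt ℝ 2 g X) :
    Laplacian.laplacian (fun Z => f Z * g Z) X = f X * Laplacian.laplacian g X
      + 2 * ∑ i, partialDeriv i f X * partialDeriv i g X + g X * Laplacian.laplacian f X := by
  rw [laplacian_eq_sum_partialDeriv (hf.mul hg), laplacian_eq_sum_partialDeriv hf,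
    laplacian_eq_sum_partialDeriv hg, Finset.mul_sum, Finset.mul_sum, Finset.mul_sum,
    ← Finset.sum_add_distrib, ← Finset.sum_add_distrib]
  refine Finset.sum_congr rfl fun i _ => ?_
  have h1 : partialDeriv i (fun Z => f Z * g Z) =ᶠ[𝓝 X]
      fun Z => f Z * partialDeriv i g Z + g Z * partialDeriv i f Z := by
    filter_upwards [hf.eventually (by simp), hg.eventually (by simp)] with Z hfZ hgZ
    exact partialDeriv_mul (hfZ.differentiableAt (by norm_num)) (hgZ.differentiableAt (by norm_num)) i
  have hfd := hf.differentiableAt (by norm_num)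
  have hgd := hg.differentiableAt (by norm_num)
  have hfd' := (hf.partialDeriv (k := 1) i (by norm_num)).differentiableAt (by norm_num)
  have hgd' := (hg.partialDeriv (k := 1) i (by norm_num)).differentiableAt (by norm_num)
  rw [partialDeriv_congr h1, partialDeriv_add (hfd.fun_mul hgd') (hgd.fun_mul hfd'),
    partialDeriv_mul hfd hgd', partialDeriv_mul hgd hfd']
  ring

lemma sum_mul_partialDeriv (f : EuclideanSpace ℝ (Fin n) → ℝ) (X Z : EuclideanSpace ℝ (Fin n)) :
    ∑ i, Z i * partialDeriv i f X = fderiv ℝ f X Z := by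
  unfold partialDeriv
  have : Z = ∑ i, Z i • EuclideanSpace.single i (1 : ℝ) := by
    conv_lhs => rw [← (EuclideanSpace.basisFun (Fin n) ℝ).sum_repr Z]
    simp
  conv_rhs => rw [this, map_sum]
  simp

lemma partialDeriv_radial {h : ℝ → ℝ} {X : EuclideanSpace ℝ (Fin n)}
    (hh : DifferentiableAt ℝ h (‖X‖ ^ 2)) (i : Fin n) :
    partialDeriv i (fun Z => h (‖Z‖ ^ 2)) X = 2 * X i * deriv h (‖X‖ ^ 2) := by
  unfold partialDeriv
  have h1 : HasFDerivAt (fun Z : EuclideanSpace ℝ (Fin n) => ‖Z‖ ^ 2) (2 • innerSL ℝ X) X :=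
    (hasStrictFDerivAt_norm_sq X).hasFDerivAt
  have h2 := hh.hasDerivAt.comp_hasFDerivAt X h1
  have h3 := h2.fderiv
  rw [show (fun Z : EuclideanSpace ℝ (Fin n) => h (‖Z‖ ^ 2)) =
    h ∘ (fun Z : EuclideanSpace ℝ (Fin n) => ‖Z‖ ^ 2) from rfl, h3]
  simp [EuclideanSpace.inner_single_right]
  ring

lemma ContDiffAt.radial {m : WithTop ℕ∞} {h : ℝ → ℝ} {X : EuclideanSpace ℝ (Fin n)}
    (hh : ContDiffAt ℝ m h (‖X‖ ^ 2)) :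
    ContDiffAt ℝ m (fun Z : EuclideanSpace ℝ (Fin n) => h (‖Z‖ ^ 2)) X :=
  hh.comp X (contDiff_norm_sq ℝ).contDiffAt

lemma laplacian_radial {h : ℝ → ℝ} {X : EuclideanSpace ℝ (Fin n)}
    (hh : ContDiffAt ℝ 2 h (‖X‖ ^ 2)) :
    Laplacian.laplacian (fun Z : EuclideanSpace ℝ (Fin n) => h (‖Z‖ ^ 2)) X =
      2 * n * deriv h (‖X‖ ^ 2) + 4 * ‖X‖ ^ 2 * deriv (deriv h) (‖X‖ ^ 2) := by
  rw [laplacian_eq_sum_partialDeriv hh.radial]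
  have hcont : Tendsto (fun Z : EuclideanSpace ℝ (Fin n) => ‖Z‖ ^ 2) (𝓝 X) (𝓝 (‖X‖ ^ 2)) :=
    (by fun_prop : Continuous fun Z : EuclideanSpace ℝ (Fin n) => ‖Z‖ ^ 2).tendsto X
  have hd' : DifferentiableAt ℝ (deriv h) (‖X‖ ^ 2) := by
    have := (hh.fderiv_right (m := 1) (by norm_num)).differentiableAt (by norm_num)
    rw [show deriv h = fun t => fderiv ℝ h t 1 from funext fun t => fderiv_apply_one_eq_deriv.symm]
    exact this.clm_apply (by fun_prop)
  have hder : ∀ i, partialDeriv i (partialDeriv i fun Z => h (‖Z‖ ^ 2)) X =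
      2 * deriv h (‖X‖ ^ 2) + 4 * X i ^ 2 * deriv (deriv h) (‖X‖ ^ 2) := by
    intro i
    have h1 : (partialDeriv i fun Z => h (‖Z‖ ^ 2)) =ᶠ[𝓝 X]
        fun Z => (2 * Z i) * deriv h (‖Z‖ ^ 2) := by
      filter_upwards [hcont.eventually (hh.eventually (by simp))] with Z hZ
      exact partialDeriv_radial (hZ.differentiableAt (by norm_num)) i
    have h2 : HasFDerivAt (fun Z : EuclideanSpace ℝ (Fin n) => 2 * Z i)
        ((2 : ℝ) • (EuclideanSpace.proj i : EuclideanSpace ℝ (Fin n) →L[ℝ] ℝ)) X :=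
      (EuclideanSpace.proj i : EuclideanSpace ℝ (Fin n) →L[ℝ] ℝ).hasFDerivAt.const_mul 2
    have h3 : DifferentiableAt ℝ (fun Z : EuclideanSpace ℝ (Fin n) => deriv h (‖Z‖ ^ 2)) X :=
      DifferentiableAt.comp (g := deriv h) X hd' (contDiff_norm_sq ℝ (n := 1)).contDiffAt.differentiableAt_one
    rw [partialDeriv_congr h1, partialDeriv_mul h2.differentiableAt h3, partialDeriv_radial hd']
    have h4 : partialDeriv i (fun Z => 2 * Z i) X = 2 := by
      unfold partialDeriv; rw [h2.fderiv]; simp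
    rw [h4]; ring
  simp_rw [hder, Finset.sum_add_distrib, ← Finset.sum_mul, ← Finset.mul_sum]
  rw [EuclideanSpace.real_norm_sq_eq]
  simp only [Finset.sum_const, Finset.card_univ, Fintype.card_fin, nsmul_eq_mul]
  ring

/-- The free factor `c` lets the rule be iterated: `c = 1` for a normal extension, then `c = r⁻¹`
for its partial derivatives. -/
lemma partialDeriv_smul_of_forall {f : EuclideanSpace ℝ (Fin n) → ℝ} {r c : ℝ} (hr : r ≠ 0)
    (hf : ∀ X, f (r • X) = c * f X) (i : Fin n) (X : EuclideanSpace ℝ (Fin n)) :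
    partialDeriv i f (r • X) = r⁻¹ * c * partialDeriv i f X := by
  unfold partialDeriv
  have h1 := fderiv_comp_smul (𝕜 := ℝ) (f := f) r (x := X)
  have h2 : (fun X => f (r • X)) = fun X => c * f X := funext hf
  rw [h2] at h1
  have h3 : fderiv ℝ (fun X => c * f X) X = c • fderiv ℝ f X := by
    exact congrFun (fderiv_const_smul_field (𝕜 := ℝ) (f := f) c) X
  rw [h3] at h1
  have h4 := congrArg (fun L => L (EuclideanSpace.single i (1:ℝ))) h1
  simp only [smul_apply, smul_eq_mul] at h4
  rw [mul_assoc, h4]; field_simp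

/-! ### Functions on the sphere extended along normals -/

lemma normalExt_of_ne (u : Sph n → ℝ) {X : EuclideanSpace ℝ (Fin n)} (hX : X ≠ 0) :
    normalExt u X = u ⟨‖X‖⁻¹ • X, by
      rw [mem_sphere_zero_iff_norm, norm_smul, norm_inv, norm_norm]
      exact inv_mul_cancel₀ (norm_ne_zero_iff.mpr hX)⟩ := by
  simp [normalExt, hX]

lemma Sph.ne_zero (x : Sph n) : (x : EuclideanSpace ℝ (Fin n)) ≠ 0 := by
  intro h
  have := norm_eq_of_mem_sphere x
  rw [h] at this; simp at this

@[simp] lemma normalExt_coe (u : Sph n → ℝ) (x : Sph n) :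
    normalExt u (x : EuclideanSpace ℝ (Fin n)) = u x := by
  rw [normalExt_of_ne u x.ne_zero]
  congr 1
  ext1
  simp

lemma normalExt_smul (u : Sph n → ℝ) {r : ℝ} (hr : 0 < r) (X : EuclideanSpace ℝ (Fin n)) :
    normalExt u (r • X) = normalExt u X := by
  by_cases hX : X = 0
  · simp [hX]
  rw [normalExt_of_ne u hX, normalExt_of_ne u (smul_ne_zero hr.ne' hX)]
  congr 2
  rw [norm_smul, smul_smul, Real.norm_of_nonneg hr.le]
  field_simp

lemma isOpen_ne_zero : IsOpen {X : EuclideanSpace ℝ (Fin n) | X ≠ 0} := isOpen_ne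

lemma SphContDiff.contDiffAt {m : WithTop ℕ∞} {u : Sph n → ℝ} (hu : SphContDiff m u)
    {X : EuclideanSpace ℝ (Fin n)} (hX : X ≠ 0) : ContDiffAt ℝ m (normalExt u) X :=
  ContDiffOn.contDiffAt hu (isOpen_ne_zero.mem_nhds hX)

lemma SphContDiff.continuous {m : WithTop ℕ∞} {u : Sph n → ℝ} (hu : SphContDiff m u) :
    Continuous u := by
  have h1 : ContinuousOn (normalExt u) {X | X ≠ 0} := ContDiffOn.continuousOn hu
  have h2 := h1.comp_continuous (f := fun x : Sph n => (x : EuclideanSpace ℝ (Fin n)))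
    continuous_subtype_val (fun x => x.ne_zero)
  simpa [Function.comp_def] using h2

/-- Euler's identity in degree `0`. It kills the cross term in the Laplacian of a radial function
times a normal extension, since the gradient of a radial function is a multiple of `X`. -/
lemma fderiv_normalExt_self (u : Sph n → ℝ) (X : EuclideanSpace ℝ (Fin n))
    (hd : DifferentiableAt ℝ (normalExt u) X) : fderiv ℝ (normalExt u) X X = 0 := by
  have h1 : HasDerivAt (fun t : ℝ => normalExt u (t • X)) (fderiv ℝ (normalExt u) X X) 1 := by
    have h2 : HasDerivAt (fun t : ℝ => t • X) X 1 := by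
      simpa using (hasDerivAt_id (1:ℝ)).smul_const X
    have h3 : HasFDerivAt (normalExt u) (fderiv ℝ (normalExt u) X) ((1:ℝ) • X) := by
      rw [one_smul]; exact hd.hasFDerivAt
    exact h3.comp_hasDerivAt 1 h2
  have h2 : HasDerivAt (fun t : ℝ => normalExt u (t • X)) 0 1 := by
    refine (hasDerivAt_const (1:ℝ) (normalExt u X)).congr_of_eventuallyEq ?_
    filter_upwards [lt_mem_nhds (zero_lt_one' ℝ)] with t ht
    exact normalExt_smul u ht X
  exact h1.unique h2

lemma partialDeriv_normalExt_smul (u : Sph n → ℝ) {r : ℝ} (hr : 0 < r)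
    (i : Fin n) (X : EuclideanSpace ℝ (Fin n)) :
    partialDeriv i (normalExt u) (r • X) = r⁻¹ * partialDeriv i (normalExt u) X := by
  simpa using partialDeriv_smul_of_forall (c := 1) hr.ne'
    (fun X => by rw [normalExt_smul u hr, one_mul]) i X

lemma laplacian_normalExt_smul {u : Sph n → ℝ} (hu : SphContDiff 2 u) {r : ℝ} (hr : 0 < r)
    {X : EuclideanSpace ℝ (Fin n)} (hX : X ≠ 0) :
    Laplacian.laplacian (normalExt u) (r • X) =
      (r ^ 2)⁻¹ * Laplacian.laplacian (normalExt u) X := by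
  rw [laplacian_eq_sum_partialDeriv (hu.contDiffAt hX),
    laplacian_eq_sum_partialDeriv (hu.contDiffAt (smul_ne_zero hr.ne' hX)), Finset.mul_sum]
  refine Finset.sum_congr rfl fun i _ => ?_
  rw [partialDeriv_smul_of_forall hr.ne' (partialDeriv_normalExt_smul u hr i) i X]
  rw [← mul_inv, pow_two]

lemma sphContDiff_iff_contDiffAt {m : WithTop ℕ∞} {u : Sph n → ℝ} :
    SphContDiff m u ↔ ∀ X : EuclideanSpace ℝ (Fin n), X ≠ 0 → ContDiffAt ℝ m (normalExt u) X :=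
  ⟨fun h _ hX => h.contDiffAt hX, fun h X hX => (h X hX).contDiffWithinAt⟩

lemma contDiffAt_normalize {X : EuclideanSpace ℝ (Fin n)} (hX : X ≠ 0) :
    ContDiffAt ℝ ∞ (fun Z : EuclideanSpace ℝ (Fin n) => ‖Z‖⁻¹ • Z) X :=
  ((contDiffAt_norm ℝ hX).inv (norm_ne_zero_iff.mpr hX)).smul contDiffAt_id

/-- The restriction to the sphere of a function that is `C^m` near the sphere is `C^m`. -/
lemma sphContDiff_of_contDiffAt {m : ℕ∞} {f : EuclideanSpace ℝ (Fin n) → ℝ}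
    (hf : ∀ x : Sph n, ContDiffAt ℝ m f x) : SphContDiff m (fun x : Sph n => f x) := by
  rw [sphContDiff_iff_contDiffAt]
  intro X hX
  have h1 : normalExt (fun x : Sph n => f x) =ᶠ[𝓝 X]
      f ∘ (fun Z : EuclideanSpace ℝ (Fin n) => ‖Z‖⁻¹ • Z) := by
    filter_upwards [isOpen_ne_zero.mem_nhds hX] with Z hZ
    rw [normalExt_of_ne _ hZ]; rfl
  refine ContDiffAt.congr_of_eventuallyEq ?_ h1
  refine ContDiffAt.comp X (hf ⟨‖X‖⁻¹ • X, ?_⟩)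
    ((contDiffAt_normalize hX).of_le (by exact_mod_cast le_top))
  rw [mem_sphere_zero_iff_norm, norm_smul, norm_inv, norm_norm]
  exact inv_mul_cancel₀ (norm_ne_zero_iff.mpr hX)

lemma SphContDiff.sphLaplacian {u : Sph n → ℝ} (hu : SphContDiff ∞ u) :
    SphContDiff ∞ (sphLaplacian u) := by
  refine sphContDiff_of_contDiffAt (m := ⊤) (f := Laplacian.laplacian (normalExt u)) fun x => ?_
  have h1 : Laplacian.laplacian (normalExt u) =ᶠ[𝓝 (x : EuclideanSpace ℝ (Fin n))]
      fun X => ∑ i, partialDeriv i (partialDeriv i (normalExt u)) X := by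
    filter_upwards [isOpen_ne_zero.mem_nhds x.ne_zero] with Z hZ
    exact laplacian_eq_sum_partialDeriv ((hu.contDiffAt hZ).of_le (by norm_cast))
  refine ContDiffAt.congr_of_eventuallyEq (ContDiffAt.sum fun i _ => ?_) h1
  exact ((hu.contDiffAt x.ne_zero).partialDeriv (k := ∞) i (by simp)).partialDeriv i (by simp)

lemma continuous_sphLaplacian {u : Sph n → ℝ} (hu : SphContDiff 2 u) :
    Continuous (sphLaplacian u) := by
  rw [continuous_iff_continuousAt]
  intro x
  have h1 : Laplacian.laplacian (normalExt u) =ᶠ[𝓝 (x : EuclideanSpace ℝ (Fin n))]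
      fun X => ∑ i, partialDeriv i (partialDeriv i (normalExt u)) X := by
    filter_upwards [isOpen_ne_zero.mem_nhds x.ne_zero] with Z hZ
    exact laplacian_eq_sum_partialDeriv (hu.contDiffAt hZ)
  have h2 : ContinuousAt (Laplacian.laplacian (normalExt u)) (x : EuclideanSpace ℝ (Fin n)) := by
    refine ContinuousAt.congr_of_eventuallyEq (ContDiffAt.continuousAt (𝕜 := ℝ) (n := 0)
      (ContDiffAt.sum fun i _ => ?_)) h1
    exact ((hu.contDiffAt x.ne_zero).partialDeriv (k := 1) i (by norm_num)).partialDeriv i (by simp)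
  exact h2.comp (f := fun x : Sph n => (x : EuclideanSpace ℝ (Fin n)))
    continuous_subtype_val.continuousAt
end

/-! ### Integration over the sphere and symmetry of its Laplacian. -/

noncomputable section

variable {n : ℕ}

instance : IsFiniteMeasure (surfaceMeasure n) := by unfold surfaceMeasure; infer_instance

instance : (surfaceMeasure n).IsOpenPosMeasure := by unfold surfaceMeasure; infer_instance

lemma integrable_surfaceMeasure {f : Sph n → ℝ} (hf : Continuous f) :
    Integrable f (surfaceMeasure n) :=
  hf.integrable_of_hasCompactSupport (HasCompactSupport.of_compactSpace f)

/-- Integration in polar coordinates of a product of a radial and a spherical function. -/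
lemma integral_radial_mul_normalExt (g : ℝ → ℝ) (v : Sph n → ℝ) :
    ∫ X : EuclideanSpace ℝ (Fin n), g ‖X‖ * normalExt v X =
      (∫ r : Ioi (0 : ℝ), g r ∂Measure.volumeIoiPow (n - 1)) * ∫ x, v x ∂surfaceMeasure n := by
  -- For `n = 0` the space is one point: the sphere carries no measure, and `normalExt` takes its
  -- default value `0` at the origin, so both sides vanish.
  rcases subsingleton_or_nontrivial (EuclideanSpace ℝ (Fin n)) with hE | hE
  · have h1 : surfaceMeasure n = 0 := by
      unfold surfaceMeasure; rwa [Measure.toSphere_eq_zero_iff]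
    have h2 : ∀ X : EuclideanSpace ℝ (Fin n), g ‖X‖ * normalExt v X = 0 := fun X => by
      rw [Subsingleton.elim X 0]; simp [normalExt]
    simp [h1, h2]
  have hd : Module.finrank ℝ (EuclideanSpace ℝ (Fin n)) - 1 = n - 1 := by simp
  calc
    ∫ X : EuclideanSpace ℝ (Fin n), g ‖X‖ * normalExt v X
      = ∫ X : ({(0)}ᶜ : Set (EuclideanSpace ℝ (Fin n))), g ‖X.1‖ * normalExt v X.1
          ∂((volume : Measure (EuclideanSpace ℝ (Fin n))).comap (↑)) := by
      rw [integral_subtype_comap (measurableSet_singleton _).compl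
        fun x : EuclideanSpace ℝ (Fin n) ↦ g ‖x‖ * normalExt v x, restrict_compl_singleton]
    _ = ∫ x, v x.1 * g x.2 ∂(surfaceMeasure n).prod (.volumeIoiPow (n - 1)) := by
      have h := (volume : Measure (EuclideanSpace ℝ (Fin n))).measurePreserving_homeomorphUnitSphereProd.integral_comp
        (Homeomorph.measurableEmbedding _) (fun x => v x.1 * g x.2)
      rw [hd] at h
      rw [surfaceMeasure, ← h]
      refine integral_congr_ae (Eventually.of_forall fun X => ?_)
      have hX : X.1 ≠ 0 := X.2
      simp only [normalExt_of_ne v hX, homeomorphUnitSphereProd_apply_snd_coe]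
      rw [mul_comm]
      congr 2
      ext1
      simp
    _ = (∫ x, v x ∂surfaceMeasure n) * ∫ r : Ioi (0 : ℝ), g r ∂Measure.volumeIoiPow (n - 1) :=
      integral_prod_mul v (fun r : Ioi (0:ℝ) => g r)
    _ = _ := mul_comm _ _

lemma HasCompactSupport.partialDeriv {f : EuclideanSpace ℝ (Fin n) → ℝ} (hf : HasCompactSupport f)
    (i : Fin n) : HasCompactSupport (partialDeriv i f) :=
  hf.fderiv_apply ℝ _

lemma ContDiff.partialDeriv {m k : WithTop ℕ∞} {f : EuclideanSpace ℝ (Fin n) → ℝ}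
    (hf : ContDiff ℝ m f) (i : Fin n) (hmk : k + 1 ≤ m) : ContDiff ℝ k (partialDeriv i f) :=
  contDiff_iff_contDiffAt.mpr fun _ => hf.contDiffAt.partialDeriv i hmk

lemma integral_mul_partialDeriv {f g : EuclideanSpace ℝ (Fin n) → ℝ} (hf : ContDiff ℝ 1 f)
    (hg : ContDiff ℝ 1 g) (hfc : HasCompactSupport f) (hgc : HasCompactSupport g) (i : Fin n) :
    ∫ X, f X * partialDeriv i g X = -∫ X, partialDeriv i f X * g X := by
  refine integral_mul_fderiv_eq_neg_fderiv_mul_of_integrable ?_ ?_ ?_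
    (fun x _ => hf.differentiable (by norm_num) x) (fun x _ => hg.differentiable (by norm_num) x)
  · exact ((hf.partialDeriv (k := 0) i (by simp)).continuous.mul
      hg.continuous).integrable_of_hasCompactSupport hgc.mul_left
  · exact (hf.continuous.mul (hg.partialDeriv (k := 0) i
      (by simp)).continuous).integrable_of_hasCompactSupport hfc.mul_right
  · exact (hf.continuous.mul hg.continuous).integrable_of_hasCompactSupport hfc.mul_right

/-- Green's identity for compactly supported functions. -/
lemma integral_mul_laplacian_comm {f g : EuclideanSpace ℝ (Fin n) → ℝ} (hf : ContDiff ℝ 2 f)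
    (hg : ContDiff ℝ 2 g) (hfc : HasCompactSupport f) (hgc : HasCompactSupport g) :
    ∫ X, (f X * Laplacian.laplacian g X - g X * Laplacian.laplacian f X) = 0 := by
  have h11 : (1 : WithTop ℕ∞) + 1 ≤ 2 := by norm_num
  have h12 : (1 : WithTop ℕ∞) ≤ 2 := by norm_num
  have hpf := fun i => hf.partialDeriv (k := 1) i h11
  have hpg := fun i => hg.partialDeriv (k := 1) i h11
  have hppf := fun i => (hpf i).partialDeriv (k := 0) i (by simp)
  have hppg := fun i => (hpg i).partialDeriv (k := 0) i (by simp)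
  have hI1 : ∀ i, Integrable fun X => f X * partialDeriv i (partialDeriv i g) X := fun i =>
    (hf.continuous.mul (hppg i).continuous).integrable_of_hasCompactSupport hfc.mul_right
  have hI2 : ∀ i, Integrable fun X => g X * partialDeriv i (partialDeriv i f) X := fun i =>
    (hg.continuous.mul (hppf i).continuous).integrable_of_hasCompactSupport hgc.mul_right
  simp_rw [fun X => laplacian_eq_sum_partialDeriv (hf.contDiffAt (x := X)),
    fun X => laplacian_eq_sum_partialDeriv (hg.contDiffAt (x := X)), Finset.mul_sum,
    ← Finset.sum_sub_distrib]
  rw [integral_finsetSum _ fun i _ => show Integrable (fun X =>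
    f X * partialDeriv i (partialDeriv i g) X - g X * partialDeriv i (partialDeriv i f) X) from
      (hI1 i).sub (hI2 i)]
  refine Finset.sum_eq_zero fun i _ => ?_
  rw [integral_sub (hI1 i) (hI2 i), integral_mul_partialDeriv (hf.of_le h12) (hpg i) hfc
    (hgc.partialDeriv i), integral_mul_partialDeriv (hg.of_le h12) (hpf i) hgc (hfc.partialDeriv i)]
  simp_rw [mul_comm (partialDeriv i f _)]
  ring

/-- A smooth cutoff of the squared radius, supported away from `0` and `∞`. -/
def radialBump : ContDiffBump (1 : ℝ) := ⟨1 / 4, 1 / 2, by norm_num, by norm_num⟩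

lemma radialBump_eq_zero {w : ℝ} (hw : w ≤ 1 / 2 ∨ 3 / 2 ≤ w) : radialBump w = 0 := by
  apply radialBump.zero_of_le_dist
  rw [Real.dist_eq]
  change (1 / 2 : ℝ) ≤ _
  rcases hw with hw | hw
  · rw [abs_of_nonpos (by linarith)]; linarith
  · rw [abs_of_nonneg (by linarith)]; linarith

/-- A normal extension is in general singular at the origin, but the cutoff vanishes for `‖X‖² ≤
1/2`. -/
lemma contDiff_radialBump_mul {u : Sph n → ℝ} {m : ℕ∞} (hu : SphContDiff m u) :
    ContDiff ℝ m fun X : EuclideanSpace ℝ (Fin n) => radialBump (‖X‖ ^ 2) * normalExt u X := by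
  rw [contDiff_iff_contDiffAt]
  intro X
  by_cases hX : X = 0
  · have h1 : (fun X : EuclideanSpace ℝ (Fin n) => radialBump (‖X‖ ^ 2) * normalExt u X) =ᶠ[𝓝 X]
        fun _ => 0 := by
      have : Tendsto (fun Z : EuclideanSpace ℝ (Fin n) => ‖Z‖ ^ 2) (𝓝 X) (𝓝 (‖X‖ ^ 2)) :=
        (by fun_prop : Continuous fun Z : EuclideanSpace ℝ (Fin n) => ‖Z‖ ^ 2).tendsto X
      rw [hX] at this ⊢
      have h3 : ‖(0 : EuclideanSpace ℝ (Fin n))‖ ^ 2 < 1 / 2 := by norm_num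
      filter_upwards [this.eventually (gt_mem_nhds h3)] with Z hZ
      rw [radialBump_eq_zero (Or.inl hZ.le), zero_mul]
    exact contDiffAt_const.congr_of_eventuallyEq h1
  · exact (radialBump.contDiff.contDiffAt.radial).mul (hu.contDiffAt hX)

lemma hasCompactSupport_radialBump_mul (u : EuclideanSpace ℝ (Fin n) → ℝ) :
    HasCompactSupport fun X : EuclideanSpace ℝ (Fin n) => radialBump (‖X‖ ^ 2) * u X := by
  refine HasCompactSupport.intro (isCompact_closedBall (0 : EuclideanSpace ℝ (Fin n)) 2) fun X hX => ?_
  rw [mem_closedBall_zero_iff, not_le] at hX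
  rw [radialBump_eq_zero (Or.inr (by nlinarith)), zero_mul]

/-- The radial weight appearing in the proof of symmetry of the spherical Laplacian. -/
lemma volumeIoiPow_integral_ne_zero (hn : 2 ≤ n) :
    (∫ r : Ioi (0 : ℝ), radialBump ((r : ℝ) ^ 2) ^ 2 * ((r : ℝ) ^ 2)⁻¹
      ∂Measure.volumeIoiPow (n - 1)) ≠ 0 := by
  intro h0
  -- Polar coordinates with `v = 1`: the radial integral times the area of the sphere is the
  -- integral over `ℝⁿ` of a continuous nonnegative function that equals `1` at a unit vector.
  have h1 := integral_radial_mul_normalExt (n := n)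
    (fun r => radialBump (r ^ 2) ^ 2 * (r ^ 2)⁻¹) (fun _ => 1)
  rw [h0, zero_mul] at h1
  have hE : ∀ X : EuclideanSpace ℝ (Fin n), (radialBump (‖X‖ ^ 2) ^ 2 * (‖X‖ ^ 2)⁻¹) *
      normalExt (fun _ => (1 : ℝ)) X = radialBump (‖X‖ ^ 2) ^ 2 * (‖X‖ ^ 2)⁻¹ := by
    intro X
    by_cases hX : X = 0
    · simp [hX]
    · rw [normalExt_of_ne _ hX, mul_one]
  simp_rw [hE] at h1
  have hcs : HasCompactSupport fun X : EuclideanSpace ℝ (Fin n) =>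
      radialBump (‖X‖ ^ 2) ^ 2 * (‖X‖ ^ 2)⁻¹ := by
    simp_rw [pow_two (radialBump _), mul_assoc]
    exact hasCompactSupport_radialBump_mul _
  have hcont : Continuous fun X : EuclideanSpace ℝ (Fin n) =>
      radialBump (‖X‖ ^ 2) ^ 2 * (‖X‖ ^ 2)⁻¹ := by
    rw [continuous_iff_continuousAt]
    intro X
    by_cases hX : X = 0
    · have h1 : (fun X : EuclideanSpace ℝ (Fin n) => radialBump (‖X‖ ^ 2) ^ 2 * (‖X‖ ^ 2)⁻¹) =ᶠ[𝓝 X]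
          fun _ => 0 := by
        have : Tendsto (fun Z : EuclideanSpace ℝ (Fin n) => ‖Z‖ ^ 2) (𝓝 X) (𝓝 (‖X‖ ^ 2)) :=
          (by fun_prop : Continuous fun Z : EuclideanSpace ℝ (Fin n) => ‖Z‖ ^ 2).tendsto X
        rw [hX] at this ⊢
        have h3 : ‖(0 : EuclideanSpace ℝ (Fin n))‖ ^ 2 < 1 / 2 := by norm_num
        filter_upwards [this.eventually (gt_mem_nhds h3)] with Z hZ
        rw [radialBump_eq_zero (Or.inl hZ.le)]; simp
      exact continuousAt_const.congr h1.symm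
    · refine ContinuousAt.mul (((radialBump.continuous.comp (by fun_prop :
        Continuous fun Z : EuclideanSpace ℝ (Fin n) => ‖Z‖ ^ 2)).pow 2).continuousAt) ?_
      exact ContinuousAt.inv₀ (by fun_prop) (by simpa using hX)
  have hpos : 0 < ∫ X : EuclideanSpace ℝ (Fin n), radialBump (‖X‖ ^ 2) ^ 2 * (‖X‖ ^ 2)⁻¹ := by
    refine hcont.integral_pos_of_hasCompactSupport_nonneg_nonzero hcs
      (fun X => by positivity) (x := EuclideanSpace.single ⟨0, by omega⟩ 1) ?_
    have : radialBump 1 = 1 := radialBump.one_of_mem_closedBall (by simp [radialBump])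
    simp [this]
  exact hpos.ne' h1

/-- The Laplacian on the sphere is symmetric. -/
theorem integral_mul_sphLaplacian_comm (hn : 2 ≤ n) {u v : Sph n → ℝ} (hu : SphContDiff 2 u)
    (hv : SphContDiff 2 v) :
    ∫ x, u x * sphLaplacian v x ∂surfaceMeasure n = ∫ x, v x * sphLaplacian u x ∂surfaceMeasure n := by
  have hfu := contDiff_radialBump_mul (m := 2) hu
  have hfv := contDiff_radialBump_mul (m := 2) hv
  have h1 := integral_mul_laplacian_comm hfu hfv (hasCompactSupport_radialBump_mul _)
    (hasCompactSupport_radialBump_mul _)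
  -- Product rule for cutoff times extension: the cross term vanishes by `fderiv_normalExt_self`,
  -- and the Laplacian of the extension is homogeneous of degree `-2`.
  have hlap : ∀ {w : Sph n → ℝ}, SphContDiff 2 w → ∀ {X : EuclideanSpace ℝ (Fin n)}, X ≠ 0 →
      Laplacian.laplacian (fun X => radialBump (‖X‖ ^ 2) * normalExt w X) X =
      radialBump (‖X‖ ^ 2) * ((‖X‖ ^ 2)⁻¹ * normalExt (sphLaplacian w) X) +
      normalExt w X * Laplacian.laplacian (fun X : EuclideanSpace ℝ (Fin n) => radialBump (‖X‖ ^ 2)) X := by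
    intro w hw X hX
    rw [laplacian_mul (radialBump.contDiff.contDiffAt.radial) (hw.contDiffAt hX)]
    have h2 : ∑ i, partialDeriv i (fun X => radialBump (‖X‖ ^ 2)) X * partialDeriv i (normalExt w) X = 0 := by
      have h3 : ∀ i, partialDeriv i (fun X => radialBump (‖X‖ ^ 2)) X * partialDeriv i (normalExt w) X =
          2 * deriv radialBump (‖X‖ ^ 2) * (X i * partialDeriv i (normalExt w) X) := fun i => by
        rw [partialDeriv_radial
          ((radialBump.contDiff (n := 1)).differentiable (by norm_num) _)]; ring
      simp_rw [h3]
      rw [← Finset.mul_sum, sum_mul_partialDeriv,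
        fderiv_normalExt_self _ _ ((hw.contDiffAt hX).differentiableAt (by norm_num)), mul_zero]
    have hX' : 0 < ‖X‖ := norm_pos_iff.mpr hX
    have h4 : Laplacian.laplacian (normalExt w) X = (‖X‖ ^ 2)⁻¹ * normalExt (sphLaplacian w) X := by
      have h5 := laplacian_normalExt_smul hw hX' (X := ‖X‖⁻¹ • X)
        (smul_ne_zero (inv_ne_zero hX'.ne') hX)
      rw [smul_inv_smul₀ hX'.ne'] at h5
      rw [h5, normalExt_of_ne _ hX]; rfl
    rw [h2, h4]; ring
  -- The terms with the Laplacian of the cutoff are symmetric in `u` and `v` and cancel. What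
  -- remains is a radial weight times a function on the sphere, so the integral factors.
  have h2 : ∀ X : EuclideanSpace ℝ (Fin n),
      (radialBump (‖X‖ ^ 2) * normalExt u X) *
        Laplacian.laplacian (fun X => radialBump (‖X‖ ^ 2) * normalExt v X) X -
      (radialBump (‖X‖ ^ 2) * normalExt v X) *
        Laplacian.laplacian (fun X => radialBump (‖X‖ ^ 2) * normalExt u X) X =
      (radialBump (‖X‖ ^ 2) ^ 2 * (‖X‖ ^ 2)⁻¹) *
        normalExt (fun x => u x * sphLaplacian v x - v x * sphLaplacian u x) X := by
    intro X
    by_cases hX : X = 0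
    · simp [hX, normalExt]
    rw [hlap hu hX, hlap hv hX]
    simp only [normalExt_of_ne _ hX]
    ring
  simp_rw [h2] at h1
  rw [integral_radial_mul_normalExt (fun r => radialBump (r ^ 2) ^ 2 * (r ^ 2)⁻¹)] at h1
  have h3 := (mul_eq_zero.mp h1).resolve_left (volumeIoiPow_integral_ne_zero hn)
  rw [integral_sub (integrable_surfaceMeasure (hu.continuous.fun_mul (continuous_sphLaplacian hv)))
    (integrable_surfaceMeasure (hv.continuous.fun_mul (continuous_sphLaplacian hu)))] at h3
  linarith
end

noncomputable section

variable {n : ℕ}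

/-! ### Polynomials as functions on `ℝⁿ` -/

/-- The polynomial function on `ℝⁿ` defined by a polynomial. -/
def polyFun (p : MvPolynomial (Fin n) ℝ) (X : EuclideanSpace ℝ (Fin n)) : ℝ :=
  MvPolynomial.eval (fun i => X i) p

/-- The formal Laplacian of a polynomial. -/
def polyLaplacian : MvPolynomial (Fin n) ℝ →ₗ[ℝ] MvPolynomial (Fin n) ℝ :=
  ∑ i, (MvPolynomial.pderiv i).toLinearMap ∘ₗ (MvPolynomial.pderiv i).toLinearMap

lemma polyLaplacian_apply (p : MvPolynomial (Fin n) ℝ) :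
    polyLaplacian p = ∑ i, MvPolynomial.pderiv i (MvPolynomial.pderiv i p) := by
  simp [polyLaplacian]

lemma hasFDerivAt_polyFun (p : MvPolynomial (Fin n) ℝ) (X : EuclideanSpace ℝ (Fin n)) :
    HasFDerivAt (polyFun p) (∑ i, polyFun (MvPolynomial.pderiv i p) X •
      (EuclideanSpace.proj i : EuclideanSpace ℝ (Fin n) →L[ℝ] ℝ)) X := by
  induction p using MvPolynomial.induction_on with
  | C a =>
    have : polyFun (MvPolynomial.C a : MvPolynomial (Fin n) ℝ) = fun _ => a := by
      ext X; simp [polyFun]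
    rw [this]
    simpa [polyFun] using hasFDerivAt_const a X
  | add p q hp hq =>
    have : polyFun (p + q) = fun X => polyFun p X + polyFun q X := by ext X; simp [polyFun]
    rw [this]
    refine (hp.fun_add hq).congr_fderiv ?_
    ext Z
    simp [polyFun, add_mul, Finset.sum_add_distrib]
  | mul_X p j hp =>
    have : polyFun (p * MvPolynomial.X j) = fun X => polyFun p X * X j := by ext X; simp [polyFun]
    rw [this]
    have hj : HasFDerivAt (fun X : EuclideanSpace ℝ (Fin n) => X j)
      (EuclideanSpace.proj j : EuclideanSpace ℝ (Fin n) →L[ℝ] ℝ) X :=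
      (EuclideanSpace.proj j : EuclideanSpace ℝ (Fin n) →L[ℝ] ℝ).hasFDerivAt
    refine (hp.fun_mul hj).congr_fderiv ?_
    ext Z
    have h1 : ∀ i, polyFun (MvPolynomial.pderiv i (p * MvPolynomial.X j)) X * Z i =
        (if i = j then polyFun p X * Z i else 0) +
          X j * (polyFun (MvPolynomial.pderiv i p) X * Z i) := by
      intro i
      by_cases hij : i = j
      · subst hij; simp [polyFun]; ring
      · simp [polyFun, MvPolynomial.pderiv_X_of_ne (Ne.symm hij), hij]; ring
    symm
    calc _ = ∑ i, polyFun (MvPolynomial.pderiv i (p * MvPolynomial.X j)) X * Z i := by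
            simp only [sum_apply, smul_apply, EuclideanSpace.coe_proj,
              smul_eq_mul]
      _ = _ := by
            simp only [h1, Finset.sum_add_distrib]
            simp [Finset.mul_sum]

lemma partialDeriv_polyFun (p : MvPolynomial (Fin n) ℝ) (i : Fin n) :
    partialDeriv i (polyFun p) = polyFun (MvPolynomial.pderiv i p) := by
  ext X
  unfold partialDeriv
  rw [(hasFDerivAt_polyFun p X).fderiv]
  simp

lemma contDiff_polyFun {m : WithTop ℕ∞} (p : MvPolynomial (Fin n) ℝ) : ContDiff ℝ m (polyFun p) := by
  induction p using MvPolynomial.induction_on with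
  | C a =>
    have : polyFun (MvPolynomial.C a : MvPolynomial (Fin n) ℝ) = fun _ => a := by
      ext X; simp [polyFun]
    rw [this]; exact contDiff_const
  | add p q hp hq =>
    have : polyFun (p + q) = fun X => polyFun p X + polyFun q X := by ext X; simp [polyFun]
    rw [this]; exact hp.add hq
  | mul_X p j hp =>
    have : polyFun (p * MvPolynomial.X j) = fun X => polyFun p X * X j := by ext X; simp [polyFun]
    rw [this]
    exact hp.mul (EuclideanSpace.proj j : EuclideanSpace ℝ (Fin n) →L[ℝ] ℝ).contDiff

lemma laplacian_polyFun (p : MvPolynomial (Fin n) ℝ) :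
    Laplacian.laplacian (polyFun p) = polyFun (polyLaplacian p) := by
  ext X
  rw [laplacian_eq_sum_partialDeriv (contDiff_polyFun p).contDiffAt, polyLaplacian_apply]
  simp_rw [partialDeriv_polyFun]
  simp [polyFun]

lemma polyFun_injective : Function.Injective (polyFun : MvPolynomial (Fin n) ℝ → _) := by
  intro p q h
  refine MvPolynomial.funext fun x => ?_
  exact congrFun h (WithLp.toLp 2 x)

lemma polyFun_smul {p : MvPolynomial (Fin n) ℝ} {k : ℕ} (hp : p.IsHomogeneous k) (r : ℝ)
    (X : EuclideanSpace ℝ (Fin n)) : polyFun p (r • X) = r ^ k * polyFun p X := by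
  unfold polyFun
  rw [MvPolynomial.eval_eq, MvPolynomial.eval_eq, Finset.mul_sum]
  refine Finset.sum_congr rfl fun d hd => ?_
  have h1 : d.degree = k := by
    have := hp (MvPolynomial.mem_support_iff.mp hd)
    rw [Finsupp.degree_eq_weight_one]; exact this
  simp only [PiLp.smul_apply, smul_eq_mul, mul_pow, Finset.prod_mul_distrib]
  rw [Finset.prod_pow_eq_pow_sum]
  have h2 : ∑ i ∈ d.support, d i = k := h1
  rw [h2]; ring

lemma polyFun_eq_norm_pow_mul {p : MvPolynomial (Fin n) ℝ} {k : ℕ} (hp : p.IsHomogeneous k)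
    {X : EuclideanSpace ℝ (Fin n)} (hX : X ≠ 0) :
    polyFun p X = ‖X‖ ^ k * normalExt (fun x : Sph n => polyFun p x) X := by
  rw [normalExt_of_ne _ hX, ← polyFun_smul hp, smul_inv_smul₀ (norm_ne_zero_iff.mpr hX)]

lemma sphContDiff_polyFun {m : ℕ∞} (p : MvPolynomial (Fin n) ℝ) :
    SphContDiff m (fun x : Sph n => polyFun p x) :=
  sphContDiff_of_contDiffAt fun _ => (contDiff_polyFun p).contDiffAt

/-- Near the sphere `p` is `|X|^k` times the normal extension of its restriction, and the cross term
of the product rule vanishes. The eigenvalue is `Δ|X|^k` at `|X| = 1`, obtained from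
`laplacian_radial` by writing `|X|^k = h(|X|²)` with `h(w) = w^(k/2)`. -/
lemma sphLaplacian_polyFun {p : MvPolynomial (Fin n) ℝ} {k : ℕ} (hp : p.IsHomogeneous k)
    (x : Sph n) : sphLaplacian (fun x : Sph n => polyFun p x) x =
      polyFun (polyLaplacian p) x - sphEigenvalue n k * polyFun p x := by
  set h : ℝ → ℝ := fun w => w ^ ((k : ℝ) / 2) with hh
  have hx1 : ‖(x : EuclideanSpace ℝ (Fin n))‖ = 1 := norm_eq_of_mem_sphere x
  have hhd : ContDiffAt ℝ 2 h (‖(x : EuclideanSpace ℝ (Fin n))‖ ^ 2) := by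
    rw [hx1, one_pow]
    exact Real.contDiffAt_rpow_const_of_ne one_ne_zero
  have hu := sphContDiff_polyFun (m := 2) p
  have h1 : polyFun p =ᶠ[𝓝 (x : EuclideanSpace ℝ (Fin n))]
      fun X => h (‖X‖ ^ 2) * normalExt (fun x : Sph n => polyFun p x) X := by
    filter_upwards [isOpen_ne_zero.mem_nhds x.ne_zero] with Z hZ
    rw [polyFun_eq_norm_pow_mul hp hZ, hh]
    congr 1
    simp only
    rw [← Real.rpow_natCast ‖Z‖ 2, ← Real.rpow_mul (norm_nonneg _), ← Real.rpow_natCast]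
    congr 1; push_cast; ring
  have h2 : ∑ i, partialDeriv i (fun X => h (‖X‖ ^ 2)) (x : EuclideanSpace ℝ (Fin n)) *
      partialDeriv i (normalExt (fun x : Sph n => polyFun p x)) x = 0 := by
    have h3 : ∀ i, partialDeriv i (fun X => h (‖X‖ ^ 2)) (x : EuclideanSpace ℝ (Fin n)) *
        partialDeriv i (normalExt (fun x : Sph n => polyFun p x)) x =
        2 * deriv h (‖(x : EuclideanSpace ℝ (Fin n))‖ ^ 2) *
          ((x : EuclideanSpace ℝ (Fin n)) i *
            partialDeriv i (normalExt (fun x : Sph n => polyFun p x)) x) := fun i => by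
      rw [partialDeriv_radial (hhd.differentiableAt (by norm_num))]; ring
    simp_rw [h3]
    rw [← Finset.mul_sum, sum_mul_partialDeriv,
      fderiv_normalExt_self _ _ ((hu.contDiffAt x.ne_zero).differentiableAt (by norm_num)), mul_zero]
  have hd1 : ∀ w : ℝ, 0 < w → deriv h w = (k : ℝ) / 2 * w ^ ((k : ℝ) / 2 - 1) := fun w hw =>
    (Real.hasDerivAt_rpow_const (Or.inl hw.ne')).deriv
  have hd2 : deriv (deriv h) 1 = (k : ℝ) / 2 * ((k : ℝ) / 2 - 1) := by
    have : deriv h =ᶠ[𝓝 1] fun w => (k : ℝ) / 2 * w ^ ((k : ℝ) / 2 - 1) := by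
      filter_upwards [lt_mem_nhds one_pos] with w hw using hd1 w hw
    rw [this.deriv_eq, ((Real.hasDerivAt_rpow_const (Or.inl one_ne_zero)).const_mul _).deriv]
    simp
  rw [← laplacian_polyFun, (InnerProductSpace.laplacian_congr_nhds h1).eq_of_nhds,
    laplacian_mul hhd.radial (hu.contDiffAt x.ne_zero), h2, laplacian_radial hhd, hx1, one_pow,
    hd1 1 one_pos, hd2, normalExt_coe]
  simp only [hh, Real.one_rpow, sphEigenvalue, sphLaplacian]
  ring

/-! ### Spherical harmonics -/

lemma mem_sphericalHarmonics_iff {k : ℕ} {f : Sph n → ℝ} : f ∈ sphericalHarmonics n k ↔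
    ∃ p : MvPolynomial (Fin n) ℝ, p.IsHomogeneous k ∧ polyLaplacian p = 0 ∧
      f = fun x : Sph n => polyFun p x := by
  constructor
  · rintro ⟨p, hp, hp', hf⟩
    exact ⟨p, hp, by rw [polyLaplacian_apply, hp'], funext hf⟩
  · rintro ⟨p, hp, hp', hf⟩
    exact ⟨p, hp, by rw [← polyLaplacian_apply, hp'], fun x => congrFun hf x⟩

lemma sphContDiff_of_mem {m : ℕ∞} {k : ℕ} {f : Sph n → ℝ} (hf : f ∈ sphericalHarmonics n k) :
    SphContDiff m f := by
  obtain ⟨p, -, -, rfl⟩ := mem_sphericalHarmonics_iff.mp hf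
  exact sphContDiff_polyFun p

lemma continuous_of_mem {k : ℕ} {f : Sph n → ℝ} (hf : f ∈ sphericalHarmonics n k) :
    Continuous f := (sphContDiff_of_mem (m := 0) hf).continuous

lemma sphLaplacian_of_mem {k : ℕ} {f : Sph n → ℝ} (hf : f ∈ sphericalHarmonics n k) (x : Sph n) :
    sphLaplacian f x = -sphEigenvalue n k * f x := by
  obtain ⟨p, hp, hp', rfl⟩ := mem_sphericalHarmonics_iff.mp hf
  rw [sphLaplacian_polyFun hp, hp']
  simp [polyFun]

/-- Source of all decay in `k`: it converts powers of the eigenvalue into powers of `k`, and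
`exp(-√λ_k y/2)` into `exp(-ky/2)`. -/
lemma sq_le_sphEigenvalue (hn : 2 ≤ n) (k : ℕ) : (k : ℝ) ^ 2 ≤ sphEigenvalue n k := by
  unfold sphEigenvalue
  have h1 : (2 : ℝ) ≤ n := by exact_mod_cast hn
  have h2 : (0 : ℝ) ≤ k := k.cast_nonneg
  nlinarith

lemma sphEigenvalue_nonneg (hn : 2 ≤ n) (k : ℕ) : 0 ≤ sphEigenvalue n k :=
  (sq_nonneg _).trans (sq_le_sphEigenvalue hn k)

lemma sphEigenvalue_strictMono (hn : 2 ≤ n) : StrictMono (sphEigenvalue n) := by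
  intro j k hjk
  unfold sphEigenvalue
  have h1 : (2 : ℝ) ≤ n := by exact_mod_cast hn
  have h2 : (0 : ℝ) ≤ j := j.cast_nonneg
  have h3 : (j : ℝ) < k := by exact_mod_cast hjk
  nlinarith

/-- Symmetry of the Laplacian tested against a spherical harmonic. -/
lemma integral_sphLaplacian_mul_of_mem (hn : 2 ≤ n) {k : ℕ} {u f : Sph n → ℝ}
    (hu : SphContDiff 2 u) (hf : f ∈ sphericalHarmonics n k) :
    ∫ x, sphLaplacian u x * f x ∂surfaceMeasure n =
      -sphEigenvalue n k * ∫ x, u x * f x ∂surfaceMeasure n := by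
  have h1 := integral_mul_sphLaplacian_comm hn hu (sphContDiff_of_mem (m := 2) hf)
  simp_rw [sphLaplacian_of_mem hf] at h1
  simp_rw [mul_comm (sphLaplacian u _)]
  rw [← h1, ← integral_const_mul]
  congr 1; ext x; ring

/-- Spherical harmonics of different degrees are orthogonal. -/
lemma integral_mul_eq_zero_of_mem (hn : 2 ≤ n) {j k : ℕ} (hjk : j ≠ k) {f g : Sph n → ℝ}
    (hf : f ∈ sphericalHarmonics n j) (hg : g ∈ sphericalHarmonics n k) :
    ∫ x, f x * g x ∂surfaceMeasure n = 0 := by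
  have h1 := integral_sphLaplacian_mul_of_mem hn (sphContDiff_of_mem (m := 2) hf) hg
  simp_rw [sphLaplacian_of_mem hf, mul_assoc] at h1
  rw [integral_const_mul] at h1
  have h2 : sphEigenvalue n j ≠ sphEigenvalue n k := (sphEigenvalue_strictMono hn).injective.ne hjk
  have h3 : (sphEigenvalue n j - sphEigenvalue n k) * ∫ x, f x * g x ∂surfaceMeasure n = 0 := by
    linarith
  exact (mul_eq_zero.mp h3).resolve_left (sub_ne_zero.mpr h2)

lemma eq_zero_of_integral_sq_eq_zero {f : Sph n → ℝ} (hf : Continuous f)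
    (h : ∫ x, f x * f x ∂surfaceMeasure n = 0) : f = 0 := by
  have hc : Continuous fun x => f x * f x := hf.mul hf
  have h1 := (integral_eq_zero_iff_of_nonneg (fun x => mul_self_nonneg (f x))
    (integrable_surfaceMeasure hc)).mp h
  have h2 := Measure.eq_of_ae_eq h1 hc (continuous_const (y := (0 : ℝ)))
  ext x
  exact mul_self_eq_zero.mp (congrFun h2 x)

/-- Homogeneity carries the zeros from the sphere to every `X ≠ 0`; continuity and density cover the
origin. -/
lemma polyFun_eq_zero_of_sphere {p : MvPolynomial (Fin n) ℝ} {k : ℕ} (hn : 2 ≤ n)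
    (hp : p.IsHomogeneous k) (h : ∀ x : Sph n, polyFun p x = 0) : p = 0 := by
  have : NeZero n := ⟨by omega⟩
  refine polyFun_injective ?_
  have h1 : ∀ X : EuclideanSpace ℝ (Fin n), X ≠ 0 → polyFun p X = 0 := by
    intro X hX
    rw [polyFun_eq_norm_pow_mul hp hX, normalExt_of_ne _ hX, h, mul_zero]
  have hc : Continuous (polyFun p) := (contDiff_polyFun (m := 0) p).continuous
  have : Nontrivial (EuclideanSpace ℝ (Fin n)) := by
    refine ⟨EuclideanSpace.single 0 1, 0, fun h => ?_⟩
    have := congrArg norm h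
    simp at this
  have h2 : Dense {X : EuclideanSpace ℝ (Fin n) | X ≠ 0} := dense_compl_singleton 0
  have h3 := Continuous.ext_on h2 hc (continuous_const (y := (0 : ℝ))) (fun X hX => h1 X hX)
  rw [h3]; ext X; simp [polyFun]

/-- The polynomial `|X|²`. -/
def normSqPoly (n : ℕ) : MvPolynomial (Fin n) ℝ := ∑ i, MvPolynomial.X i ^ 2

lemma isHomogeneous_normSqPoly : (normSqPoly n).IsHomogeneous 2 :=
  MvPolynomial.IsHomogeneous.sum _ _ _ fun i _ => MvPolynomial.isHomogeneous_X_pow i 2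

lemma polyFun_mul (p q : MvPolynomial (Fin n) ℝ) (X : EuclideanSpace ℝ (Fin n)) :
    polyFun (p * q) X = polyFun p X * polyFun q X := by simp [polyFun]

lemma polyFun_sub (p q : MvPolynomial (Fin n) ℝ) (X : EuclideanSpace ℝ (Fin n)) :
    polyFun (p - q) X = polyFun p X - polyFun q X := by simp [polyFun]

lemma polyFun_normSqPoly_sphere (x : Sph n) : polyFun (normSqPoly n) x = 1 := by
  have := EuclideanSpace.real_norm_sq_eq (x : EuclideanSpace ℝ (Fin n))
  rw [norm_eq_of_mem_sphere x, one_pow] at this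
  simp [polyFun, normSqPoly, ← this]

/-- The truncated `k - 2` is harmless: for `k < 2` the Laplacian is `0`, which is homogeneous of
every degree. -/
lemma MvPolynomial.IsHomogeneous.polyLaplacian {p : MvPolynomial (Fin n) ℝ} {k : ℕ}
    (hp : p.IsHomogeneous k) : (polyLaplacian p).IsHomogeneous (k - 2) := by
  rw [polyLaplacian_apply]
  exact MvPolynomial.IsHomogeneous.sum _ _ _ fun i _ => hp.pderiv.pderiv

/-- Every homogeneous polynomial restricts to a sum of spherical harmonics. -/
lemma polyFun_mem_iSup_sphericalHarmonics (hn : 2 ≤ n) (k : ℕ) (p : MvPolynomial (Fin n) ℝ)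
    (hp : p.IsHomogeneous k) :
    (fun x : Sph n => polyFun p x) ∈ ⨆ j ∈ Finset.range (k + 1), sphericalHarmonics n j := by
  induction k using Nat.strong_induction_on generalizing p with
  | _ k ih =>
  have hself : ∀ q : MvPolynomial (Fin n) ℝ, q.IsHomogeneous k → polyLaplacian q = 0 →
      (fun x : Sph n => polyFun q x) ∈ ⨆ j ∈ Finset.range (k + 1), sphericalHarmonics n j := by
    intro q hq hq0
    exact Submodule.mem_iSup_of_mem k (Submodule.mem_iSup_of_mem (by simp)
      (mem_sphericalHarmonics_iff.mpr ⟨q, hq, hq0, rfl⟩))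
  rcases Nat.lt_or_ge k 2 with hk | hk
  · refine hself p hp ?_
    rw [polyLaplacian_apply]
    refine Finset.sum_eq_zero fun i _ => ?_
    have h1 : (MvPolynomial.pderiv i p).IsHomogeneous 0 := by
      have := hp.pderiv (i := i)
      rwa [show k - 1 = 0 by omega] at this
    have h2 := MvPolynomial.totalDegree_eq_zero_iff_eq_C.mp (Nat.le_zero.mp h1.totalDegree_le)
    rw [h2, MvPolynomial.pderiv_C]
  obtain ⟨m, rfl⟩ : ∃ m, k = m + 2 := ⟨k - 2, by omega⟩
  have hmul : ∀ q : MvPolynomial (Fin n) ℝ, q.IsHomogeneous m →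
      (normSqPoly n * q).IsHomogeneous (m + 2) := fun q hq => by
    rw [add_comm]; exact isHomogeneous_normSqPoly.mul hq
  -- With `T q = Δ(|X|² q)` surjective, some `r` satisfies `Δ(|X|² r) = Δp`; then `p - |X|² r` is
  -- harmonic, and `|X|² r` restricts to `r`, of lower degree. In finite dimension injectivity of
  -- `T` is enough.
  let T : MvPolynomial.homogeneousSubmodule (Fin n) ℝ m →ₗ[ℝ]
      MvPolynomial.homogeneousSubmodule (Fin n) ℝ m :=
    LinearMap.restrict (polyLaplacian ∘ₗ LinearMap.mulLeft ℝ (normSqPoly n))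
      (fun q hq => (hmul q hq).polyLaplacian)
  have hT : ∀ q : MvPolynomial.homogeneousSubmodule (Fin n) ℝ m, ((T q : MvPolynomial.homogeneousSubmodule (Fin n) ℝ m) : MvPolynomial (Fin n) ℝ) =
      polyLaplacian (normSqPoly n * q.1) := fun q => rfl
  -- If `Δ(|X|² q) = 0`, the restriction of `q` is a spherical harmonic of degree `m + 2`, while by
  -- induction it is a sum of harmonics of degree at most `m`. It is therefore orthogonal to itself.
  have hinj : Function.Injective T := by
    rw [← LinearMap.ker_eq_bot, LinearMap.ker_eq_bot']
    rintro ⟨q, hq⟩ hq0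
    have hq' : q.IsHomogeneous m := hq
    have h1 : polyLaplacian (normSqPoly n * q) = 0 := by
      have := hT ⟨q, hq⟩
      rw [hq0] at this
      exact this.symm
    have hf : (fun x : Sph n => polyFun q x) ∈ sphericalHarmonics n (m + 2) :=
      mem_sphericalHarmonics_iff.mpr ⟨_, hmul q hq, h1, by
        ext x; rw [polyFun_mul, polyFun_normSqPoly_sphere, one_mul]⟩
    have horth : ∀ g ∈ ⨆ j ∈ Finset.range (m + 1), sphericalHarmonics n j,
        Continuous g ∧ ∫ x, polyFun q x * g x ∂surfaceMeasure n = 0 := by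
      intro g hg
      induction hg using Submodule.iSup_induction' with
      | mem j g hg =>
        by_cases hj : j ∈ Finset.range (m + 1)
        · simp only [hj, iSup_pos] at hg
          refine ⟨continuous_of_mem hg, integral_mul_eq_zero_of_mem hn ?_ hf hg⟩
          simp at hj; omega
        · simp only [hj, not_false_eq_true, iSup_neg, Submodule.mem_bot] at hg
          subst hg
          exact ⟨continuous_const, by simp⟩
      | zero => exact ⟨continuous_const, by simp⟩
      | add g₁ g₂ _ _ h₁ h₂ =>
        refine ⟨h₁.1.add h₂.1, ?_⟩
        have hqc := continuous_of_mem hf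
        simp only [Pi.add_apply, mul_add]
        rw [integral_add (integrable_surfaceMeasure (hqc.fun_mul h₁.1))
          (integrable_surfaceMeasure (hqc.fun_mul h₂.1)), h₁.2, h₂.2, add_zero]
    have h2 := (horth _ (ih m (by omega) q hq')).2
    have h3 := eq_zero_of_integral_sq_eq_zero (continuous_of_mem hf) h2
    have h4 := polyFun_eq_zero_of_sphere hn hq' (fun x => congrFun h3 x)
    exact Subtype.ext h4
  have : Module.Finite ℝ (MvPolynomial.homogeneousSubmodule (Fin n) ℝ m) :=
    Module.Finite.iff_fg.mpr (MvPolynomial.homogeneousSubmodule_fg (σ := Fin n) (R := ℝ) m)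
  obtain ⟨⟨r, hr⟩, hr'⟩ := (LinearMap.injective_iff_surjective.mp hinj)
    ⟨polyLaplacian p, hp.polyLaplacian⟩
  have hr1 : r.IsHomogeneous m := hr
  have hr2 : polyLaplacian (normSqPoly n * r) = polyLaplacian p := by
    rw [← hT ⟨r, hr⟩, hr']
  have h1 := hself (p - normSqPoly n * r) (hp.sub (hmul r hr1)) (by rw [map_sub, hr2, sub_self])
  have h2 := ih m (by omega) r hr1
  have h3 : (⨆ j ∈ Finset.range (m + 1), sphericalHarmonics n j) ≤
      ⨆ j ∈ Finset.range (m + 2 + 1), sphericalHarmonics n j :=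
    biSup_mono fun j hj => by simp at hj ⊢; omega
  have h4 : (fun x : Sph n => polyFun p x) =
      (fun x : Sph n => polyFun (p - normSqPoly n * r) x) + fun x : Sph n => polyFun r x := by
    ext x
    simp [polyFun_sub, polyFun_mul, polyFun_normSqPoly_sphere]
  rw [h4]
  exact Submodule.add_mem _ h1 (h3 h2)

/-- A continuous function orthogonal to all spherical harmonics vanishes. -/
theorem eq_zero_of_forall_integral_mul_eq_zero (hn : 2 ≤ n) {w : Sph n → ℝ} (hw : Continuous w)
    (h : ∀ k, ∀ f ∈ sphericalHarmonics n k, ∫ x, w x * f x ∂surfaceMeasure n = 0) : w = 0 := by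
  have hsup : ∀ k, ∀ g ∈ ⨆ j ∈ Finset.range (k + 1), sphericalHarmonics n j,
      Continuous g ∧ ∫ x, w x * g x ∂surfaceMeasure n = 0 := by
    intro k g hg
    induction hg using Submodule.iSup_induction' with
    | mem j g hg =>
      by_cases hj : j ∈ Finset.range (k + 1)
      · simp only [hj, iSup_pos] at hg
        exact ⟨continuous_of_mem hg, h j g hg⟩
      · simp only [hj, not_false_eq_true, iSup_neg, Submodule.mem_bot] at hg
        subst hg
        exact ⟨continuous_const, by simp⟩
    | zero => exact ⟨continuous_const, by simp⟩
    | add g₁ g₂ _ _ h₁ h₂ =>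
      refine ⟨h₁.1.add h₂.1, ?_⟩
      simp only [Pi.add_apply, mul_add]
      rw [integral_add (integrable_surfaceMeasure (hw.fun_mul h₁.1))
        (integrable_surfaceMeasure (hw.fun_mul h₂.1)), h₁.2, h₂.2, add_zero]
  have hpoly : ∀ p : MvPolynomial (Fin n) ℝ, ∫ x : Sph n, w x * polyFun p x ∂surfaceMeasure n = 0 := by
    intro p
    have h1 : ∀ X, polyFun p X =
        ∑ i ∈ Finset.range (p.totalDegree + 1), polyFun (p.homogeneousComponent i) X := by
      intro X
      conv_lhs => rw [← MvPolynomial.sum_homogeneousComponent p]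
      simp [polyFun]
    simp_rw [h1, Finset.mul_sum]
    have hm := fun i => hsup i _ (polyFun_mem_iSup_sphericalHarmonics hn i _
      (MvPolynomial.homogeneousComponent_isHomogeneous i p))
    rw [integral_finsetSum _ fun i _ => integrable_surfaceMeasure (hw.fun_mul (hm i).1)]
    exact Finset.sum_eq_zero fun i _ => (hm i).2
  let coord : Fin n → C(Sph n, ℝ) := fun i =>
    ⟨fun x => (x : EuclideanSpace ℝ (Fin n)) i, by fun_prop⟩
  -- Polynomial functions form a subalgebra separating points, so Stone–Weierstrass approximates `w`
  -- uniformly by functions orthogonal to `w`; hence `∫ w² ≤ ε ∫ |w|` for every `ε > 0`.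
  let A : Subalgebra ℝ C(Sph n, ℝ) := (MvPolynomial.aeval (R := ℝ) coord).range
  have hA : ∀ p : MvPolynomial (Fin n) ℝ, ∀ x : Sph n,
      (MvPolynomial.aeval (R := ℝ) coord p : C(Sph n, ℝ)) x = polyFun p x := by
    intro p x
    induction p using MvPolynomial.induction_on with
    | C a => simp [polyFun]
    | add p q hp hq =>
      rw [map_add, ContinuousMap.add_apply, hp, hq]; simp [polyFun]
    | mul_X p j hp =>
      rw [map_mul, ContinuousMap.mul_apply, hp]; simp [polyFun, coord]
  have hsep : A.SeparatesPoints := by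
    intro x y hxy
    obtain ⟨i, hi⟩ : ∃ i, (x : EuclideanSpace ℝ (Fin n)) i ≠ (y : EuclideanSpace ℝ (Fin n)) i := by
      by_contra hcon
      push Not at hcon
      exact hxy (Subtype.ext (PiLp.ext hcon))
    exact ⟨coord i, ⟨coord i, ⟨MvPolynomial.X i, by simp⟩, rfl⟩, hi⟩
  refine eq_zero_of_integral_sq_eq_zero hw ?_
  have hI : ∀ ε > 0, |∫ x, w x * w x ∂surfaceMeasure n| ≤
      ε * ∫ x, |w x| ∂surfaceMeasure n := by
    intro ε hε
    obtain ⟨⟨g, p, hp⟩, hg⟩ :=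
      ContinuousMap.exists_mem_subalgebra_near_continuous_of_separatesPoints A hsep w hw ε hε
    have hp' : ∀ x, g x = polyFun p x := fun x => by rw [← hA, ← hp]; rfl
    have h1 : ∫ x, w x * w x ∂surfaceMeasure n =
        ∫ x : Sph n, w x * (w x - polyFun p x) ∂surfaceMeasure n := by
      simp_rw [mul_sub]
      rw [integral_sub (integrable_surfaceMeasure (hw.fun_mul hw)) (integrable_surfaceMeasure
        (hw.fun_mul (sphContDiff_polyFun (m := 0) p).continuous)), hpoly p, sub_zero]
    rw [h1, ← integral_const_mul]
    refine (abs_integral_le_integral_abs).trans (integral_mono ?_ ?_ fun x => ?_)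
    · exact integrable_surfaceMeasure ((hw.mul (hw.sub
        (sphContDiff_polyFun (m := 0) p).continuous)).abs)
    · exact integrable_surfaceMeasure (continuous_const.mul hw.abs)
    · have := (hg x).le
      simp only [hp', Real.norm_eq_abs] at this
      simp only [abs_mul]
      rw [mul_comm ε, abs_sub_comm]
      exact mul_le_mul_of_nonneg_left this (abs_nonneg _)
  have hlim : Tendsto (fun ε : ℝ => ε * ∫ x, |w x| ∂surfaceMeasure n) (𝓝[>] 0) (𝓝 0) := by
    have : Tendsto (fun ε : ℝ => ε * ∫ x, |w x| ∂surfaceMeasure n) (𝓝 0)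
        (𝓝 (0 * ∫ x, |w x| ∂surfaceMeasure n)) := tendsto_id.mul_const _
    rw [zero_mul] at this
    exact this.mono_left nhdsWithin_le_nhds
  have h2 := ge_of_tendsto hlim (eventually_nhdsWithin_of_forall fun ε hε => hI ε hε)
  exact abs_eq_zero.mp (le_antisymm h2 (abs_nonneg _))
end

noncomputable section

variable {n : ℕ}

/-! ### Rotation invariance -/

open scoped Pointwise in
-- The surface measure of a set is, up to a factor, the volume of the cone over it, and a linear
-- isometry carries cones to cones and preserves volume.
lemma measurePreserving_sphere_map (R : EuclideanSpace ℝ (Fin n) ≃ₗᵢ[ℝ] EuclideanSpace ℝ (Fin n))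
    (ρ : Sph n → Sph n) (hρ : ∀ x, (ρ x : EuclideanSpace ℝ (Fin n)) = R x) :
    MeasurePreserving ρ (surfaceMeasure n) (surfaceMeasure n) := by
  have hc : Continuous ρ := by
    rw [continuous_induced_rng]
    have : (Subtype.val ∘ ρ) = fun x : Sph n => R x := funext hρ
    rw [this]
    exact R.continuous.comp continuous_subtype_val
  refine ⟨hc.measurable, ?_⟩
  ext s hs
  rw [Measure.map_apply hc.measurable hs]
  unfold surfaceMeasure
  rw [Measure.toSphere_apply' _ hs, Measure.toSphere_apply' _ (hc.measurable hs)]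
  congr 1
  have h1 : (Ioo (0 : ℝ) 1 • (Subtype.val '' (ρ ⁻¹' s)) : Set (EuclideanSpace ℝ (Fin n))) =
      R ⁻¹' (Ioo (0 : ℝ) 1 • (Subtype.val '' s)) := by
    ext X
    simp only [Set.mem_smul, mem_image, mem_preimage]
    constructor
    · rintro ⟨r, hr, _, ⟨x, hx, rfl⟩, rfl⟩
      exact ⟨r, hr, _, ⟨ρ x, hx, rfl⟩, by rw [hρ, map_smul]⟩
    · rintro ⟨r, hr, _, ⟨y, hy, rfl⟩, h⟩
      have hy1 : R.symm (y : EuclideanSpace ℝ (Fin n)) ∈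
          Metric.sphere (0 : EuclideanSpace ℝ (Fin n)) 1 := by
        rw [mem_sphere_zero_iff_norm, LinearIsometryEquiv.norm_map]
        exact norm_eq_of_mem_sphere y
      refine ⟨r, hr, _, ⟨⟨_, hy1⟩, ?_, rfl⟩, ?_⟩
      · have : ρ ⟨_, hy1⟩ = y := Subtype.ext (by rw [hρ]; simp)
        rw [this]; exact hy
      · apply R.injective
        rw [← h, map_smul]; simp
  rw [h1]
  exact R.measurePreserving.measure_preimage_emb R.toHomeomorph.measurableEmbedding _

/-- The Laplacian is the same in every orthonormal basis; the image of the standard basis under `R`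
is used on the right-hand side. -/
lemma laplacian_comp_isometry (R : EuclideanSpace ℝ (Fin n) ≃ₗᵢ[ℝ] EuclideanSpace ℝ (Fin n))
    {f : EuclideanSpace ℝ (Fin n) → ℝ} (hf : ContDiff ℝ 2 f) (X : EuclideanSpace ℝ (Fin n)) :
    Laplacian.laplacian (fun Z => f (R Z)) X = Laplacian.laplacian f (R X) := by
  rw [InnerProductSpace.laplacian_eq_iteratedFDeriv_orthonormalBasis f
    ((EuclideanSpace.basisFun (Fin n) ℝ).map R),
    InnerProductSpace.laplacian_eq_iteratedFDeriv_orthonormalBasis _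
    (EuclideanSpace.basisFun (Fin n) ℝ)]
  refine Finset.sum_congr rfl fun i _ => ?_
  have h1 := ContinuousLinearMap.iteratedFDeriv_comp_right
    (R : EuclideanSpace ℝ (Fin n) →L[ℝ] EuclideanSpace ℝ (Fin n)) hf X (i := 2) le_rfl
  have h2 : (f ∘ (R : EuclideanSpace ℝ (Fin n) →L[ℝ] EuclideanSpace ℝ (Fin n))) =
    fun Z => f (R Z) := rfl
  rw [h2] at h1
  rw [h1, ContinuousMultilinearMap.compContinuousLinearMap_apply]
  congr 1
  ext j
  fin_cases j <;> rfl

lemma comp_isometry_mem_sphericalHarmonics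
    (R : EuclideanSpace ℝ (Fin n) ≃ₗᵢ[ℝ] EuclideanSpace ℝ (Fin n))
    (ρ : Sph n → Sph n) (hρ : ∀ x, (ρ x : EuclideanSpace ℝ (Fin n)) = R x) {k : ℕ}
    {f : Sph n → ℝ} (hf : f ∈ sphericalHarmonics n k) :
    (fun x => f (ρ x)) ∈ sphericalHarmonics n k := by
  obtain ⟨p, hp, hp0, rfl⟩ := mem_sphericalHarmonics_iff.mp hf
  -- Substituting the coordinates of `R X`, which are linear forms in `X`, for the variables keeps
  -- the degree of homogeneity.
  let q : MvPolynomial (Fin n) ℝ := MvPolynomial.aeval (fun i : Fin n =>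
    ∑ j, MvPolynomial.C (R (EuclideanSpace.single j 1) i) * MvPolynomial.X j) p
  have hq : ∀ X, polyFun q X = polyFun p (R X) := by
    intro X
    have hX : ∀ i, R X i = ∑ j, R (EuclideanSpace.single j 1) i * X j := by
      intro i
      have : X = ∑ j, X j • EuclideanSpace.single j (1 : ℝ) := by
        conv_lhs => rw [← (EuclideanSpace.basisFun (Fin n) ℝ).sum_repr X]
        simp
      conv_lhs => rw [this, map_sum]
      simp [mul_comm]
    have hφ : ∀ p' : MvPolynomial (Fin n) ℝ, polyFun (MvPolynomial.aeval (fun i : Fin n =>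
        ∑ j, MvPolynomial.C (R (EuclideanSpace.single j 1) i) * MvPolynomial.X j) p') X =
        polyFun p' (R X) := by
      intro p'
      induction p' using MvPolynomial.induction_on with
      | C a => simp [polyFun, MvPolynomial.algebraMap_eq]
      | add a b ha hb =>
        simp only [polyFun, map_add] at ha hb ⊢
        rw [ha, hb]
      | mul_X a i ha =>
        simp only [polyFun, map_mul, MvPolynomial.aeval_X, MvPolynomial.eval_X] at ha ⊢
        rw [ha, hX]
        simp
    exact hφ p
  refine mem_sphericalHarmonics_iff.mpr ⟨q, ?_, ?_, ?_⟩
  · have := hp.aeval (fun i : Fin n =>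
      ∑ j, MvPolynomial.C (R (EuclideanSpace.single j 1) i) * MvPolynomial.X j) (n := 1)
      fun i => MvPolynomial.IsHomogeneous.sum _ _ _ fun j _ => by
        simpa using (MvPolynomial.isHomogeneous_C _ _).mul (MvPolynomial.isHomogeneous_X ℝ j)
    rwa [one_mul] at this
  · apply polyFun_injective
    rw [← laplacian_polyFun]
    ext X
    rw [show polyFun q = fun Z => polyFun p (R Z) from funext hq,
      laplacian_comp_isometry R (contDiff_polyFun p), laplacian_polyFun, hp0]
    simp [polyFun]
  · ext x
    rw [hq, ← hρ]

/-- The reflection in the hyperplane orthogonal to `x - y` exchanges two vectors of equal norm. -/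
lemma exists_isometry_map (x y : Sph n) :
    ∃ R : EuclideanSpace ℝ (Fin n) ≃ₗᵢ[ℝ] EuclideanSpace ℝ (Fin n),
      ∃ ρ : Sph n → Sph n, (∀ z, (ρ z : EuclideanSpace ℝ (Fin n)) = R z) ∧ ρ x = y := by
  let R := (ℝ ∙ ((x : EuclideanSpace ℝ (Fin n)) - y))ᗮ.reflection
  refine ⟨R, fun z => ⟨R z, ?_⟩, fun z => rfl, Subtype.ext ?_⟩
  · rw [mem_sphere_zero_iff_norm, LinearIsometryEquiv.norm_map]
    exact norm_eq_of_mem_sphere z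
  · exact Submodule.reflection_sub
      ((norm_eq_of_mem_sphere x).trans (norm_eq_of_mem_sphere y).symm)

/-! ### Expansions in an orthonormal basis of spherical harmonics -/

namespace SphericalHarmonicBasis

variable (B : SphericalHarmonicBasis n)

lemma Y_mem (k : ℕ) (l : Fin (B.dim k)) : B.Y k l ∈ sphericalHarmonics n k := by
  rw [← B.span_eq]; exact Submodule.subset_span ⟨l, rfl⟩

lemma continuous_Y (k : ℕ) (l : Fin (B.dim k)) : Continuous (B.Y k l) :=
  continuous_of_mem (B.Y_mem k l)

lemma sum_mul_Y_mem (k : ℕ) (c : Fin (B.dim k) → ℝ) :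
    (fun x => ∑ l, c l * B.Y k l x) ∈ sphericalHarmonics n k := by
  have : (fun x => ∑ l, c l * B.Y k l x) = ∑ l, c l • B.Y k l := by ext x; simp
  rw [this]
  exact Submodule.sum_mem _ fun l _ => Submodule.smul_mem _ _ (B.Y_mem k l)

lemma proj_mem (k : ℕ) (u : Sph n → ℝ) : B.proj k u ∈ sphericalHarmonics n k :=
  B.sum_mul_Y_mem k _

lemma integral_mul_sum_Y {u : Sph n → ℝ} (hu : Continuous u) (k : ℕ) (c : Fin (B.dim k) → ℝ) :
    ∫ x, u x * (∑ l, c l * B.Y k l x) ∂surfaceMeasure n = ∑ l, c l * B.coeff u k l := by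
  simp_rw [Finset.mul_sum]
  rw [integral_finsetSum _ fun l _ => integrable_surfaceMeasure
    (hu.fun_mul (continuous_const.fun_mul (B.continuous_Y k l)))]
  refine Finset.sum_congr rfl fun l _ => ?_
  rw [coeff, ← integral_const_mul]
  congr 1; ext x; ring

lemma coeff_sum_Y (k : ℕ) (c : Fin (B.dim k) → ℝ) (l : Fin (B.dim k)) :
    B.coeff (fun x => ∑ m, c m * B.Y k m x) k l = c l := by
  unfold coeff
  simp_rw [mul_comm _ (B.Y k l _)]
  rw [B.integral_mul_sum_Y (B.continuous_Y k l)]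
  simp [coeff, B.orthonormal]

lemma proj_of_mem {k : ℕ} {f : Sph n → ℝ} (hf : f ∈ sphericalHarmonics n k) : B.proj k f = f := by
  rw [← B.span_eq, Submodule.mem_span_range_iff_exists_fun] at hf
  obtain ⟨c, rfl⟩ := hf
  have : (∑ l, c l • B.Y k l) = fun x => ∑ l, c l * B.Y k l x := by ext x; simp
  rw [this]
  ext x
  simp [proj, B.coeff_sum_Y]

lemma integral_sq_sum_Y (k : ℕ) (c : Fin (B.dim k) → ℝ) :
    ∫ x, (∑ l, c l * B.Y k l x) * (∑ l, c l * B.Y k l x) ∂surfaceMeasure n = ∑ l, c l ^ 2 := by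
  rw [B.integral_mul_sum_Y (continuous_of_mem (B.sum_mul_Y_mem k c))]
  simp [B.coeff_sum_Y, pow_two]

/-- Bessel's inequality in a single degree. -/
lemma integral_proj_sq_le {u : Sph n → ℝ} (hu : Continuous u) (k : ℕ) :
    ∫ x, B.proj k u x * B.proj k u x ∂surfaceMeasure n ≤ ∫ x, u x * u x ∂surfaceMeasure n := by
  have hp : Continuous (B.proj k u) := continuous_of_mem (B.proj_mem k u)
  have h1 : ∫ x, u x * B.proj k u x ∂surfaceMeasure n = ∑ l, B.coeff u k l ^ 2 := by
    unfold proj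
    rw [B.integral_mul_sum_Y hu]
    simp [pow_two]
  have h2 : ∫ x, B.proj k u x * B.proj k u x ∂surfaceMeasure n = ∑ l, B.coeff u k l ^ 2 :=
    B.integral_sq_sum_Y k _
  have h3 : 0 ≤ ∫ x, (u x - B.proj k u x) * (u x - B.proj k u x) ∂surfaceMeasure n :=
    integral_nonneg fun x => mul_self_nonneg _
  have h4 : ∀ x, (u x - B.proj k u x) * (u x - B.proj k u x) =
      u x * u x - 2 * (u x * B.proj k u x) + B.proj k u x * B.proj k u x := fun x => by ring
  simp_rw [h4] at h3
  rw [integral_add (integrable_surfaceMeasure ((hu.fun_mul hu).fun_sub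
      (continuous_const.fun_mul (hu.fun_mul hp))))
      (integrable_surfaceMeasure (hp.fun_mul hp)),
    integral_sub (integrable_surfaceMeasure (hu.fun_mul hu))
      (integrable_surfaceMeasure (continuous_const.fun_mul (hu.fun_mul hp))),
    integral_const_mul, h1, h2] at h3
  rw [h2]; linarith

/-- The reproducing kernel of `SH^k` on the diagonal. -/
def diagKernel (k : ℕ) (x : Sph n) : ℝ := ∑ l, B.Y k l x ^ 2

/-- Cauchy–Schwarz between the coefficients of `f` and the values `Y k l x`. -/
lemma sq_le_diagKernel_mul {k : ℕ} {f : Sph n → ℝ} (hf : f ∈ sphericalHarmonics n k) (x : Sph n) :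
    f x ^ 2 ≤ B.diagKernel k x * ∫ z, f z * f z ∂surfaceMeasure n := by
  rw [← B.proj_of_mem hf]
  unfold proj
  rw [B.integral_sq_sum_Y, mul_comm]
  exact Finset.sum_mul_sq_le_sq_mul_sq _ _ _

lemma diagKernel_nonneg (k : ℕ) (x : Sph n) : 0 ≤ B.diagKernel k x :=
  Finset.sum_nonneg fun _ _ => sq_nonneg _

/-- The kernel function `f = K(x, ·)` satisfies `f x = ∫ f² = K(x, x)`. Composed with an isometry
taking `y` to `x`, it is a harmonic of the same norm with value `K(x, x)` at `y`, so `K(x, x)² ≤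
K(y, y) K(x, x)`. Exchanging `x` and `y` shows that the diagonal is constant. -/
lemma diagKernel_le (k : ℕ) (x y : Sph n) : B.diagKernel k x ≤ B.diagKernel k y := by
  obtain ⟨R, ρ, hρ, hyx⟩ := exists_isometry_map y x
  let f : Sph n → ℝ := fun z => ∑ l, B.Y k l x * B.Y k l z
  have hf : f ∈ sphericalHarmonics n k := B.sum_mul_Y_mem k _
  have hfx : f x = B.diagKernel k x := by simp [f, diagKernel, pow_two]
  have hf2 : ∫ z, f z * f z ∂surfaceMeasure n = B.diagKernel k x := B.integral_sq_sum_Y k _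
  have hg2 : ∫ z, f (ρ z) * f (ρ z) ∂surfaceMeasure n = B.diagKernel k x := by
    have hm := measurePreserving_sphere_map R ρ hρ
    rw [← hf2]
    have hc : Continuous fun z => f z * f z := (continuous_of_mem hf).mul (continuous_of_mem hf)
    conv_rhs => rw [← hm.map_eq]
    rw [integral_map hm.measurable.aemeasurable hc.aestronglyMeasurable]
  have h1 := B.sq_le_diagKernel_mul (comp_isometry_mem_sphericalHarmonics R ρ hρ hf) y
  simp only [hyx, hfx, hg2] at h1
  rcases (B.diagKernel_nonneg k x).eq_or_lt with h | h
  · rw [← h]; exact B.diagKernel_nonneg k y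
  · nlinarith

/-- The trace of the kernel is the dimension, and the diagonal is constant. -/
lemma diagKernel_mul_measure (k : ℕ) (x : Sph n) :
    B.diagKernel k x * (surfaceMeasure n).real univ = B.dim k := by
  have h1 : ∫ z, B.diagKernel k z ∂surfaceMeasure n = B.dim k := by
    unfold diagKernel
    rw [integral_finsetSum _ fun l _ => integrable_surfaceMeasure ((B.continuous_Y k l).fun_pow 2)]
    simp [pow_two, B.orthonormal]
  have h2 : ∀ z, B.diagKernel k z = B.diagKernel k x := fun z =>
    le_antisymm (B.diagKernel_le k z x) (B.diagKernel_le k x z)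
  simp_rw [h2] at h1
  rw [integral_const, smul_eq_mul] at h1
  linarith

/-- A crude count: harmonics of degree `k` lie in the span of the monomials whose exponents are all
at most `k`. Any polynomial bound in `k` would serve. -/
lemma dim_le (k : ℕ) : B.dim k ≤ (k + 1) ^ n := by
  let w : (Fin n → Fin (k + 1)) → Sph n → ℝ := fun d x =>
    ∏ i, (x : EuclideanSpace ℝ (Fin n)) i ^ (d i : ℕ)
  have hlin : LinearIndependent ℝ (B.Y k) := by
    rw [Fintype.linearIndependent_iff]
    intro c hc l
    have h1 : (fun x => ∑ m, c m * B.Y k m x) = 0 := by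
      rw [← hc]; ext x; simp
    rw [← B.coeff_sum_Y k c l, h1]
    simp [coeff]
  have hsub : ∀ l, B.Y k l ∈ Submodule.span ℝ (range w) := by
    intro l
    obtain ⟨p, hp, -, hpl⟩ := mem_sphericalHarmonics_iff.mp (B.Y_mem k l)
    have h1 : B.Y k l = ∑ d ∈ p.support.attach, p.coeff d.1 • w (fun i => ⟨d.1 i, by
        have h2 : (d.1).degree = k := by
          rw [Finsupp.degree_eq_weight_one]
          exact hp (MvPolynomial.mem_support_iff.mp d.2)
        have := Finsupp.le_degree i d.1
        omega⟩) := by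
      rw [hpl]
      ext x
      simp only [polyFun, MvPolynomial.eval_eq', Finset.sum_apply, Pi.smul_apply, smul_eq_mul, w]
      exact (Finset.sum_attach p.support (fun d => p.coeff d *
        ∏ i, (x : EuclideanSpace ℝ (Fin n)) i ^ (d i))).symm
    rw [h1]
    exact Submodule.sum_mem _ fun d _ => Submodule.smul_mem _ _ (Submodule.subset_span ⟨_, rfl⟩)
  have h1 : Fintype.card (Fin (B.dim k)) ≤ Fintype.card (Fin n → Fin (k + 1)) := by
    classical
    have h2 := linearIndependent_le_span_aux' (B.Y k) hlin (range w)
      (by rintro _ ⟨l, rfl⟩; exact hsub l)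
    refine h2.trans ?_
    exact Fintype.card_range_le w
  simpa using h1

end SphericalHarmonicBasis

lemma surfaceMeasure_univ_pos (hn : 2 ≤ n) : 0 < (surfaceMeasure n).real univ := by
  have : Nonempty (Sph n) := ⟨⟨EuclideanSpace.single ⟨0, by omega⟩ 1, by simp⟩⟩
  exact ENNReal.toReal_pos (isOpen_univ.measure_pos _ univ_nonempty).ne' (measure_ne_top _ _)

/-- The pointwise bound on spherical harmonics by their `L²` norm. -/
lemma sq_le_of_mem (hn : 2 ≤ n) (B : SphericalHarmonicBasis n) {k : ℕ} {f : Sph n → ℝ}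
    (hf : f ∈ sphericalHarmonics n k) (x : Sph n) :
    f x ^ 2 ≤ (k + 1 : ℝ) ^ n / (surfaceMeasure n).real univ *
      ∫ z, f z * f z ∂surfaceMeasure n := by
  have hpos := surfaceMeasure_univ_pos hn
  refine (B.sq_le_diagKernel_mul hf x).trans ?_
  refine mul_le_mul_of_nonneg_right ?_ (integral_nonneg fun z => mul_self_nonneg _)
  rw [le_div_iff₀ hpos, B.diagKernel_mul_measure]
  exact_mod_cast B.dim_le k
end

/-! ### Rapid decay and convergence of the spherical harmonic expansion. -/

noncomputable section

variable {n : ℕ}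

lemma sphContDiff_iterate_sphLaplacian {u : Sph n → ℝ} (hu : SphContDiff ∞ u) (m : ℕ) :
    SphContDiff ∞ (sphLaplacian^[m] u) := by
  induction m with
  | zero => exact hu
  | succ m ih => rw [Function.iterate_succ_apply']; exact ih.sphLaplacian

lemma SphContDiff.two_of_infty {u : Sph n → ℝ} (hu : SphContDiff ∞ u) : SphContDiff 2 u :=
  ContDiffOn.of_le hu (by norm_cast)

namespace SphericalHarmonicBasis

variable (B : SphericalHarmonicBasis n)

lemma coeff_sphLaplacian (hn : 2 ≤ n) {u : Sph n → ℝ} (hu : SphContDiff 2 u) (k : ℕ)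
    (l : Fin (B.dim k)) : B.coeff (sphLaplacian u) k l = -sphEigenvalue n k * B.coeff u k l :=
  integral_sphLaplacian_mul_of_mem hn hu (B.Y_mem k l)

lemma proj_eq_mul_of_coeff {u v : Sph n → ℝ} {k : ℕ} {c : ℝ}
    (h : ∀ l, B.coeff v k l = c * B.coeff u k l) (x : Sph n) :
    B.proj k v x = c * B.proj k u x := by
  simp [proj, h, Finset.mul_sum, mul_assoc]

lemma proj_iterate_sphLaplacian (hn : 2 ≤ n) {u : Sph n → ℝ} (hu : SphContDiff ∞ u) (k m : ℕ)
    (x : Sph n) :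
    B.proj k (sphLaplacian^[m] u) x = (-sphEigenvalue n k) ^ m * B.proj k u x := by
  induction m with
  | zero => simp
  | succ m ih =>
    rw [Function.iterate_succ_apply', B.proj_eq_mul_of_coeff (B.coeff_sphLaplacian hn
      (sphContDiff_iterate_sphLaplacian hu m).two_of_infty k), ih, pow_succ]
    ring

/-- The left side is `|P_k v|` for `v = Δ^m u`. The sup bound `sq_le_of_mem` and Bessel's inequality
apply to it; the square root of `(k+1)^n` is wasted to keep integer powers. -/
lemma exists_eigenvalue_pow_mul_proj_le (hn : 2 ≤ n) {u : Sph n → ℝ} (hu : SphContDiff ∞ u)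
    (m : ℕ) : ∃ C : ℝ, 0 ≤ C ∧ ∀ k x,
      sphEigenvalue n k ^ m * |B.proj k u x| ≤ C * (k + 1 : ℝ) ^ n := by
  set v := sphLaplacian^[m] u with hv
  have hvc : Continuous v := (sphContDiff_iterate_sphLaplacian hu m).continuous
  set I := ∫ z, v z * v z ∂surfaceMeasure n with hI
  have hI0 : 0 ≤ I := integral_nonneg fun z => mul_self_nonneg _
  have hω := surfaceMeasure_univ_pos hn
  refine ⟨√(I / (surfaceMeasure n).real univ), Real.sqrt_nonneg _, fun k x => ?_⟩
  have h1 : sphEigenvalue n k ^ m * |B.proj k u x| = |B.proj k v x| := by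
    rw [hv, B.proj_iterate_sphLaplacian hn hu, abs_mul, abs_pow, abs_neg,
      abs_of_nonneg (sphEigenvalue_nonneg hn k)]
  rw [h1]
  refine abs_le_of_sq_le_sq' (a := B.proj k v x) ?_ (by positivity) |> abs_le.mpr
  have h2 := sq_le_of_mem hn B (B.proj_mem k v) x
  have h3 := B.integral_proj_sq_le hvc k
  have h4 : (1 : ℝ) ≤ (k + 1 : ℝ) ^ n := one_le_pow₀ (by linarith [k.cast_nonneg (α := ℝ)])
  rw [mul_pow, Real.sq_sqrt (by positivity)]
  calc B.proj k v x ^ 2 ≤ (k + 1 : ℝ) ^ n / (surfaceMeasure n).real univ * I :=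
        h2.trans (mul_le_mul_of_nonneg_left h3 (by positivity))
    _ = I / (surfaceMeasure n).real univ * ((k + 1 : ℝ) ^ n * 1) := by ring
    _ ≤ I / (surfaceMeasure n).real univ * ((k + 1 : ℝ) ^ n) ^ 2 := by
        rw [pow_two ((k + 1 : ℝ) ^ n)]
        gcongr

/-- The bound with `n + 1` further powers of the eigenvalue gains `k^(2n+2)`, which beats `(k+1)^n`
and leaves `1/k²`. Degree `0` gains nothing from this and is covered by `C₀`. -/
lemma exists_summable_bound (hn : 2 ≤ n) {u : Sph n → ℝ} (hu : SphContDiff ∞ u)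
    (m : ℕ) : ∃ b : ℕ → ℝ, Summable b ∧ ∀ k x,
      sphEigenvalue n k ^ m * |B.proj k u x| ≤ b k := by
  obtain ⟨C₀, hC₀, h₀⟩ := B.exists_eigenvalue_pow_mul_proj_le hn hu m
  obtain ⟨C₁, hC₁, h₁⟩ := B.exists_eigenvalue_pow_mul_proj_le hn hu (m + (n + 1))
  have hs : Summable fun k : ℕ => 1 / ((k : ℝ) + 1) ^ 2 := by
    simpa using (summable_nat_add_iff 1).mpr (Real.summable_one_div_nat_pow.mpr one_lt_two)
  refine ⟨fun k => (C₀ + C₁ * 2 ^ n * 4) * (1 / ((k : ℝ) + 1) ^ 2), hs.mul_left _, fun k x => ?_⟩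
  rcases Nat.eq_zero_or_pos k with rfl | hk
  · have := h₀ 0 x
    simp only [Nat.cast_zero, zero_add, one_pow, mul_one] at this
    refine this.trans ?_
    simp only [Nat.cast_zero, zero_add, one_pow, div_one, mul_one]
    have : 0 ≤ C₁ * 2 ^ n * 4 := by positivity
    linarith
  · have hk1 : (1 : ℝ) ≤ k := by exact_mod_cast hk
    have hk0 : (0 : ℝ) < k := by linarith
    have h2 : ((k : ℝ) ^ 2) ^ (n + 1) * (sphEigenvalue n k ^ m * |B.proj k u x|) ≤
        C₁ * (k + 1 : ℝ) ^ n := by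
      refine le_trans ?_ (h₁ k x)
      have := sq_le_sphEigenvalue hn k
      have h3 := sphEigenvalue_nonneg hn k
      calc _ ≤ sphEigenvalue n k ^ (n + 1) * (sphEigenvalue n k ^ m * |B.proj k u x|) := by gcongr
        _ = _ := by ring
    have h3 : (k + 1 : ℝ) ^ n ≤ 2 ^ n * k ^ n := by
      rw [← mul_pow]; gcongr; linarith
    have h4 : (k : ℝ) ^ n ≤ (k : ℝ) ^ (2 * n) := pow_le_pow_right₀ hk1 (by omega)
    have h5 : (k : ℝ) ^ (2 * n) * ((k : ℝ) ^ 2 * (sphEigenvalue n k ^ m * |B.proj k u x|)) ≤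
        (k : ℝ) ^ (2 * n) * (C₁ * 2 ^ n) := by
      calc _ = ((k : ℝ) ^ 2) ^ (n + 1) * (sphEigenvalue n k ^ m * |B.proj k u x|) := by
            rw [← pow_mul]; ring
        _ ≤ C₁ * (2 ^ n * (k : ℝ) ^ (2 * n)) := h2.trans (by gcongr; exact h3.trans (by gcongr))
        _ = _ := by ring
    have h6 := le_of_mul_le_mul_left h5 (by positivity)
    have h7 : sphEigenvalue n k ^ m * |B.proj k u x| ≤ C₁ * 2 ^ n / (k : ℝ) ^ 2 := by
      rw [le_div_iff₀ (by positivity)]; linarith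
    refine h7.trans ?_
    simp only [mul_one_div]
    rw [div_le_div_iff₀ (by positivity) (by positivity)]
    have h8 : ((k : ℝ) + 1) ^ 2 ≤ 4 * (k : ℝ) ^ 2 := by nlinarith
    have h9 : 0 ≤ C₁ * 2 ^ n := by positivity
    nlinarith [mul_le_mul_of_nonneg_left h8 h9, mul_nonneg hC₀ (sq_nonneg (k : ℝ))]

/-- Rapid decay of the spherical harmonic expansion of a smooth function. -/
lemma exists_summable_bound_rpow (hn : 2 ≤ n) {u : Sph n → ℝ} (hu : SphContDiff ∞ u) :
    ∃ b : ℕ → ℝ, Summable b ∧ (∀ k x, |B.proj k u x| ≤ b k) ∧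
      (∀ k x, sphEigenvalue n k * |B.proj k u x| ≤ b k) ∧
      (∀ s : ℝ, 0 < s → s < 1 → ∀ k x, sphEigenvalue n k ^ s * |B.proj k u x| ≤ b k) := by
  obtain ⟨b₀, hb₀, h₀⟩ := B.exists_summable_bound hn hu 0
  obtain ⟨b₁, hb₁, h₁⟩ := B.exists_summable_bound hn hu 1
  simp only [pow_zero, one_mul, pow_one] at h₀ h₁
  refine ⟨fun k => b₀ k + b₁ k, hb₀.add hb₁, fun k x => ?_, fun k x => ?_, fun s hs0 hs1 k x => ?_⟩
  · have := (mul_nonneg (sphEigenvalue_nonneg hn k) (abs_nonneg _)).trans (h₁ k x)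
    linarith [h₀ k x]
  · have := (abs_nonneg _).trans (h₀ k x)
    linarith [h₁ k x]
  · have h2 := sphEigenvalue_nonneg hn k
    have h3 : sphEigenvalue n k ^ s ≤ 1 + sphEigenvalue n k := by
      rcases le_total (sphEigenvalue n k) 1 with h | h
      · exact (Real.rpow_le_one h2 h hs0.le).trans (by linarith)
      · refine (Real.rpow_le_rpow_of_exponent_le h hs1.le).trans ?_
        rw [Real.rpow_one]; linarith
    calc _ ≤ (1 + sphEigenvalue n k) * |B.proj k u x| := by gcongr
      _ = |B.proj k u x| + sphEigenvalue n k * |B.proj k u x| := by ring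
      _ ≤ _ := add_le_add (h₀ k x) (h₁ k x)

/-- Uniqueness of coefficients. It replaces pointwise arguments twice: for the sum of the expansion
and for the Laplacian of a series. -/
lemma eq_of_coeff_eq (hn : 2 ≤ n) {u v : Sph n → ℝ} (hu : Continuous u) (hv : Continuous v)
    (h : ∀ k l, B.coeff u k l = B.coeff v k l) : u = v := by
  rw [← sub_eq_zero]
  refine eq_zero_of_forall_integral_mul_eq_zero hn (hu.sub hv) fun k f hf => ?_
  have hfc := continuous_of_mem hf
  simp only [Pi.sub_apply, sub_mul]
  rw [integral_sub (integrable_surfaceMeasure (hu.fun_mul hfc))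
    (integrable_surfaceMeasure (hv.fun_mul hfc)), ← B.proj_of_mem hf]
  unfold proj
  rw [B.integral_mul_sum_Y hu, B.integral_mul_sum_Y hv]
  simp [h]

section Multiplier

variable {u : Sph n → ℝ} {c : ℕ → ℝ} {b : ℕ → ℝ}

lemma continuous_tsum_mul_proj (hb : Summable b) (h : ∀ k x, |c k * B.proj k u x| ≤ b k) :
    Continuous fun x => ∑' k, c k * B.proj k u x :=
  continuous_tsum (fun k => continuous_const.mul (continuous_of_mem (B.proj_mem k u))) hb h

/-- The uniform bound allows termwise integration, and orthogonality of degrees leaves the single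
term `k`. -/
lemma coeff_tsum_mul_proj (hn : 2 ≤ n) (hb : Summable b) (h : ∀ k x, |c k * B.proj k u x| ≤ b k)
    (k : ℕ) (l : Fin (B.dim k)) :
    B.coeff (fun x => ∑' j, c j * B.proj j u x) k l = c k * B.coeff u k l := by
  have hY := B.continuous_Y k l
  have hpc := fun j => continuous_of_mem (B.proj_mem j u)
  obtain ⟨M, hM⟩ : ∃ M, ∀ x, |B.Y k l x| ≤ M := by
    obtain ⟨M, hM⟩ := isCompact_univ.exists_bound_of_continuousOn hY.continuousOn
    exact ⟨M, fun x => by simpa using hM x (mem_univ x)⟩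
  have hterm : ∀ j x, ‖c j * B.proj j u x * B.Y k l x‖ ≤ b j * M := fun j x => by
    rw [norm_mul]
    exact mul_le_mul (h j x) (hM x) (norm_nonneg _) ((abs_nonneg _).trans (h j x))
  have h1 : HasSum (fun j => ∫ x, c j * B.proj j u x * B.Y k l x ∂surfaceMeasure n)
      (∫ x, ∑' j, c j * B.proj j u x * B.Y k l x ∂surfaceMeasure n) := by
    refine hasSum_integral_of_summable_integral_norm (fun j => integrable_surfaceMeasure
      ((continuous_const.mul (hpc j)).mul hY)) ?_
    refine Summable.of_nonneg_of_le (fun j => integral_nonneg fun x => norm_nonneg _) (fun j => ?_)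
      ((hb.mul_right M).mul_right ((surfaceMeasure n).real univ))
    calc ∫ x, ‖c j * B.proj j u x * B.Y k l x‖ ∂surfaceMeasure n
        ≤ ∫ x, b j * M ∂surfaceMeasure n :=
          integral_mono (integrable_surfaceMeasure ((continuous_const.mul (hpc j)).mul hY).norm)
            (integrable_const _) (hterm j)
      _ = _ := by rw [integral_const, smul_eq_mul, mul_comm]
  have h2 : ∀ j, j ≠ k → ∫ x, c j * B.proj j u x * B.Y k l x ∂surfaceMeasure n = 0 := by
    intro j hj
    simp_rw [mul_assoc]
    rw [integral_const_mul, integral_mul_eq_zero_of_mem hn hj (B.proj_mem j u) (B.Y_mem k l),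
      mul_zero]
  have h3 := h1.unique (hasSum_single k h2)
  unfold coeff
  simp_rw [← tsum_mul_right]
  rw [h3]
  simp_rw [mul_assoc]
  rw [integral_const_mul]
  congr 1
  exact B.coeff_sum_Y k (fun l => B.coeff u k l) l

end Multiplier

/-- A smooth function is the sum of its spherical harmonic expansion. -/
theorem hasSum_proj (hn : 2 ≤ n) {u : Sph n → ℝ} (hu : SphContDiff ∞ u) (x : Sph n) :
    HasSum (fun k => B.proj k u x) (u x) := by
  obtain ⟨b, hb, h0, -⟩ := B.exists_summable_bound_rpow hn hu
  have h1 : ∀ k x, |(fun _ => 1 : ℕ → ℝ) k * B.proj k u x| ≤ b k := by simpa using h0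
  have h2 : (fun x => ∑' k, (fun _ => 1 : ℕ → ℝ) k * B.proj k u x) = u :=
    B.eq_of_coeff_eq hn (B.continuous_tsum_mul_proj hb h1) hu.continuous fun k l => by
      rw [B.coeff_tsum_mul_proj hn hb h1, one_mul]
  have h3 : Summable fun k => B.proj k u x := Summable.of_norm_bounded hb fun k => h0 k x
  have h4 := h3.hasSum
  rwa [← congrFun h2 x, show (∑' k, (fun _ => 1 : ℕ → ℝ) k * B.proj k u x) = ∑' k, B.proj k u x by
    simp]

lemma proj_fracLaplacian (hn : 2 ≤ n) {u : Sph n → ℝ} (hu : SphContDiff ∞ u) {s : ℝ}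
    (hs0 : 0 < s) (hs1 : s < 1) (k : ℕ) (x : Sph n) :
    B.proj k (B.fracLaplacian s u) x = sphEigenvalue n k ^ s * B.proj k u x := by
  obtain ⟨b, hb, -, -, h⟩ := B.exists_summable_bound_rpow hn hu
  refine B.proj_eq_mul_of_coeff (fun l => ?_) x
  exact B.coeff_tsum_mul_proj (c := fun k => sphEigenvalue n k ^ s) hn hb (fun k x => by
    rw [abs_mul, abs_of_nonneg (Real.rpow_nonneg (sphEigenvalue_nonneg hn k) _)]
    exact h s hs0 hs1 k x) k l

/-- Harmonics of degree `0` are constants. -/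
lemma proj_zero_eq_zero {u : Sph n → ℝ} (hu : ∫ z, u z ∂surfaceMeasure n = 0) (x : Sph n) :
    B.proj 0 u x = 0 := by
  refine Finset.sum_eq_zero fun l _ => ?_
  obtain ⟨p, hp, -, hpl⟩ := mem_sphericalHarmonics_iff.mp (B.Y_mem 0 l)
  have h2 := MvPolynomial.totalDegree_eq_zero_iff_eq_C.mp (Nat.le_zero.mp hp.totalDegree_le)
  rw [coeff, hpl, h2]
  simp only [polyFun, MvPolynomial.eval_C]
  rw [integral_mul_const, hu]
  simp

end SphericalHarmonicBasis
end

noncomputable section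

/-! ### The integral `∫₀^∞ e^{-w - z/w} w^{a-1} dw` -/

/-- The integral `∫₀^∞ e^{-w - z/w} w^{a-1} dw`, up to normalization a Macdonald function. -/
def macdonald (a z : ℝ) : ℝ := ∫ w in Ioi (0 : ℝ), Real.exp (-w - z / w) * w ^ (a - 1)

lemma measurable_macdonald_integrand (a z : ℝ) :
    Measurable fun w : ℝ => Real.exp (-w - z / w) * w ^ (a - 1) := by fun_prop

/-- For `z > 0` the factor `exp(-z/w)` is at most `N! (w/z)^N`, which absorbs any negative power of
`w`; `N > 1 - a` makes the resulting exponent positive. Hence every real order `a` is admissible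
when `z > 0`. -/
lemma exists_macdonald_integrand_le (a : ℝ) {z : ℝ} (hz : 0 < z) : ∃ C d : ℝ, 0 ≤ C ∧ 0 < d ∧
    ∀ w : ℝ, 0 < w → Real.exp (-w - z / w) * w ^ (a - 1) ≤ C * (w ^ d * Real.exp (-w)) := by
  obtain ⟨N, hN⟩ := exists_nat_gt (1 - a)
  refine ⟨N.factorial / z ^ N, a - 1 + N, by positivity, by linarith, fun w hw => ?_⟩
  have h1 := Real.pow_div_factorial_le_exp (x := z / w) (by positivity) N
  have h2 : Real.exp (-(z / w)) ≤ N.factorial / z ^ N * w ^ N := by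
    rw [Real.exp_neg, inv_le_comm₀ (Real.exp_pos _) (by positivity)]
    refine le_trans (le_of_eq ?_) h1
    rw [div_pow]
    field_simp
  rw [sub_eq_add_neg, Real.exp_add, Real.rpow_add hw, Real.rpow_natCast]
  calc Real.exp (-w) * Real.exp (-(z / w)) * w ^ (a - 1)
      ≤ Real.exp (-w) * (N.factorial / z ^ N * w ^ N) * w ^ (a - 1) := by gcongr
    _ = _ := by ring

lemma macdonald_integrable_of_pos (a : ℝ) {z : ℝ} (hz : 0 < z) :
    IntegrableOn (fun w : ℝ => Real.exp (-w - z / w) * w ^ (a - 1)) (Ioi 0) := by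
  obtain ⟨C, d, -, hd, h⟩ := exists_macdonald_integrand_le a hz
  have h1 : IntegrableOn (fun w : ℝ => w ^ d * Real.exp (-w)) (Ioi 0) := by
    simpa using integrableOn_rpow_mul_exp_neg_mul_rpow (s := d) (p := 1) (b := 1)
      (by linarith) one_pos one_pos
  refine Integrable.mono' (h1.const_mul C) (measurable_macdonald_integrand a z).aestronglyMeasurable ?_
  filter_upwards [ae_restrict_mem measurableSet_Ioi] with w hw
  have hw : 0 < w := hw
  rw [Real.norm_of_nonneg (by positivity)]
  exact h w hw

lemma macdonald_integrand_le_gamma {a z w : ℝ} (hz : 0 ≤ z) (hw : 0 < w) :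
    Real.exp (-w - z / w) * w ^ (a - 1) ≤ Real.exp (-w) * w ^ (a - 1) := by
  have : 0 ≤ z / w := by positivity
  gcongr
  linarith

lemma macdonald_integrable {a z : ℝ} (ha : 0 < a) (hz : 0 ≤ z) :
    IntegrableOn (fun w : ℝ => Real.exp (-w - z / w) * w ^ (a - 1)) (Ioi 0) := by
  refine Integrable.mono' (Real.GammaIntegral_convergent ha)
    (measurable_macdonald_integrand a z).aestronglyMeasurable ?_
  filter_upwards [ae_restrict_mem measurableSet_Ioi] with w hw
  have hw : 0 < w := hw
  rw [Real.norm_of_nonneg (by positivity)]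
  exact macdonald_integrand_le_gamma hz hw

lemma macdonald_zero {a : ℝ} (ha : 0 < a) : macdonald a 0 = Real.Gamma a := by
  rw [Real.Gamma_eq_integral ha, macdonald]
  simp

lemma macdonald_nonneg (a z : ℝ) : 0 ≤ macdonald a z := by
  refine setIntegral_nonneg measurableSet_Ioi fun w hw => ?_
  have hw : 0 < w := hw
  positivity

lemma macdonald_le_gamma {a z : ℝ} (ha : 0 < a) (hz : 0 ≤ z) : macdonald a z ≤ Real.Gamma a := by
  rw [Real.Gamma_eq_integral ha]
  exact setIntegral_mono_on (macdonald_integrable ha hz) (Real.GammaIntegral_convergent ha)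
    measurableSet_Ioi fun w hw => macdonald_integrand_le_gamma hz hw

lemma macdonald_pos {a z : ℝ} (h : IntegrableOn
    (fun w : ℝ => Real.exp (-w - z / w) * w ^ (a - 1)) (Ioi 0)) : 0 < macdonald a z := by
  rw [macdonald, setIntegral_pos_iff_support_of_nonneg_ae]
  · have : (Function.support fun w : ℝ => Real.exp (-w - z / w) * w ^ (a - 1)) ∩ Ioi 0 = Ioi 0 := by
      refine inter_eq_right.mpr fun w hw => ?_
      have hw : 0 < w := hw
      simp only [Function.mem_support]
      positivity
    rw [this]; simp
  · filter_upwards [ae_restrict_mem measurableSet_Ioi] with w hw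
    have hw : 0 < w := hw
    simp only [Pi.zero_apply]
    positivity
  · exact h

/-- Half of the exponent is spent on `√z ≤ w/2 + z/w`, and the remaining `exp(-w/2)` keeps the
integral finite. -/
lemma exists_macdonald_le_exp {a : ℝ} (ha : 0 < a) :
    ∃ C : ℝ, 0 ≤ C ∧ ∀ z, 0 ≤ z → macdonald a z ≤ C * Real.exp (-√z) := by
  have hI : IntegrableOn (fun w : ℝ => w ^ (a - 1) * Real.exp (-(1 / 2) * w)) (Ioi 0) := by
    simpa using integrableOn_rpow_mul_exp_neg_mul_rpow (s := a - 1) (p := 1) (b := 1 / 2)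
      (by linarith) one_pos (by norm_num)
  refine ⟨∫ w in Ioi (0 : ℝ), w ^ (a - 1) * Real.exp (-(1 / 2) * w), ?_, fun z hz => ?_⟩
  · refine setIntegral_nonneg measurableSet_Ioi fun w hw => ?_
    have hw : 0 < w := hw
    positivity
  rw [macdonald, ← integral_mul_const]
  refine setIntegral_mono_on (macdonald_integrable ha hz) (hI.mul_const _)
    measurableSet_Ioi fun w hw => ?_
  have hw : 0 < w := hw
  rw [mul_assoc, ← Real.exp_add, mul_comm]
  gcongr
  have h1 : √z ≤ w / 2 + z / w := by
    have h3 : √z * w ≤ w ^ 2 / 2 + z := by nlinarith [Real.sq_sqrt hz, sq_nonneg w]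
    rw [div_add_div _ _ two_ne_zero hw.ne', le_div_iff₀ (by positivity)]
    nlinarith
  linarith

lemma tendsto_macdonald_zero {a : ℝ} (ha : 0 < a) {ι : Type*} {l : Filter ι} [l.IsCountablyGenerated]
    {g : ι → ℝ} (hg : Tendsto g l (𝓝 0)) (hg0 : ∀ᶠ i in l, 0 ≤ g i) :
    Tendsto (fun i => macdonald a (g i)) l (𝓝 (Real.Gamma a)) := by
  rw [← macdonald_zero ha]
  refine tendsto_integral_filter_of_dominated_convergence
    (fun w => Real.exp (-w) * w ^ (a - 1)) (Eventually.of_forall fun i =>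
      (measurable_macdonald_integrand a _).aestronglyMeasurable) ?_
    (Real.GammaIntegral_convergent ha) ?_
  · filter_upwards [hg0] with i hi
    filter_upwards [ae_restrict_mem measurableSet_Ioi] with w hw
    have hw : 0 < w := hw
    rw [Real.norm_of_nonneg (by positivity)]
    exact macdonald_integrand_le_gamma hi hw
  · refine Eventually.of_forall fun w => ?_
    refine Tendsto.mul_const _ ((Real.continuous_exp.tendsto _).comp ?_)
    exact tendsto_const_nhds.sub (hg.div_const w)

/-- Differentiation under the integral; for parameters above `z/2` the derivative is dominated by
the integrand at `z/2`. -/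
lemma hasDerivAt_macdonald (a : ℝ) {z : ℝ} (hz : 0 < z) :
    HasDerivAt (macdonald a) (-macdonald (a - 1) z) z := by
  have h := hasDerivAt_integral_of_dominated_loc_of_deriv_le (μ := volume.restrict (Ioi (0 : ℝ)))
    (F := fun z w => Real.exp (-w - z / w) * w ^ (a - 1))
    (F' := fun z w => -(Real.exp (-w - z / w) * w ^ (a - 1 - 1)))
    (bound := fun w => Real.exp (-w - (z / 2) / w) * w ^ (a - 1 - 1))
    (x₀ := z) (s := Ioi (z / 2)) (Ioi_mem_nhds (by linarith))
    (Eventually.of_forall fun x => (measurable_macdonald_integrand a x).aestronglyMeasurable)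
    (macdonald_integrable_of_pos a hz)
    (measurable_macdonald_integrand (a - 1) z).neg.aestronglyMeasurable ?_
    (macdonald_integrable_of_pos (a - 1) (half_pos hz)) ?_
  · have h2 := h.2
    rw [integral_neg] at h2
    exact h2
  · filter_upwards [ae_restrict_mem measurableSet_Ioi] with w hw x hx
    have hw : 0 < w := hw
    have hx : z / 2 < x := hx
    rw [norm_neg, Real.norm_of_nonneg (by positivity)]
    gcongr
  · filter_upwards [ae_restrict_mem measurableSet_Ioi] with w hw x hx
    have hw : 0 < w := hw
    have h1 : HasDerivAt (fun x : ℝ => -w - x / w) (-(1 / w)) x :=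
      ((hasDerivAt_id x).div_const w).const_sub (-w)
    refine (h1.exp.mul_const (w ^ (a - 1))).congr_deriv ?_
    rw [Real.rpow_sub_one hw.ne' (a - 1)]
    field_simp

/-- The integral over the half-line of the derivative of `exp(-w - z/w) w^a` is zero, since
`exists_macdonald_integrand_le` makes both boundary terms vanish. -/
lemma macdonald_recurrence {a z : ℝ} (hz : 0 < z) :
    a * macdonald a z = macdonald (a + 1) z - z * macdonald (a - 1) z := by
  have hI := fun b => macdonald_integrable_of_pos b hz
  obtain ⟨C, d, hC, hd, hbd⟩ := exists_macdonald_integrand_le (a + 1) hz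
  have hpt : ∀ w : ℝ, 0 < w →
      Real.exp (-w - z / w) * (-1 + z / w ^ 2) * w ^ a +
        Real.exp (-w - z / w) * (a * w ^ (a - 1)) =
      z * (Real.exp (-w - z / w) * w ^ (a - 1 - 1)) - Real.exp (-w - z / w) * w ^ (a + 1 - 1)
        + a * (Real.exp (-w - z / w) * w ^ (a - 1)) := by
    intro w hw
    rw [Real.rpow_sub_one hw.ne' (a - 1), Real.rpow_sub_one hw.ne' a, add_sub_cancel_right]
    field_simp
    ring
  have hsum : IntegrableOn (fun w : ℝ =>
      z * (Real.exp (-w - z / w) * w ^ (a - 1 - 1)) - Real.exp (-w - z / w) * w ^ (a + 1 - 1)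
        + a * (Real.exp (-w - z / w) * w ^ (a - 1))) (Ioi 0) :=
    (((hI (a - 1)).const_mul z).sub (hI (a + 1))).add ((hI a).const_mul a)
  have hlim0 : Tendsto (fun w : ℝ => C * (w ^ d * Real.exp (-w))) (𝓝[>] 0) (𝓝 0) := by
    have h1 : ContinuousAt (fun w : ℝ => C * (w ^ d * Real.exp (-w))) 0 :=
      continuousAt_const.mul ((Real.continuousAt_rpow_const 0 d (Or.inr hd.le)).mul (by fun_prop))
    have h2 := h1.tendsto
    rw [Real.zero_rpow hd.ne', zero_mul, mul_zero] at h2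
    exact h2.mono_left nhdsWithin_le_nhds
  have hliminf : Tendsto (fun w : ℝ => C * (w ^ d * Real.exp (-w))) atTop (𝓝 0) := by
    have := (tendsto_rpow_mul_exp_neg_mul_atTop_nhds_zero d 1 one_pos).const_mul C
    simpa using this
  have hle : ∀ w : ℝ, 0 < w → ((fun w : ℝ => Real.exp (-w - z / w)) * fun w : ℝ => w ^ a) w ≤
      C * (w ^ d * Real.exp (-w)) := fun w hw => by
    have := hbd w hw
    rwa [add_sub_cancel_right] at this
  have h := integral_Ioi_deriv_mul_eq_sub (a := (0 : ℝ)) (a' := (0 : ℝ)) (b' := (0 : ℝ))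
    (u := fun w => Real.exp (-w - z / w)) (v := fun w => w ^ a)
    (u' := fun w => Real.exp (-w - z / w) * (-1 + z / w ^ 2)) (v' := fun w => a * w ^ (a - 1))
    ?_ ?_ ?_ ?_ ?_
  · rw [setIntegral_congr_fun measurableSet_Ioi hpt, integral_add, integral_sub, integral_const_mul,
      integral_const_mul] at h
    · change z * macdonald (a - 1) z - macdonald (a + 1) z + a * macdonald a z = 0 - 0 at h
      linarith
    · exact (hI (a - 1)).const_mul z
    · exact hI (a + 1)
    · exact ((hI (a - 1)).const_mul z).sub (hI (a + 1))
    · exact (hI a).const_mul a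
  · intro w hw
    have hw : 0 < w := hw
    have h1 : HasDerivAt (fun w : ℝ => -w - z / w) (-1 + z / w ^ 2) w := by
      refine ((hasDerivAt_id w).neg.sub ((hasDerivAt_inv hw.ne').const_mul z)).congr_deriv ?_
      field_simp
      ring
    exact h1.exp
  · intro w hw
    exact Real.hasDerivAt_rpow_const (Or.inl (ne_of_gt hw))
  · exact hsum.congr_fun (fun w hw => (hpt w hw).symm) measurableSet_Ioi
  · refine squeeze_zero' ?_ ?_ hlim0
    · filter_upwards [self_mem_nhdsWithin] with w hw
      have hw : 0 < w := hw
      simp only [Pi.mul_apply]; positivity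
    · filter_upwards [self_mem_nhdsWithin] with w hw using hle w hw
  · refine squeeze_zero' ?_ ?_ hliminf
    · filter_upwards [eventually_gt_atTop 0] with w hw
      simp only [Pi.mul_apply]; positivity
    · filter_upwards [eventually_gt_atTop 0] with w hw using hle w hw

/-- The substitution `w = c / t` on the half-line. -/
lemma integral_comp_div_Ioi (f : ℝ → ℝ) {c : ℝ} (hc : 0 < c) :
    ∫ w in Ioi (0 : ℝ), f (c / w) * (c / w ^ 2) = ∫ t in Ioi (0 : ℝ), f t := by
  have h1 := integral_comp_rpow_Ioi (fun t => f (c * t)) (p := -1) (by norm_num)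
  have h2 := integral_comp_mul_left_Ioi f 0 hc
  rw [mul_zero] at h2
  rw [h2] at h1
  have h3 : ∫ t in Ioi (0 : ℝ), f t =
      c * ∫ x in Ioi (0 : ℝ), (|(-1 : ℝ)| * x ^ ((-1 : ℝ) - 1)) • f (c * x ^ (-1 : ℝ)) := by
    rw [h1, smul_eq_mul, mul_inv_cancel_left₀ hc.ne']
  rw [h3, ← integral_const_mul]
  refine setIntegral_congr_fun measurableSet_Ioi fun w hw => ?_
  have hw : 0 < w := hw
  have h4 : w ^ ((-1 : ℝ) - 1) = (w ^ 2)⁻¹ := by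
    rw [show (-1 : ℝ) - 1 = -(2 : ℕ) by norm_num, Real.rpow_neg hw.le, Real.rpow_natCast]
  simp only [h4, Real.rpow_neg_one, smul_eq_mul, abs_neg, abs_one, one_mul]
  rw [div_eq_mul_inv c w]
  ring

/-- The heat kernel form of the Macdonald integral. -/
lemma integral_exp_mul_rpow_eq_macdonald (a : ℝ) {c : ℝ} (hc : 0 < c) (μ : ℝ) :
    ∫ t in Ioi (0 : ℝ), Real.exp (-(c / t)) * Real.exp (-t * μ) * t ^ (-a - 1) =
      c ^ (-a) * macdonald a (c * μ) := by
  rw [← integral_comp_div_Ioi _ hc, macdonald, ← integral_const_mul]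
  refine setIntegral_congr_fun measurableSet_Ioi fun w hw => ?_
  have hw : 0 < w := hw
  rw [← Real.exp_add, Real.div_rpow hc.le hw.le, Real.rpow_sub_one hc.ne', Real.rpow_sub_one hw.ne',
    Real.rpow_sub_one hw.ne', Real.rpow_neg hw.le a,
    show -(c / (c / w)) + -(c / w) * μ = -w - c * μ / w by field_simp; ring]
  field_simp

/-- The inversion `w ↦ z/w`, read off from the heat form with `μ = 1`. It turns the order `s - 1` of
the derivative into `1 - s > 0`, which has a finite limit at `z = 0`, and it produces the second
heat formula. -/
lemma macdonald_symm (a : ℝ) {z : ℝ} (hz : 0 < z) : macdonald a z = z ^ a * macdonald (-a) z := by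
  have h := integral_exp_mul_rpow_eq_macdonald (-a) hz 1
  rw [neg_neg, mul_one] at h
  rw [← h, macdonald]
  refine setIntegral_congr_fun measurableSet_Ioi fun w _ => ?_
  rw [← Real.exp_add]
  congr 2
  ring
end

noncomputable section

/-! ### The solution of the one-dimensional extension equation -/

/-- The extension of an eigenfunction with eigenvalue `μ`, as a function of `y`. -/
def extProfile (s μ y : ℝ) : ℝ := macdonald s (μ * y ^ 2 / 4) / Real.Gamma s

/-- The derivative of `extProfile` in `y`. -/
def extProfileDeriv (s μ y : ℝ) : ℝ :=
  -(μ ^ s * y ^ (2 * s - 1) * (4 ^ (1 - s) / 2) * macdonald (1 - s) (μ * y ^ 2 / 4) / Real.Gamma s)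

variable {s μ y : ℝ}

lemma extProfile_nonneg (hs : 0 < s) : 0 ≤ extProfile s μ y :=
  div_nonneg (macdonald_nonneg _ _) (Real.Gamma_pos_of_pos hs).le

lemma extProfile_le_one (hs : 0 < s) (hμ : 0 ≤ μ) : extProfile s μ y ≤ 1 := by
  have hΓ := Real.Gamma_pos_of_pos hs
  rw [extProfile, div_le_one hΓ]
  exact macdonald_le_gamma hs (by positivity)

lemma exists_extProfile_le_exp (hs : 0 < s) : ∃ C : ℝ, 0 ≤ C ∧ ∀ μ y : ℝ, 0 ≤ μ → 0 < y →
    extProfile s μ y ≤ C * Real.exp (-(√μ * y / 2)) := by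
  have hΓ := Real.Gamma_pos_of_pos hs
  obtain ⟨C, hC, h⟩ := exists_macdonald_le_exp hs
  refine ⟨C / Real.Gamma s, by positivity, fun μ y hμ hy => ?_⟩
  have h1 := h (μ * y ^ 2 / 4) (by positivity)
  have h2 : √(μ * y ^ 2 / 4) = √μ * y / 2 := by
    rw [Real.sqrt_div (by positivity), Real.sqrt_mul hμ, Real.sqrt_sq hy.le,
      show (4 : ℝ) = 2 ^ 2 by norm_num, Real.sqrt_sq (by norm_num)]
  rw [h2] at h1
  rw [extProfile, div_mul_eq_mul_div]
  gcongr

/-- The dependence on the eigenvalue is only `μ^s`, the weight already summable for the fractional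
Laplacian. -/
lemma extProfileDeriv_abs_le (hs0 : 0 < s) (hs1 : s < 1) (hμ : 0 ≤ μ) (hy : 0 < y) :
    |extProfileDeriv s μ y| ≤ μ ^ s * (y ^ (2 * s - 1) *
      (4 ^ (1 - s) / 2 * Real.Gamma (1 - s) / Real.Gamma s)) := by
  have hΓ := Real.Gamma_pos_of_pos hs0
  have h1 := macdonald_le_gamma (a := 1 - s) (z := μ * y ^ 2 / 4) (by linarith) (by positivity)
  have h0 := macdonald_nonneg (1 - s) (μ * y ^ 2 / 4)
  rw [extProfileDeriv, abs_neg, abs_of_nonneg (by positivity)]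
  calc _ ≤ μ ^ s * y ^ (2 * s - 1) * (4 ^ (1 - s) / 2) * Real.Gamma (1 - s) / Real.Gamma s := by
        gcongr
    _ = _ := by ring

lemma neg_rpow_mul_extProfileDeriv (hy : 0 < y) :
    -(y ^ (1 - 2 * s) * extProfileDeriv s μ y) =
      μ ^ s * (4 ^ (1 - s) / 2 / Real.Gamma s * macdonald (1 - s) (μ * y ^ 2 / 4)) := by
  have h : y ^ (1 - 2 * s) * y ^ (2 * s - 1) = 1 := by
    rw [← Real.rpow_add hy]; simp
  unfold extProfileDeriv
  linear_combination (μ ^ s * (4 ^ (1 - s) / 2 / Real.Gamma s * macdonald (1 - s) (μ * y ^ 2 / 4))) * h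

/-- Two forms of one derivative: the definition, of order `1 - s`, is suited to `y → 0`; this one,
of order `s - 1`, is what the chain rule gives and what can be differentiated again. -/
lemma extProfileDeriv_eq (hs : 0 < s) (hμ : 0 ≤ μ) (hy : 0 < y) :
    extProfileDeriv s μ y = -(μ * y / 2 * macdonald (s - 1) (μ * y ^ 2 / 4) / Real.Gamma s) := by
  rcases hμ.eq_or_lt with rfl | hμ
  · simp [extProfileDeriv, Real.zero_rpow hs.ne']
  rw [extProfileDeriv, macdonald_symm (s - 1) (by positivity : 0 < μ * y ^ 2 / 4), neg_sub,
    Real.div_rpow (by positivity) (by norm_num), Real.mul_rpow hμ.le (by positivity),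
    Real.rpow_sub_one hμ.ne', ← Real.rpow_natCast y 2, ← Real.rpow_mul hy.le,
    show ((2 : ℕ) : ℝ) * (s - 1) = 2 * s - 1 - 1 by push_cast; ring,
    Real.rpow_sub_one hy.ne', show (1 : ℝ) - s = -(s - 1) by ring,
    Real.rpow_neg (by norm_num : (0 : ℝ) ≤ 4)]
  have hpow : y ^ (2 * s) = y ^ 2 * y ^ (2 * s - 1 - 1) := by
    rw [← Real.rpow_natCast y 2, ← Real.rpow_add hy]
    congr 1; push_cast; ring
  field_simp
  rw [hpow]
  ring

lemma hasDerivAt_extProfile (hs : 0 < s) (hμ : 0 ≤ μ) (hy : 0 < y) :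
    HasDerivAt (extProfile s μ) (extProfileDeriv s μ y) y := by
  rw [extProfileDeriv_eq hs hμ hy]
  rcases hμ.eq_or_lt with rfl | hμ
  · have : extProfile s 0 = fun _ => macdonald s 0 / Real.Gamma s := by
      ext y; simp [extProfile]
    rw [this]
    simpa using hasDerivAt_const y (macdonald s 0 / Real.Gamma s)
  have h1 : HasDerivAt (fun y : ℝ => μ * y ^ 2 / 4) (μ * y / 2) y := by
    refine (((hasDerivAt_pow 2 y).const_mul μ).div_const 4).congr_deriv ?_
    simp; ring
  have h2 := (hasDerivAt_macdonald s (by positivity : 0 < μ * y ^ 2 / 4)).comp y h1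
  refine (h2.div_const (Real.Gamma s)).congr_deriv ?_
  ring

/-- This is the extension equation for one eigenvalue, and it amounts to `macdonald_recurrence` at
order `s - 1`. -/
lemma hasDerivAt_extProfileDeriv (hs : 0 < s) (hμ : 0 ≤ μ) (hy : 0 < y) :
    HasDerivAt (extProfileDeriv s μ)
      (μ * extProfile s μ y - (1 - 2 * s) / y * extProfileDeriv s μ y) y := by
  have heq : extProfileDeriv s μ =ᶠ[𝓝 y]
      fun y => -(μ * y / 2 * macdonald (s - 1) (μ * y ^ 2 / 4) / Real.Gamma s) := by
    filter_upwards [lt_mem_nhds hy] with y hy using extProfileDeriv_eq hs hμ hy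
  refine HasDerivAt.congr_of_eventuallyEq ?_ heq
  rw [extProfileDeriv_eq hs hμ hy]
  rcases hμ.eq_or_lt with rfl | hμ
  · simpa using hasDerivAt_const y (0 : ℝ)
  have h1 : HasDerivAt (fun y : ℝ => μ * y ^ 2 / 4) (μ * y / 2) y := by
    refine (((hasDerivAt_pow 2 y).const_mul μ).div_const 4).congr_deriv ?_
    simp; ring
  have hz : 0 < μ * y ^ 2 / 4 := by positivity
  have h2 := (hasDerivAt_macdonald (s - 1) hz).comp y h1
  have h3 : HasDerivAt (fun y : ℝ => μ * y / 2) (μ / 2) y := by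
    refine (((hasDerivAt_id y).const_mul μ).div_const 2).congr_deriv ?_
    simp
  refine (((h3.mul h2).div_const (Real.Gamma s)).neg).congr_deriv ?_
  have h4 := macdonald_recurrence (a := s - 1) hz
  rw [sub_add_cancel] at h4
  have hΓ := (Real.Gamma_pos_of_pos hs).ne'
  unfold extProfile
  simp only [Function.comp_apply]
  field_simp
  linear_combination (4 : ℝ) * h4

lemma tendsto_extProfile (hs : 0 < s) (hμ : 0 ≤ μ) :
    Tendsto (extProfile s μ) (𝓝[>] 0) (𝓝 1) := by
  have hg : Tendsto (fun y : ℝ => μ * y ^ 2 / 4) (𝓝[>] 0) (𝓝 0) := by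
    have h : Continuous fun y : ℝ => μ * y ^ 2 / 4 := by fun_prop
    have := h.tendsto 0
    simp only [ne_eq, OfNat.ofNat_ne_zero, not_false_eq_true, zero_pow, mul_zero, zero_div] at this
    exact this.mono_left nhdsWithin_le_nhds
  have h := (tendsto_macdonald_zero hs hg
    (Eventually.of_forall fun y => by positivity)).div_const (Real.Gamma s)
  rwa [div_self (Real.Gamma_pos_of_pos hs).ne'] at h

lemma tendsto_neg_rpow_mul_extProfileDeriv (hs1 : s < 1) (hμ : 0 ≤ μ) :
    Tendsto (fun y => -(y ^ (1 - 2 * s) * extProfileDeriv s μ y)) (𝓝[>] 0)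
      (𝓝 (μ ^ s * (Real.Gamma (1 - s) / (4 ^ (s - 1 / 2) * Real.Gamma s)))) := by
  have hg : Tendsto (fun y : ℝ => μ * y ^ 2 / 4) (𝓝[>] 0) (𝓝 0) := by
    have h : Continuous fun y : ℝ => μ * y ^ 2 / 4 := by fun_prop
    have := h.tendsto 0
    simp only [ne_eq, OfNat.ofNat_ne_zero, not_false_eq_true, zero_pow, mul_zero, zero_div] at this
    exact this.mono_left nhdsWithin_le_nhds
  have h := ((tendsto_macdonald_zero (a := 1 - s) (by linarith) hg
    (Eventually.of_forall fun y => by positivity)).const_mul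
      (4 ^ (1 - s) / 2 / Real.Gamma s)).const_mul (μ ^ s)
  -- Here the exponent `s - 1/2` of the constant arises: the factor `1/2` is `4^(-1/2)`.
  have h4 : (4 : ℝ) ^ (1 - s) / 2 = (4 ^ (s - 1 / 2))⁻¹ := by
    rw [← Real.rpow_neg (by norm_num), show -(s - 1 / 2) = 1 - s - 1 / 2 by ring,
      Real.rpow_sub (by norm_num) (1 - s), ← Real.sqrt_eq_rpow,
      show (4 : ℝ) = 2 ^ 2 by norm_num, Real.sqrt_sq (by norm_num)]
  have h5 : μ ^ s * (Real.Gamma (1 - s) / (4 ^ (s - 1 / 2) * Real.Gamma s)) =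
      μ ^ s * (4 ^ (1 - s) / 2 / Real.Gamma s * Real.Gamma (1 - s)) := by
    rw [h4, div_eq_mul_inv, mul_inv, div_eq_mul_inv]; ring
  rw [h5]
  refine h.congr' ?_
  filter_upwards [self_mem_nhdsWithin] with y hy
  exact (neg_rpow_mul_extProfileDeriv hy).symm

/-- The heat kernel representation of `extProfile`. -/
lemma integral_heat_eq_extProfile (hs : 0 < s) (hy : 0 < y) (μ : ℝ) :
    ∫ t in Ioi (0 : ℝ), Real.exp (-y ^ 2 / (4 * t)) * Real.exp (-t * μ) / t ^ (1 + s) =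
      4 ^ s * Real.Gamma s / y ^ (2 * s) * extProfile s μ y := by
  have h := integral_exp_mul_rpow_eq_macdonald s (c := y ^ 2 / 4) (by positivity) μ
  have h1 : (y ^ 2 / 4) ^ (-s) = 4 ^ s / y ^ (2 * s) := by
    rw [Real.rpow_neg (by positivity), Real.div_rpow (by positivity) (by norm_num),
      ← Real.rpow_natCast y 2, ← Real.rpow_mul hy.le, inv_div]
    norm_num
  rw [h1, show y ^ 2 / 4 * μ = μ * y ^ 2 / 4 by ring] at h
  have hΓ := (Real.Gamma_pos_of_pos hs).ne'
  rw [extProfile, show 4 ^ s * Real.Gamma s / y ^ (2 * s) *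
    (macdonald s (μ * y ^ 2 / 4) / Real.Gamma s) =
    4 ^ s / y ^ (2 * s) * macdonald s (μ * y ^ 2 / 4) by field_simp, ← h]
  refine setIntegral_congr_fun measurableSet_Ioi fun t ht => ?_
  have ht : 0 < t := ht
  rw [show -s - 1 = -(1 + s) by ring, Real.rpow_neg ht.le, div_eq_mul_inv _ (t ^ (1 + s)),
    show -y ^ 2 / (4 * t) = -(y ^ 2 / 4 / t) by field_simp]

/-- The second heat kernel representation of `extProfile`. -/
lemma integral_heat_eq_extProfile_of_pos (hs : 0 < s) (hy : 0 < y) (hμ : 0 < μ) :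
    ∫ t in Ioi (0 : ℝ), Real.exp (-y ^ 2 / (4 * t)) * (Real.exp (-t * μ) * μ ^ s) / t ^ (1 - s) =
      Real.Gamma s * extProfile s μ y := by
  have hz : 0 < μ * y ^ 2 / 4 := by positivity
  have h := integral_exp_mul_rpow_eq_macdonald (-s) (c := y ^ 2 / 4) (by positivity) μ
  rw [neg_neg, show y ^ 2 / 4 * μ = μ * y ^ 2 / 4 by ring] at h
  have hΓ := (Real.Gamma_pos_of_pos hs).ne'
  rw [extProfile, mul_div_cancel₀ _ hΓ, macdonald_symm s hz,
    show μ * y ^ 2 / 4 = μ * (y ^ 2 / 4) by ring, Real.mul_rpow hμ.le (by positivity),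
    show μ * (y ^ 2 / 4) = μ * y ^ 2 / 4 by ring, mul_assoc, ← h, ← integral_const_mul]
  refine setIntegral_congr_fun measurableSet_Ioi fun t ht => ?_
  have ht : 0 < t := ht
  rw [show s - 1 = -(1 - s) by ring, Real.rpow_neg ht.le, div_eq_mul_inv _ (t ^ (1 - s)),
    show -y ^ 2 / (4 * t) = -(y ^ 2 / 4 / t) by field_simp]
  ring

lemma extProfile_pos (hs : 0 < s) (hμ : 0 ≤ μ) : 0 < extProfile s μ y :=
  div_pos (macdonald_pos (macdonald_integrable hs (by positivity))) (Real.Gamma_pos_of_pos hs)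

/-- A non-integrable function has integral `0` by convention, whereas the formula gives a positive
value. -/
lemma integrableOn_heat (hs : 0 < s) (hy : 0 < y) (hμ : 0 ≤ μ) :
    IntegrableOn (fun t : ℝ => Real.exp (-y ^ 2 / (4 * t)) * Real.exp (-t * μ) / t ^ (1 + s))
      (Ioi 0) := by
  by_contra hcon
  have h := integral_heat_eq_extProfile hs hy μ
  rw [integral_undef hcon] at h
  have h1 := extProfile_pos (y := y) hs hμ
  have h2 := Real.Gamma_pos_of_pos hs
  have : 0 < 4 ^ s * Real.Gamma s / y ^ (2 * s) * extProfile s μ y := by positivity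
  linarith

lemma integrableOn_heat_of_pos (hs : 0 < s) (hy : 0 < y) (hμ : 0 < μ) :
    IntegrableOn (fun t : ℝ => Real.exp (-y ^ 2 / (4 * t)) * (Real.exp (-t * μ) * μ ^ s) /
      t ^ (1 - s)) (Ioi 0) := by
  by_contra hcon
  have h := integral_heat_eq_extProfile_of_pos hs hy hμ
  rw [integral_undef hcon] at h
  have h1 := extProfile_pos (y := y) hs hμ.le
  have h2 := Real.Gamma_pos_of_pos hs
  have : 0 < Real.Gamma s * extProfile s μ y := by positivity
  linarith
end

noncomputable section

/-! ### Regularity of series of harmonic polynomials -/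

variable {n : ℕ}

lemma one_mem_sphericalHarmonics : (fun _ => 1 : Sph n → ℝ) ∈ sphericalHarmonics n 0 :=
  mem_sphericalHarmonics_iff.mpr ⟨1, MvPolynomial.isHomogeneous_one _ _, by
    simp [polyLaplacian_apply], by ext x; simp [polyFun]⟩

lemma integral_sphLaplacian (hn : 2 ≤ n) {u : Sph n → ℝ} (hu : SphContDiff 2 u) :
    ∫ x, sphLaplacian u x ∂surfaceMeasure n = 0 := by
  have h := integral_sphLaplacian_mul_of_mem hn hu one_mem_sphericalHarmonics
  simpa [sphEigenvalue] using h

lemma polyLaplacian_commutes (p : MvPolynomial (Fin n) ℝ) (i : Fin n) :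
    polyLaplacian (MvPolynomial.pderiv i p) = MvPolynomial.pderiv i (polyLaplacian p) := by
  apply polyFun_injective
  ext X
  simp only [polyLaplacian_apply, map_sum]
  have hcomm : ∀ (q : MvPolynomial (Fin n) ℝ) (j : Fin n),
      MvPolynomial.pderiv j (MvPolynomial.pderiv i q) =
        MvPolynomial.pderiv i (MvPolynomial.pderiv j q) := by
    intro q j
    have h : ⁅(MvPolynomial.pderiv j :
        Derivation ℝ (MvPolynomial (Fin n) ℝ) (MvPolynomial (Fin n) ℝ)),
        (MvPolynomial.pderiv i :
          Derivation ℝ (MvPolynomial (Fin n) ℝ) (MvPolynomial (Fin n) ℝ))⁆ = 0 := by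
      apply MvPolynomial.derivation_ext
      intro l
      simp [Derivation.commutator_apply, MvPolynomial.pderiv_X, Pi.single_apply, apply_ite]
    have h2 := congrArg (fun D : Derivation ℝ (MvPolynomial (Fin n) ℝ) (MvPolynomial (Fin n) ℝ) => D q) h
    simp only [Derivation.commutator_apply, Derivation.coe_zero, Pi.zero_apply] at h2
    exact sub_eq_zero.mp h2
  congr 1
  refine Finset.sum_congr rfl fun j _ => ?_
  rw [hcomm p j, hcomm _ j]

/-- The `L²` norm of a partial derivative of a harmonic homogeneous polynomial. -/
lemma integral_pderiv_sq_le (hn : 2 ≤ n) {p : MvPolynomial (Fin n) ℝ} {k : ℕ}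
    (hp : p.IsHomogeneous k) (hp0 : polyLaplacian p = 0) (i : Fin n) :
    ∫ x : Sph n, polyFun (MvPolynomial.pderiv i p) x * polyFun (MvPolynomial.pderiv i p) x
        ∂surfaceMeasure n ≤
      (n : ℝ) ^ 2 * (k + 1 : ℝ) ^ 2 * ∫ x : Sph n, polyFun p x * polyFun p x ∂surfaceMeasure n := by
  have hc : ∀ q : MvPolynomial (Fin n) ℝ, Continuous fun x : Sph n => polyFun q x := fun q =>
    (sphContDiff_polyFun (m := 0) q).continuous
  have hI0 : 0 ≤ ∫ x : Sph n, polyFun p x * polyFun p x ∂surfaceMeasure n :=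
    integral_nonneg fun x => mul_self_nonneg _
  -- For harmonic `p`, `Δ(p²) = 2|∇p|²`. As `p²` is homogeneous of degree `2k` and a spherical
  -- Laplacian has integral zero, `2∫|∇p|² = λ_{2k} ∫p²` on the sphere.
  have hlap : ∀ x : Sph n, sphLaplacian (fun x : Sph n => polyFun (p * p) x) x =
      2 * ∑ j, polyFun (MvPolynomial.pderiv j p) x * polyFun (MvPolynomial.pderiv j p) x -
        sphEigenvalue n (k + k) * (polyFun p x * polyFun p x) := by
    intro x
    have h1 : polyLaplacian (p * p) =
        2 * ∑ j, MvPolynomial.pderiv j p * MvPolynomial.pderiv j p := by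
      have h2 : ∀ j, MvPolynomial.pderiv j (MvPolynomial.pderiv j (p * p)) =
          2 * (MvPolynomial.pderiv j p * MvPolynomial.pderiv j p) +
            2 * p * MvPolynomial.pderiv j (MvPolynomial.pderiv j p) := by
        intro j
        simp only [Derivation.leibniz, map_add, smul_eq_mul]
        ring
      rw [polyLaplacian_apply, Finset.sum_congr rfl fun j _ => h2 j, Finset.sum_add_distrib,
        ← Finset.mul_sum, ← Finset.mul_sum, ← polyLaplacian_apply, hp0, mul_zero, add_zero]
    rw [sphLaplacian_polyFun (hp.mul hp), h1, polyFun_mul p p]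
    simp [polyFun]
  have h0 := integral_sphLaplacian hn (sphContDiff_polyFun (m := 2) (p * p))
  simp_rw [hlap] at h0
  have hsum : ∫ x : Sph n, ∑ j, polyFun (MvPolynomial.pderiv j p) x *
      polyFun (MvPolynomial.pderiv j p) x ∂surfaceMeasure n =
      ∑ j, ∫ x : Sph n, polyFun (MvPolynomial.pderiv j p) x *
      polyFun (MvPolynomial.pderiv j p) x ∂surfaceMeasure n :=
    integral_finsetSum _ fun j _ => integrable_surfaceMeasure ((hc _).fun_mul (hc _))
  rw [integral_sub, integral_const_mul, integral_const_mul, hsum] at h0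
  · have hle : ∫ x : Sph n, polyFun (MvPolynomial.pderiv i p) x * polyFun (MvPolynomial.pderiv i p) x
        ∂surfaceMeasure n ≤ ∑ j, ∫ x : Sph n, polyFun (MvPolynomial.pderiv j p) x *
          polyFun (MvPolynomial.pderiv j p) x ∂surfaceMeasure n :=
      Finset.single_le_sum (f := fun j => ∫ x : Sph n, polyFun (MvPolynomial.pderiv j p) x *
          polyFun (MvPolynomial.pderiv j p) x ∂surfaceMeasure n)
        (fun j _ => integral_nonneg fun x => mul_self_nonneg _) (Finset.mem_univ i)
    have hpos : 0 ≤ ∫ x : Sph n, polyFun (MvPolynomial.pderiv i p) x *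
        polyFun (MvPolynomial.pderiv i p) x ∂surfaceMeasure n :=
      integral_nonneg fun x => mul_self_nonneg _
    have hev : sphEigenvalue n (k + k) ≤ (n : ℝ) ^ 2 * (k + 1 : ℝ) ^ 2 := by
      have h2 : (2 : ℝ) ≤ n := by exact_mod_cast hn
      have h3 : (0 : ℝ) ≤ k := k.cast_nonneg
      unfold sphEigenvalue
      push_cast
      have h4 : 2 * (k : ℝ) + n ≤ n * (k + 1) := by nlinarith
      calc (k + k : ℝ) * (k + k + n - 2) ≤ (2 * k + n) * (2 * k + n) := by nlinarith
        _ ≤ (n * (k + 1)) * (n * (k + 1)) := by gcongr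
        _ = _ := by ring
    have := mul_le_mul_of_nonneg_right hev hI0
    linarith
  · exact integrable_surfaceMeasure (continuous_const.mul
      (continuous_finsetSum _ fun j _ => (hc _).mul (hc _)))
  · exact integrable_surfaceMeasure (continuous_const.mul ((hc p).mul (hc p)))

/-- The bound of a harmonic homogeneous polynomial on balls around the origin. -/
lemma abs_polyFun_le (hn : 2 ≤ n) (B : SphericalHarmonicBasis n) {p : MvPolynomial (Fin n) ℝ}
    {d k N : ℕ} {C ρ : ℝ} (hp : p.IsHomogeneous d) (hp0 : polyLaplacian p = 0) (hd : d ≤ k)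
    (hC : 0 ≤ C) (hρ : 1 ≤ ρ)
    (h : ∫ x : Sph n, polyFun p x * polyFun p x ∂surfaceMeasure n ≤ C * (k + 1 : ℝ) ^ N)
    {X : EuclideanSpace ℝ (Fin n)} (hX : ‖X‖ ≤ ρ) :
    |polyFun p X| ≤ ρ ^ k * (√(C / (surfaceMeasure n).real univ) * (k + 1 : ℝ) ^ (n + N)) := by
  have hω := surfaceMeasure_univ_pos hn
  have hk0 : (0 : ℝ) ≤ k := k.cast_nonneg
  have hk1 : (1 : ℝ) ≤ (k + 1 : ℝ) ^ (n + N) := one_le_pow₀ (by linarith)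
  have hsph : ∀ x : Sph n, |polyFun p x| ≤
      √(C / (surfaceMeasure n).real univ) * (k + 1 : ℝ) ^ (n + N) := by
    intro x
    refine abs_le_of_sq_le_sq' (a := polyFun p x) ?_ (by positivity) |> abs_le.mpr
    have h2 := sq_le_of_mem hn B (mem_sphericalHarmonics_iff.mpr ⟨p, hp, hp0, rfl⟩) x
    have hdk : (d : ℝ) ≤ k := by exact_mod_cast hd
    rw [mul_pow, Real.sq_sqrt (by positivity)]
    have hI0 : 0 ≤ ∫ x : Sph n, polyFun p x * polyFun p x ∂surfaceMeasure n :=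
      integral_nonneg fun x => mul_self_nonneg _
    calc polyFun p x ^ 2 ≤ (d + 1 : ℝ) ^ n / (surfaceMeasure n).real univ *
          ∫ x : Sph n, polyFun p x * polyFun p x ∂surfaceMeasure n := h2
      _ ≤ (k + 1 : ℝ) ^ n / (surfaceMeasure n).real univ * (C * (k + 1 : ℝ) ^ N) := by
          gcongr
      _ = C / (surfaceMeasure n).real univ * ((k + 1 : ℝ) ^ (n + N) * 1) := by
          rw [pow_add]; ring
      _ ≤ C / (surfaceMeasure n).real univ * ((k + 1 : ℝ) ^ (n + N)) ^ 2 := by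
          rw [pow_two ((k + 1 : ℝ) ^ (n + N))]
          gcongr
  have hρk : ‖X‖ ^ d ≤ ρ ^ k := (pow_le_pow_left₀ (norm_nonneg _) hX d).trans
    (pow_le_pow_right₀ hρ hd)
  by_cases hX0 : X = 0
  · rw [hX0] at hρk ⊢
    obtain ⟨x⟩ : Nonempty (Sph n) := ⟨⟨EuclideanSpace.single ⟨0, by omega⟩ 1, by simp⟩⟩
    have h3 : polyFun p (0 : EuclideanSpace ℝ (Fin n)) = 0 ^ d * polyFun p x := by
      rw [← polyFun_smul hp, zero_smul]
    rw [h3, abs_mul]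
    rw [norm_zero] at hρk
    rw [abs_of_nonneg (by positivity : (0 : ℝ) ≤ 0 ^ d)]
    exact mul_le_mul hρk (hsph x) (abs_nonneg _) (by positivity)
  · rw [polyFun_eq_norm_pow_mul hp hX0, normalExt_of_ne _ hX0, abs_mul,
      abs_of_nonneg (by positivity : 0 ≤ ‖X‖ ^ d)]
    exact mul_le_mul hρk (hsph _) (abs_nonneg _) (by positivity)

lemma summable_succ_pow_mul_exp_neg {r : ℝ} (hr : 0 < r) (M : ℕ) :
    Summable fun k : ℕ => (k + 1 : ℝ) ^ M * Real.exp (-r * k) := by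
  have h := (summable_nat_add_iff 1).mpr (Real.summable_pow_mul_exp_neg_nat_mul M hr)
  refine (h.mul_left (Real.exp r)).congr fun k => ?_
  push_cast
  rw [show -r * k = r + -r * (k + 1) by ring, Real.exp_add]
  ring

/-- A series of harmonic homogeneous polynomials with exponentially decaying coefficients is smooth
near the closed unit ball. -/
lemma contDiffOn_tsum_polyFun (hn : 2 ≤ n) (B : SphericalHarmonicBasis n) {a : ℕ → ℝ} {A c : ℝ}
    (hc : 0 < c) (ha : ∀ k, |a k| ≤ A * Real.exp (-c * k)) (m : ℕ) :
    ∀ (q : ℕ → MvPolynomial (Fin n) ℝ) (d : ℕ → ℕ) (C : ℝ) (N : ℕ), (∀ k, d k ≤ k) →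
      (∀ k, (q k).IsHomogeneous (d k)) → (∀ k, polyLaplacian (q k) = 0) → 0 ≤ C →
      (∀ k : ℕ, ∫ x : Sph n, polyFun (q k) x * polyFun (q k) x ∂surfaceMeasure n ≤
        C * (k + 1 : ℝ) ^ N) →
      ContDiffOn ℝ m (fun X => ∑' k, a k * polyFun (q k) X)
        (Metric.ball (0 : EuclideanSpace ℝ (Fin n)) (Real.exp (c / 2))) := by
  have hρ : 1 ≤ Real.exp (c / 2) := Real.one_le_exp (by linarith)
  have hA : 0 ≤ A := by
    have := (abs_nonneg _).trans (ha 0)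
    simpa using this
  have hbound : ∀ (q : ℕ → MvPolynomial (Fin n) ℝ) (d : ℕ → ℕ) (C : ℝ) (N : ℕ), (∀ k, d k ≤ k) →
      (∀ k, (q k).IsHomogeneous (d k)) → (∀ k, polyLaplacian (q k) = 0) → 0 ≤ C →
      (∀ k : ℕ, ∫ x : Sph n, polyFun (q k) x * polyFun (q k) x ∂surfaceMeasure n ≤
        C * (k + 1 : ℝ) ^ N) →
      ∃ b : ℕ → ℝ, Summable b ∧ ∀ k, ∀ X ∈ Metric.ball (0 : EuclideanSpace ℝ (Fin n))
        (Real.exp (c / 2)), |a k * polyFun (q k) X| ≤ b k := by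
    intro q d C N hd hq hq0 hC hI
    refine ⟨_, (summable_succ_pow_mul_exp_neg (half_pos hc) (n + N)).mul_left
      (A * √(C / (surfaceMeasure n).real univ)), fun k X hX => ?_⟩
    rw [mem_ball_zero_iff] at hX
    have h1 := abs_polyFun_le hn B (hq k) (hq0 k) (hd k) hC hρ (hI k) hX.le
    rw [abs_mul]
    refine (mul_le_mul (ha k) h1 (abs_nonneg _) (by positivity)).trans (le_of_eq ?_)
    -- On the ball of radius `exp(c/2)` the growth `exp(kc/2)` uses up half of the decay `exp(-ck)`.
    rw [← Real.exp_nat_mul, show -(c / 2) * k = -c * k + k * (c / 2) by ring, Real.exp_add]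
    ring
  induction m with
  | zero =>
    intro q d C N hd hq hq0 hC hI
    obtain ⟨b, hb, h⟩ := hbound q d C N hd hq hq0 hC hI
    simp only [Nat.cast_zero]
    rw [contDiffOn_zero]
    exact continuousOn_tsum (fun k => (continuous_const.mul
      (contDiff_polyFun (m := 0) (q k)).continuous).continuousOn) hb h
  | succ m ih =>
    intro q d C N hd hq hq0 hC hI
    obtain ⟨b, hb, h⟩ := hbound q d C N hd hq hq0 hC hI
    -- The class of families is stable under partial derivatives: these stay harmonic and
    -- homogeneous, and `integral_pderiv_sq_le` changes `C` to `n² C` and `N` to `N + 2`. This is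
    -- why the induction quantifies over all such families.
    have hC' : 0 ≤ (n : ℝ) ^ 2 * C := by positivity
    have hI' : ∀ i, ∀ k : ℕ, ∫ x : Sph n, polyFun (MvPolynomial.pderiv i (q k)) x *
        polyFun (MvPolynomial.pderiv i (q k)) x ∂surfaceMeasure n ≤
        (n : ℝ) ^ 2 * C * (k + 1 : ℝ) ^ (N + 2) := by
      intro i k
      have hdk : (d k : ℝ) ≤ k := by exact_mod_cast hd k
      calc _ ≤ (n : ℝ) ^ 2 * (d k + 1 : ℝ) ^ 2 *
            ∫ x : Sph n, polyFun (q k) x * polyFun (q k) x ∂surfaceMeasure n :=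
            integral_pderiv_sq_le hn (hq k) (hq0 k) i
        _ ≤ (n : ℝ) ^ 2 * (k + 1 : ℝ) ^ 2 * (C * (k + 1 : ℝ) ^ N) := by
            have := hI k
            have hI0 : 0 ≤ ∫ x : Sph n, polyFun (q k) x * polyFun (q k) x ∂surfaceMeasure n :=
              integral_nonneg fun x => mul_self_nonneg _
            gcongr
        _ = _ := by ring
    have hd' : ∀ k, d k - 1 ≤ k := fun k => (Nat.sub_le _ _).trans (hd k)
    have hq0' : ∀ i k, polyLaplacian (MvPolynomial.pderiv i (q k)) = 0 := fun i k => by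
      rw [polyLaplacian_commutes, hq0, map_zero]
    have hih := fun i => ih (fun k => MvPolynomial.pderiv i (q k)) (fun k => d k - 1) _ _ hd'
      (fun k => (hq k).pderiv) (hq0' i) hC' (hI' i)
    choose b' hb' h' using fun i => hbound (fun k => MvPolynomial.pderiv i (q k))
      (fun k => d k - 1) _ _ hd' (fun k => (hq k).pderiv) (hq0' i) hC' (hI' i)
    let π : Fin n → EuclideanSpace ℝ (Fin n) →L[ℝ] ℝ := fun i => EuclideanSpace.proj i
    have hder : ∀ X ∈ Metric.ball (0 : EuclideanSpace ℝ (Fin n)) (Real.exp (c / 2)),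
        HasFDerivAt (fun X => ∑' k, a k * polyFun (q k) X)
          (∑ i, (∑' k, a k * polyFun (MvPolynomial.pderiv i (q k)) X) • π i) X := by
      intro X hX
      have h0 : (0 : EuclideanSpace ℝ (Fin n)) ∈ Metric.ball (0 : EuclideanSpace ℝ (Fin n))
        (Real.exp (c / 2)) := Metric.mem_ball_self (Real.exp_pos _)
      have h1 := hasFDerivAt_tsum_of_isPreconnected (𝕜 := ℝ)
        (f := fun k X => a k * polyFun (q k) X)
        (f' := fun k X => ∑ i, (a k * polyFun (MvPolynomial.pderiv i (q k)) X) • π i)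
        (u := fun k => ∑ i, b' i k * ‖π i‖)
        (summable_sum fun i _ => (hb' i).mul_right _) Metric.isOpen_ball
        (convex_ball _ _).isPreconnected (fun k Z hZ => ?_) (fun k Z hZ => ?_) h0
        (Summable.of_norm_bounded hb fun k => h k 0 h0) hX
      · refine h1.congr_fderiv (HasSum.tsum_eq ?_)
        refine hasSum_sum fun i _ => HasSum.smul_const ?_ _
        exact (Summable.of_norm_bounded (hb' i) fun k => h' i k X hX).hasSum
      · refine ((hasFDerivAt_polyFun (q k) Z).const_mul (a k)).congr_fderiv ?_
        rw [Finset.smul_sum]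
        refine Finset.sum_congr rfl fun i _ => ?_
        rw [smul_smul]
      · refine (norm_sum_le _ _).trans (Finset.sum_le_sum fun i _ => ?_)
        rw [norm_smul]
        exact mul_le_mul_of_nonneg_right (h' i k Z hZ) (norm_nonneg _)
    rw [Nat.cast_succ, contDiffOn_succ_iff_fderiv_of_isOpen Metric.isOpen_ball]
    refine ⟨fun X hX => (hder X hX).differentiableAt.differentiableWithinAt, by simp, ?_⟩
    refine ContDiffOn.congr (f := fun X =>
      ∑ i, (∑' k, a k * polyFun (MvPolynomial.pderiv i (q k)) X) • π i) ?_
      fun X hX => (hder X hX).fderiv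
    exact ContDiffOn.sum fun i _ => (hih i).smul contDiffOn_const

/-- Exponentially damped spherical harmonic expansions are smooth. -/
lemma SphericalHarmonicBasis.sphContDiff_tsum_mul_proj (hn : 2 ≤ n) (B : SphericalHarmonicBasis n)
    {u : Sph n → ℝ} (hu : Continuous u) {a : ℕ → ℝ} {A c : ℝ}
    (hc : 0 < c) (ha : ∀ k, |a k| ≤ A * Real.exp (-c * k)) (m : ℕ) :
    SphContDiff m fun x => ∑' k, a k * B.proj k u x := by
  choose p hp hp0 hpu using fun k => mem_sphericalHarmonics_iff.mp (B.proj_mem k u)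
  have hI0 : 0 ≤ ∫ x, u x * u x ∂surfaceMeasure n := integral_nonneg fun x => mul_self_nonneg _
  have h1 := contDiffOn_tsum_polyFun hn B hc ha m p id _ 0 (fun k => le_rfl) hp hp0 hI0
    (fun k => by
      rw [pow_zero, mul_one]
      refine le_trans (le_of_eq ?_) (B.integral_proj_sq_le hu k)
      rw [hpu k])
  have h2 : (fun x => ∑' k, a k * B.proj k u x) =
      fun x : Sph n => (fun X => ∑' k, a k * polyFun (p k) X) (x : EuclideanSpace ℝ (Fin n)) := by
    ext x
    simp_rw [hpu]
  rw [h2]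
  refine sphContDiff_of_contDiffAt (m := (m : ℕ∞)) (f := fun X => ∑' k, a k * polyFun (p k) X)
    fun x => ?_
  refine (h1.contDiffAt (Metric.isOpen_ball.mem_nhds ?_))
  rw [mem_ball_zero_iff, norm_eq_of_mem_sphere x]
  -- The radius `exp(c/2)` exceeds `1`, so the sphere lies inside the open ball of smoothness.
  exact Real.one_lt_exp_iff.mpr (half_pos hc)
end

noncomputable section

/-! ### Series of one-dimensional extension profiles -/

section ProfileSeries

variable {s : ℝ} {μ c b : ℕ → ℝ}

/-- Fubini for series of decaying exponentials against a nonnegative weight. -/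
lemma integrableOn_and_integral_mul_tsum_exp {G : ℝ → ℝ} {μ₀ : ℝ} (hG : ContinuousOn G (Ioi 0))
    (hG0 : ∀ t, 0 < t → 0 ≤ G t) (hGi : IntegrableOn (fun t => G t * Real.exp (-t * μ₀)) (Ioi 0))
    (hμ₀ : 0 ≤ μ₀) (hb : Summable b) (hcb : ∀ k, |c k| ≤ b k) (hμ : ∀ k, μ₀ ≤ μ k ∨ c k = 0) :
    IntegrableOn (fun t => G t * ∑' k, Real.exp (-t * μ k) * c k) (Ioi 0) ∧
    ∫ t in Ioi (0 : ℝ), G t * ∑' k, Real.exp (-t * μ k) * c k =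
      ∑' k, (∫ t in Ioi (0 : ℝ), G t * Real.exp (-t * μ k)) * c k := by
  have hle : ∀ k, ∀ t : ℝ, 0 < t → |Real.exp (-t * μ k) * c k| ≤ Real.exp (-t * μ₀) * b k := by
    intro k t ht
    rcases hμ k with h | h
    · rw [abs_mul, Real.abs_exp]
      refine mul_le_mul (Real.exp_le_exp.mpr (by nlinarith)) (hcb k) (abs_nonneg _)
        (Real.exp_pos _).le
    · rw [h, mul_zero, abs_zero]
      exact mul_nonneg (Real.exp_pos _).le ((abs_nonneg _).trans (hcb k))
  have hle' : ∀ k, ∀ t : ℝ, 0 < t → |Real.exp (-t * μ k) * c k| ≤ b k := by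
    intro k t ht
    refine (hle k t ht).trans (mul_le_of_le_one_left ((abs_nonneg _).trans (hcb k)) ?_)
    rw [Real.exp_le_one_iff]
    nlinarith
  have hsum : ∀ t : ℝ, 0 < t → Summable fun k => Real.exp (-t * μ k) * c k := fun t ht =>
    Summable.of_norm_bounded hb fun k => hle' k t ht
  have hcontS : ContinuousOn (fun t => ∑' k, Real.exp (-t * μ k) * c k) (Ioi 0) :=
    continuousOn_tsum (fun k => by fun_prop) hb fun k t ht => hle' k t ht
  have hFi : ∀ k, IntegrableOn (fun t => G t * (Real.exp (-t * μ k) * c k)) (Ioi 0) := by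
    intro k
    refine Integrable.mono' (hGi.mul_const (b k))
      ((hG.mul (by fun_prop)).aestronglyMeasurable measurableSet_Ioi) ?_
    filter_upwards [ae_restrict_mem measurableSet_Ioi] with t ht
    rw [norm_mul, Real.norm_of_nonneg (hG0 t ht), mul_assoc]
    exact mul_le_mul_of_nonneg_left (hle k t ht) (hG0 t ht)
  refine ⟨?_, ?_⟩
  · refine Integrable.mono' (hGi.mul_const (∑' k, b k))
      ((hG.mul hcontS).aestronglyMeasurable measurableSet_Ioi) ?_
    filter_upwards [ae_restrict_mem measurableSet_Ioi] with t ht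
    rw [norm_mul, Real.norm_of_nonneg (hG0 t ht), mul_assoc]
    refine mul_le_mul_of_nonneg_left ?_ (hG0 t ht)
    rw [← tsum_mul_left]
    exact tsum_of_norm_bounded (hb.mul_left _).hasSum fun k => hle k t ht
  · have h1 := hasSum_integral_of_summable_integral_norm (μ := volume.restrict (Ioi (0 : ℝ)))
      (F := fun k t => G t * (Real.exp (-t * μ k) * c k)) hFi ?_
    · have h2 : ∫ t in Ioi (0 : ℝ), G t * ∑' k, Real.exp (-t * μ k) * c k =
          ∫ t in Ioi (0 : ℝ), ∑' k, G t * (Real.exp (-t * μ k) * c k) :=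
        setIntegral_congr_fun measurableSet_Ioi fun t _ => tsum_mul_left.symm
      rw [h2, ← h1.tsum_eq]
      refine tsum_congr fun k => ?_
      rw [← integral_mul_const]
      simp_rw [mul_assoc]
    · refine Summable.of_nonneg_of_le (fun k => integral_nonneg fun t => norm_nonneg _)
        (fun k => ?_) (hb.mul_left (∫ t in Ioi (0 : ℝ), G t * Real.exp (-t * μ₀)))
      rw [← integral_mul_const]
      refine setIntegral_mono_on (hFi k).norm (hGi.mul_const (b k)) measurableSet_Ioi fun t ht => ?_
      rw [norm_mul, Real.norm_of_nonneg (hG0 t ht), mul_assoc]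
      exact mul_le_mul_of_nonneg_left (hle k t ht) (hG0 t ht)

lemma abs_extProfile_mul_le (hs : 0 < s) (hμ : ∀ k, 0 ≤ μ k) (k : ℕ) (y : ℝ) :
    |extProfile s (μ k) y * c k| ≤ |c k| := by
  rw [abs_mul, abs_of_nonneg (extProfile_nonneg hs)]
  exact mul_le_of_le_one_left (abs_nonneg _) (extProfile_le_one hs (hμ k))

/-- Local uniformity in `y` for termwise differentiation: on a compact interval away from `0` the
power `x^(2s-1)` is bounded. -/
lemma exists_extProfileDeriv_bound (hs0 : 0 < s) (hs1 : s < 1) (hμ : ∀ k, 0 ≤ μ k)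
    (h2 : ∀ k, μ k ^ s * |c k| ≤ b k) {y : ℝ} (hy : 0 < y) :
    ∃ K : ℝ, 0 ≤ K ∧ ∀ k, ∀ x ∈ Ioo (y / 2) (2 * y), |extProfileDeriv s (μ k) x * c k| ≤ K * b k := by
  have hΓ := Real.Gamma_pos_of_pos hs0
  have hΓ' := Real.Gamma_pos_of_pos (sub_pos.mpr hs1)
  have hcont : ContinuousOn (fun x : ℝ => x ^ (2 * s - 1)) (Icc (y / 2) (2 * y)) := by
    intro x hx
    exact (Real.continuousAt_rpow_const x _ (Or.inl (by have := hx.1; linarith))).continuousWithinAt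
  obtain ⟨M, hM⟩ := isCompact_Icc.exists_bound_of_continuousOn hcont
  have hM0 : 0 ≤ M := (norm_nonneg _).trans (hM y ⟨by linarith, by linarith⟩)
  refine ⟨M * (4 ^ (1 - s) / 2 * Real.Gamma (1 - s) / Real.Gamma s), by positivity,
    fun k x hx => ?_⟩
  have hx0 : 0 < x := by have := hx.1; linarith
  have hMx : x ^ (2 * s - 1) ≤ M := (le_abs_self _).trans (hM x ⟨hx.1.le, hx.2.le⟩)
  have h3 := h2 k
  have h5 := Real.rpow_nonneg (hμ k) s
  rw [abs_mul]
  calc _ ≤ μ k ^ s * (x ^ (2 * s - 1) *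
        (4 ^ (1 - s) / 2 * Real.Gamma (1 - s) / Real.Gamma s)) * |c k| := by
        gcongr
        exact extProfileDeriv_abs_le hs0 hs1 (hμ k) hx0
    _ = x ^ (2 * s - 1) * (4 ^ (1 - s) / 2 * Real.Gamma (1 - s) / Real.Gamma s) *
        (μ k ^ s * |c k|) := by ring
    _ ≤ _ := by gcongr

variable (hs0 : 0 < s) (hs1 : s < 1) (hμ : ∀ k, 0 ≤ μ k) (hb : Summable b)
  (h0 : ∀ k, |c k| ≤ b k) (h1 : ∀ k, μ k * |c k| ≤ b k) (h2 : ∀ k, μ k ^ s * |c k| ≤ b k)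

include hs0 hμ hb h0 in
lemma summable_extProfile_mul (y : ℝ) : Summable fun k => extProfile s (μ k) y * c k :=
  Summable.of_norm_bounded hb fun k => (abs_extProfile_mul_le hs0 hμ k y).trans (h0 k)

include hs0 hs1 hμ hb h0 h2 in
lemma hasDerivAt_tsum_extProfile {y : ℝ} (hy : 0 < y) :
    HasDerivAt (fun y => ∑' k, extProfile s (μ k) y * c k)
      (∑' k, extProfileDeriv s (μ k) y * c k) y := by
  obtain ⟨K, hK, h⟩ := exists_extProfileDeriv_bound hs0 hs1 hμ h2 hy
  have hmem : y ∈ Ioo (y / 2) (2 * y) := ⟨by linarith, by linarith⟩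
  refine hasDerivAt_tsum_of_isPreconnected (g := fun k y => extProfile s (μ k) y * c k)
    (g' := fun k y => extProfileDeriv s (μ k) y * c k) (hb.mul_left K) isOpen_Ioo isPreconnected_Ioo
    (fun k x hx => ?_) h hmem (summable_extProfile_mul hs0 hμ hb h0 y) hmem
  exact (hasDerivAt_extProfile hs0 (hμ k) (by have := hx.1; linarith)).mul_const _

include hs0 hμ hb h1 in
lemma summable_mul_extProfile_mul (y : ℝ) : Summable fun k => μ k * extProfile s (μ k) y * c k := by
  refine Summable.of_norm_bounded hb fun k => ?_
  rw [mul_assoc, norm_mul, Real.norm_of_nonneg (hμ k)]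
  exact (mul_le_mul_of_nonneg_left (abs_extProfile_mul_le hs0 hμ k y) (hμ k)).trans (h1 k)

include hs0 hs1 hμ hb h2 in
lemma summable_extProfileDeriv_mul {y : ℝ} (hy : 0 < y) :
    Summable fun k => extProfileDeriv s (μ k) y * c k := by
  obtain ⟨K, hK, h⟩ := exists_extProfileDeriv_bound hs0 hs1 hμ h2 hy
  exact Summable.of_norm_bounded (hb.mul_left K) fun k => h k y ⟨by linarith, by linarith⟩

include hs0 hs1 hμ hb h1 h2 in
lemma hasDerivAt_tsum_extProfileDeriv {y : ℝ} (hy : 0 < y) :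
    HasDerivAt (fun y => ∑' k, extProfileDeriv s (μ k) y * c k)
      ((∑' k, μ k * extProfile s (μ k) y * c k) -
        (1 - 2 * s) / y * ∑' k, extProfileDeriv s (μ k) y * c k) y := by
  obtain ⟨K, hK, h⟩ := exists_extProfileDeriv_bound hs0 hs1 hμ h2 hy
  have hmem : y ∈ Ioo (y / 2) (2 * y) := ⟨by linarith, by linarith⟩
  have hsD := summable_extProfileDeriv_mul hs0 hs1 hμ hb h2 hy
  have hd := hasDerivAt_tsum_of_isPreconnected (g := fun k y => extProfileDeriv s (μ k) y * c k)
    (g' := fun k y => (μ k * extProfile s (μ k) y - (1 - 2 * s) / y * extProfileDeriv s (μ k) y) * c k)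
    (u := fun k => (1 + |1 - 2 * s| / (y / 2) * K) * b k)
    (hb.mul_left _) isOpen_Ioo isPreconnected_Ioo
    (fun k x hx => ?_) (fun k x hx => ?_) hmem hsD hmem
  · refine hd.congr_deriv ?_
    rw [← tsum_mul_left, ← (summable_mul_extProfile_mul hs0 hμ hb h1 y).tsum_sub (hsD.mul_left _)]
    exact tsum_congr fun k => by ring
  · exact (hasDerivAt_extProfileDeriv hs0 (hμ k) (by have := hx.1; linarith)).mul_const _
  · have hx0 : y / 2 < x := hx.1
    have hx0' : 0 < x := by linarith
    have e1 : |μ k * (extProfile s (μ k) x * c k)| ≤ b k := by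
      rw [abs_mul, abs_of_nonneg (hμ k)]
      exact (mul_le_mul_of_nonneg_left (abs_extProfile_mul_le hs0 hμ k x) (hμ k)).trans (h1 k)
    have e2 : |(1 - 2 * s) / x * (extProfileDeriv s (μ k) x * c k)| ≤
        |1 - 2 * s| / (y / 2) * (K * b k) := by
      rw [abs_mul, abs_div, abs_of_pos hx0']
      have := h k x hx
      gcongr
    calc ‖(μ k * extProfile s (μ k) x - (1 - 2 * s) / x * extProfileDeriv s (μ k) x) * c k‖
        = |μ k * (extProfile s (μ k) x * c k) -
            (1 - 2 * s) / x * (extProfileDeriv s (μ k) x * c k)| := by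
          rw [Real.norm_eq_abs]; congr 1; ring
      _ ≤ b k + |1 - 2 * s| / (y / 2) * (K * b k) := (abs_sub _ _).trans (add_le_add e1 e2)
      _ = _ := by ring

include hs0 hs1 hμ hb h0 h1 h2 in
lemma contDiffOn_tsum_extProfile :
    ContDiffOn ℝ 2 (fun y => ∑' k, extProfile s (μ k) y * c k) (Ioi 0) := by
  have hL : ContinuousOn (fun y => ∑' k, μ k * extProfile s (μ k) y * c k) (Ioi 0) := by
    refine continuousOn_tsum (fun k => ?_) hb (fun k y _ => ?_)
    · intro y hy
      exact ((continuousAt_const.mul (hasDerivAt_extProfile hs0 (hμ k) hy).continuousAt).mul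
        continuousAt_const).continuousWithinAt
    · rw [mul_assoc, norm_mul, Real.norm_of_nonneg (hμ k)]
      exact (mul_le_mul_of_nonneg_left (abs_extProfile_mul_le hs0 hμ k y) (hμ k)).trans (h1 k)
  have hD : ContinuousOn (fun y => ∑' k, extProfileDeriv s (μ k) y * c k) (Ioi 0) := fun y hy =>
    (hasDerivAt_tsum_extProfileDeriv hs0 hs1 hμ hb h1 h2 hy).continuousAt.continuousWithinAt
  have hC1 : ContDiffOn ℝ 1 (fun y => ∑' k, extProfileDeriv s (μ k) y * c k) (Ioi 0) := by
    rw [show (1 : WithTop ℕ∞) = 0 + 1 by simp, contDiffOn_succ_iff_deriv_of_isOpen isOpen_Ioi]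
    refine ⟨fun y hy => (hasDerivAt_tsum_extProfileDeriv hs0 hs1 hμ hb h1 h2
      hy).differentiableAt.differentiableWithinAt, by simp, ?_⟩
    rw [contDiffOn_zero]
    refine ContinuousOn.congr (f := fun y => (∑' k, μ k * extProfile s (μ k) y * c k) -
        (1 - 2 * s) / y * ∑' k, extProfileDeriv s (μ k) y * c k) ?_ fun y hy =>
      (hasDerivAt_tsum_extProfileDeriv hs0 hs1 hμ hb h1 h2 hy).deriv
    refine hL.sub (ContinuousOn.mul ?_ hD)
    exact continuousOn_const.div continuousOn_id fun y hy => ne_of_gt hy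
  rw [show (2 : WithTop ℕ∞) = 1 + 1 by norm_num, contDiffOn_succ_iff_deriv_of_isOpen isOpen_Ioi]
  exact ⟨fun y hy => (hasDerivAt_tsum_extProfile hs0 hs1 hμ hb h0 h2
    hy).differentiableAt.differentiableWithinAt, by simp,
    hC1.congr fun y hy => (hasDerivAt_tsum_extProfile hs0 hs1 hμ hb h0 h2 hy).deriv⟩

include hs0 hμ hb h0 in
lemma tendsto_tsum_extProfile :
    Tendsto (fun y => ∑' k, extProfile s (μ k) y * c k) (𝓝[>] 0) (𝓝 (∑' k, c k)) := by
  refine tendsto_tsum_of_dominated_convergence hb (fun k => ?_)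
    (Eventually.of_forall fun y k => (abs_extProfile_mul_le hs0 hμ k y).trans (h0 k))
  simpa using (tendsto_extProfile hs0 (hμ k)).mul_const (c k)

include hs0 hs1 hμ hb h2 in
-- The weight cancels `y^(2s-1)`, leaving `μ^s` times a Macdonald integral of order `1 - s`, bounded
-- by `Γ(1-s)`. Dominated convergence applies to the series.
lemma tendsto_neg_rpow_mul_tsum_extProfileDeriv :
    Tendsto (fun y => -(y ^ (1 - 2 * s) * ∑' k, extProfileDeriv s (μ k) y * c k)) (𝓝[>] 0)
      (𝓝 (Real.Gamma (1 - s) / (4 ^ (s - 1 / 2) * Real.Gamma s) * ∑' k, μ k ^ s * c k)) := by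
  have hΓ := Real.Gamma_pos_of_pos hs0
  have hΓ' := Real.Gamma_pos_of_pos (sub_pos.mpr hs1)
  have h3 : (fun y => -(y ^ (1 - 2 * s) * ∑' k, extProfileDeriv s (μ k) y * c k)) =
      fun y => ∑' k, -(y ^ (1 - 2 * s) * extProfileDeriv s (μ k) y) * c k := by
    ext y
    rw [← tsum_mul_left, ← tsum_neg]
    exact tsum_congr fun k => by ring
  rw [h3, ← tsum_mul_left]
  refine tendsto_tsum_of_dominated_convergence
    (hb.mul_left (4 ^ (1 - s) / 2 / Real.Gamma s * Real.Gamma (1 - s))) (fun k => ?_) ?_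
  · rw [← mul_assoc, mul_comm (Real.Gamma (1 - s) / (4 ^ (s - 1 / 2) * Real.Gamma s))]
    exact (tendsto_neg_rpow_mul_extProfileDeriv hs1 (hμ k)).mul_const (c k)
  · filter_upwards [self_mem_nhdsWithin] with y hy k
    have hy : 0 < y := hy
    have hz : 0 ≤ μ k * y ^ 2 / 4 := by have := hμ k; positivity
    have e1 := macdonald_le_gamma (a := 1 - s) (by linarith) hz
    have e0 := macdonald_nonneg (1 - s) (μ k * y ^ 2 / 4)
    have e2 := Real.rpow_nonneg (hμ k) s
    have e3 := h2 k
    rw [neg_rpow_mul_extProfileDeriv hy, norm_mul, Real.norm_of_nonneg (by positivity),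
      Real.norm_eq_abs]
    calc _ = 4 ^ (1 - s) / 2 / Real.Gamma s * macdonald (1 - s) (μ k * y ^ 2 / 4) *
          (μ k ^ s * |c k|) := by ring
      _ ≤ _ := by gcongr

end ProfileSeries
end

/-! ### Assembly: the extension as a series of profiles. -/

noncomputable section

variable {n : ℕ}

namespace SphericalHarmonicBasis

variable (B : SphericalHarmonicBasis n)

lemma integrableOn_extensionIntegrand_and_extension_eq (hn : 2 ≤ n) {s : ℝ} (hs0 : 0 < s)
    {u : Sph n → ℝ} {x : Sph n} {b : ℕ → ℝ} (hb : Summable b) (h0 : ∀ k, |B.proj k u x| ≤ b k)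
    {y : ℝ} (hy : 0 < y) :
    IntegrableOn (B.extensionIntegrand s u x y) (Ioi 0) ∧
      B.extension s u x y = ∑' k, extProfile s (sphEigenvalue n k) y * B.proj k u x := by
  have hGc : ContinuousOn (fun t : ℝ => Real.exp (-y ^ 2 / (4 * t)) / t ^ (1 + s)) (Ioi 0) := by
    intro t ht
    have ht : 0 < t := ht
    refine ContinuousAt.continuousWithinAt (ContinuousAt.div ?_
      (Real.continuousAt_rpow_const t _ (Or.inl ht.ne')) (by positivity))
    exact (continuousAt_const.div (by fun_prop) (by positivity)).rexp
  obtain ⟨h1, h2⟩ := integrableOn_and_integral_mul_tsum_exp (μ := sphEigenvalue n) (μ₀ := 0) hGc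
    (fun t ht => by positivity)
    ((integrableOn_heat hs0 hy le_rfl).congr_fun (fun t _ => by ring) measurableSet_Ioi)
    le_rfl hb h0 (fun k => Or.inl (sphEigenvalue_nonneg hn k))
  have h3 : B.extensionIntegrand s u x y = fun t => Real.exp (-y ^ 2 / (4 * t)) / t ^ (1 + s) *
      ∑' k, Real.exp (-t * sphEigenvalue n k) * B.proj k u x := by
    ext t
    unfold extensionIntegrand heat
    ring
  refine ⟨h3 ▸ h1, ?_⟩
  rw [extension, h3, h2, ← tsum_mul_left]
  refine tsum_congr fun k => ?_
  have h4 := integral_heat_eq_extProfile hs0 hy (sphEigenvalue n k)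
  have h5 : ∫ t in Ioi (0 : ℝ), Real.exp (-y ^ 2 / (4 * t)) / t ^ (1 + s) *
      Real.exp (-t * sphEigenvalue n k) =
      4 ^ s * Real.Gamma s / y ^ (2 * s) * extProfile s (sphEigenvalue n k) y := by
    rw [← h4]
    refine setIntegral_congr_fun measurableSet_Ioi fun t _ => ?_
    ring
  have hΓ := Real.Gamma_pos_of_pos hs0
  rw [h5]
  field_simp

lemma integrableOn_and_extension_eq_of_mean_zero (hn : 2 ≤ n) {s : ℝ} (hs0 : 0 < s) (hs1 : s < 1)
    {u : Sph n → ℝ} (hu : SphContDiff ∞ u) (hmean : ∫ z, u z ∂surfaceMeasure n = 0) (x : Sph n)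
    {y : ℝ} (hy : 0 < y) :
    IntegrableOn (fun t : ℝ => Real.exp (-y ^ 2 / (4 * t)) *
        B.heat t (B.fracLaplacian s u) x / t ^ (1 - s)) (Ioi 0) ∧
      B.extension s u x y = 1 / Real.Gamma s * ∫ t in Ioi (0 : ℝ),
        Real.exp (-y ^ 2 / (4 * t)) * B.heat t (B.fracLaplacian s u) x / t ^ (1 - s) := by
  obtain ⟨b, hb, h0, -, hs⟩ := B.exists_summable_bound_rpow hn hu
  have hGc : ContinuousOn (fun t : ℝ => Real.exp (-y ^ 2 / (4 * t)) / t ^ (1 - s)) (Ioi 0) := by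
    intro t ht
    have ht : 0 < t := ht
    refine ContinuousAt.continuousWithinAt (ContinuousAt.div ?_
      (Real.continuousAt_rpow_const t _ (Or.inl ht.ne')) (by positivity))
    exact (continuousAt_const.div (by fun_prop) (by positivity)).rexp
  have hpos : ∀ k, k ≠ 0 → 1 ≤ sphEigenvalue n k := fun k hk => by
    have h1 : (1 : ℝ) ≤ k := by exact_mod_cast Nat.one_le_iff_ne_zero.mpr hk
    exact le_trans (by nlinarith) (sq_le_sphEigenvalue hn k)
  have hproj := B.proj_fracLaplacian hn hu hs0 hs1
  have hzero : B.proj 0 (B.fracLaplacian s u) x = 0 := by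
    rw [hproj, B.proj_zero_eq_zero hmean, mul_zero]
  -- The weight behaves like `t^(s-1)` at infinity and is not integrable alone, so the damping
  -- `exp(-t)` is needed. It is available because nonzero degrees have eigenvalue at least `1` and
  -- the degree `0` term vanishes.
  obtain ⟨h1, h2⟩ := integrableOn_and_integral_mul_tsum_exp (μ := sphEigenvalue n) (μ₀ := 1)
    (c := fun k => B.proj k (B.fracLaplacian s u) x) hGc
    (fun t ht => by positivity)
    ((integrableOn_heat_of_pos hs0 hy one_pos).congr_fun
      (fun t _ => by simp only [Real.one_rpow]; ring) measurableSet_Ioi)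
    zero_le_one hb (fun k => by
      rw [hproj, abs_mul, abs_of_nonneg (Real.rpow_nonneg (sphEigenvalue_nonneg hn k) _)]
      exact hs s hs0 hs1 k x)
    (fun k => by
      rcases eq_or_ne k 0 with rfl | hk
      · exact Or.inr hzero
      · exact Or.inl (hpos k hk))
  have h3 : (fun t : ℝ => Real.exp (-y ^ 2 / (4 * t)) * B.heat t (B.fracLaplacian s u) x /
      t ^ (1 - s)) = fun t => Real.exp (-y ^ 2 / (4 * t)) / t ^ (1 - s) *
      ∑' k, Real.exp (-t * sphEigenvalue n k) * B.proj k (B.fracLaplacian s u) x := by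
    ext t
    unfold heat
    ring
  refine ⟨h3 ▸ h1, ?_⟩
  rw [h3, h2, (B.integrableOn_extensionIntegrand_and_extension_eq hn hs0 hb (fun k => h0 k x) hy).2,
    ← tsum_mul_left]
  refine tsum_congr fun k => ?_
  rcases eq_or_ne k 0 with rfl | hk
  · rw [hzero, B.proj_zero_eq_zero hmean]; ring
  have hΓ := Real.Gamma_pos_of_pos hs0
  have h4 := integral_heat_eq_extProfile_of_pos hs0 hy (zero_lt_one.trans_le (hpos k hk))
  rw [hproj, ← mul_assoc (∫ t in Ioi (0 : ℝ), _), ← integral_mul_const]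
  have h5 : ∫ t in Ioi (0 : ℝ), Real.exp (-y ^ 2 / (4 * t)) / t ^ (1 - s) *
      Real.exp (-t * sphEigenvalue n k) * sphEigenvalue n k ^ s =
      Real.Gamma s * extProfile s (sphEigenvalue n k) y := by
    rw [← h4]
    refine setIntegral_congr_fun measurableSet_Ioi fun t _ => ?_
    ring
  rw [h5]
  field_simp

/-- The spherical Laplacian acts on smooth damped expansions as a multiplier. -/
lemma sphLaplacian_tsum_mul_proj (hn : 2 ≤ n) {u : Sph n → ℝ} {a : ℕ → ℝ} {b : ℕ → ℝ}
    (hb : Summable b) (h : ∀ k x, |a k * B.proj k u x| ≤ b k)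
    (h' : ∀ k x, |(-sphEigenvalue n k * a k) * B.proj k u x| ≤ b k)
    (hsm : SphContDiff 2 fun x => ∑' k, a k * B.proj k u x) :
    sphLaplacian (fun x => ∑' k, a k * B.proj k u x) =
      fun x => ∑' k, (-sphEigenvalue n k * a k) * B.proj k u x := by
  -- Both sides are continuous, so comparing coefficients suffices: the left is computed by symmetry
  -- of the Laplacian, and no second derivative is taken termwise.
  refine B.eq_of_coeff_eq hn (continuous_sphLaplacian hsm) (B.continuous_tsum_mul_proj hb h')
    fun k l => ?_
  rw [B.coeff_sphLaplacian hn hsm, B.coeff_tsum_mul_proj hn hb h,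
    B.coeff_tsum_mul_proj (c := fun k => -sphEigenvalue n k * a k) hn hb h']
  ring

end SphericalHarmonicBasis

end

theorem theorem7p2 (n : ℕ) (hn : 2 ≤ n) (B : SphericalHarmonicBasis n)
    (s : ℝ) (hs0 : 0 < s) (hs1 : s < 1)
    (u : Sph n → ℝ) (hu : SphContDiff ∞ u) :
    -- the series and integrals that define the objects below converge absolutely
    (∀ x, Summable fun k : ℕ => sphEigenvalue n k ^ s * B.proj k u x) ∧
    Continuous (B.fracLaplacian s u) ∧
    (∀ t, 0 < t → ∀ x,
      (Summable fun k : ℕ => Real.exp (-t * sphEigenvalue n k) * B.proj k u x) ∧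
      (Summable fun k : ℕ =>
        Real.exp (-t * sphEigenvalue n k) * B.proj k (B.fracLaplacian s u) x)) ∧
    (∀ x, ∀ y, 0 < y → IntegrableOn (B.extensionIntegrand s u x y) (Ioi 0)) ∧
    -- the extension equation, satisfied in the classical sense
    (∀ y, 0 < y → SphContDiff 2 fun x => B.extension s u x y) ∧
    (∀ x, ContDiffOn ℝ 2 (B.extension s u x) (Ioi 0)) ∧
    (∀ x, ∀ y, 0 < y →
      sphLaplacian (fun z => B.extension s u z y) x
        + (1 - 2 * s) / y * deriv (B.extension s u x) y
        + deriv (deriv (B.extension s u x)) y = 0) ∧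
    -- the boundary value
    (∀ x, Tendsto (B.extension s u x) (𝓝[>] 0) (𝓝 (u x))) ∧
    -- the weighted conormal derivative
    (∀ x, Tendsto (fun y => -(y ^ (1 - 2 * s) * deriv (B.extension s u x) y)) (𝓝[>] 0)
      (𝓝 (Real.Gamma (1 - s) / (4 ^ (s - 1 / 2) * Real.Gamma s) * B.fracLaplacian s u x))) ∧
    -- the second formula, for functions of mean zero
    (∫ z, u z ∂(surfaceMeasure n) = 0 → ∀ x, ∀ y, 0 < y →
      IntegrableOn (fun t : ℝ => Real.exp (-y ^ 2 / (4 * t))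
        * B.heat t (B.fracLaplacian s u) x / t ^ (1 - s)) (Ioi 0) ∧
      B.extension s u x y = 1 / Real.Gamma s * ∫ t in Ioi (0 : ℝ),
        Real.exp (-y ^ 2 / (4 * t)) * B.heat t (B.fracLaplacian s u) x / t ^ (1 - s)) := by

  have hμ := sphEigenvalue_nonneg hn
  obtain ⟨b, hb, h0, h1, h2⟩ := B.exists_summable_bound_rpow hn hu
  have hfb : ∀ k x, |sphEigenvalue n k ^ s * B.proj k u x| ≤ b k := fun k x => by
    rw [abs_mul, abs_of_nonneg (Real.rpow_nonneg (hμ k) _)]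
    exact h2 s hs0 hs1 k x
  have hexp : ∀ t, 0 < t → ∀ k, Real.exp (-t * sphEigenvalue n k) ≤ 1 := fun t ht k => by
    rw [Real.exp_le_one_iff]
    nlinarith [hμ k]
  have hU : ∀ x, ∀ y, 0 < y → B.extension s u x y =
      ∑' k, extProfile s (sphEigenvalue n k) y * B.proj k u x := fun x y hy =>
    (B.integrableOn_extensionIntegrand_and_extension_eq hn hs0 hb (fun k => h0 k x) hy).2
  have hUev : ∀ x, ∀ y, 0 < y → B.extension s u x =ᶠ[𝓝 y]
      fun y => ∑' k, extProfile s (sphEigenvalue n k) y * B.proj k u x := fun x y hy => by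
    filter_upwards [lt_mem_nhds hy] with z hz using hU x z hz
  have hd1 : ∀ x, ∀ y, 0 < y → deriv (B.extension s u x) y =
      ∑' k, extProfileDeriv s (sphEigenvalue n k) y * B.proj k u x := fun x y hy => by
    rw [(hUev x y hy).deriv_eq]
    exact (hasDerivAt_tsum_extProfile hs0 hs1 hμ hb (fun k => h0 k x)
      (fun k => h2 s hs0 hs1 k x) hy).deriv
  have hsm : ∀ y, 0 < y → SphContDiff 2
      fun x => ∑' k, extProfile s (sphEigenvalue n k) y * B.proj k u x := fun y hy => by
    obtain ⟨C, hC, hCle⟩ := exists_extProfile_le_exp hs0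
    refine B.sphContDiff_tsum_mul_proj hn hu.continuous (a := fun k =>
      extProfile s (sphEigenvalue n k) y) (A := C) (half_pos hy) (fun k => ?_) 2
    rw [abs_of_nonneg (extProfile_nonneg hs0)]
    refine (hCle _ y (hμ k) hy).trans (mul_le_mul_of_nonneg_left (Real.exp_le_exp.mpr ?_) hC)
    -- The profile decays like `exp(-√λ_k y/2)`, hence at rate `c = y/2` in `k`.
    have hk : (k : ℝ) ≤ √(sphEigenvalue n k) :=
      Real.le_sqrt_of_sq_le (sq_le_sphEigenvalue hn k)
    nlinarith
  have hUx : ∀ y, 0 < y → (fun x => B.extension s u x y) =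
      fun x => ∑' k, extProfile s (sphEigenvalue n k) y * B.proj k u x := fun y hy =>
    funext fun x => hU x y hy
  refine ⟨fun x => Summable.of_norm_bounded hb fun k => hfb k x,
    B.continuous_tsum_mul_proj hb hfb, fun t ht x => ⟨?_, ?_⟩,
    fun x y hy => (B.integrableOn_extensionIntegrand_and_extension_eq hn hs0 hb
      (fun k => h0 k x) hy).1, fun y hy => ?_, fun x => ?_, fun x y hy => ?_, fun x => ?_,
    fun x => ?_, fun hmean x y hy => B.integrableOn_and_extension_eq_of_mean_zero hn hs0 hs1 hu
      hmean x hy⟩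
  · refine Summable.of_norm_bounded hb fun k => ?_
    rw [norm_mul, Real.norm_of_nonneg (Real.exp_pos _).le]
    exact (mul_le_of_le_one_left (norm_nonneg _) (hexp t ht k)).trans (h0 k x)
  · refine Summable.of_norm_bounded hb fun k => ?_
    rw [norm_mul, Real.norm_of_nonneg (Real.exp_pos _).le, B.proj_fracLaplacian hn hu hs0 hs1]
    exact (mul_le_of_le_one_left (norm_nonneg _) (hexp t ht k)).trans (hfb k x)
  · rw [hUx y hy]; exact hsm y hy
  · exact (contDiffOn_tsum_extProfile hs0 hs1 hμ hb (fun k => h0 k x) (fun k => h1 k x)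
      (fun k => h2 s hs0 hs1 k x)).congr fun y hy => hU x y hy
  · have hdev : deriv (B.extension s u x) =ᶠ[𝓝 y]
        fun y => ∑' k, extProfileDeriv s (sphEigenvalue n k) y * B.proj k u x := by
      filter_upwards [lt_mem_nhds hy] with z hz using hd1 x z hz
    rw [hdev.deriv_eq, (hasDerivAt_tsum_extProfileDeriv hs0 hs1 hμ hb (fun k => h1 k x)
      (fun k => h2 s hs0 hs1 k x) hy).deriv, hd1 x y hy, hUx y hy,
      B.sphLaplacian_tsum_mul_proj hn hb
        (fun k x => (abs_extProfile_mul_le (c := fun k => B.proj k u x) hs0 hμ k y).trans (h0 k x))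
        (fun k x => by
          rw [neg_mul, neg_mul, abs_neg, mul_assoc, abs_mul, abs_of_nonneg (hμ k)]
          exact (mul_le_mul_of_nonneg_left (abs_extProfile_mul_le
            (c := fun k => B.proj k u x) hs0 hμ k y) (hμ k)).trans (h1 k x)) (hsm y hy)]
    -- The Laplacian contributes `-∑ λ_k φ P_k u`, the second derivative `+∑ λ_k φ P_k u`, and the
    -- first-order terms cancel.
    simp only [neg_mul, tsum_neg]
    ring
  · have h := tendsto_tsum_extProfile hs0 hμ hb (fun k => h0 k x)
    rw [(B.hasSum_proj hn hu x).tsum_eq] at h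
    refine h.congr' ?_
    filter_upwards [self_mem_nhdsWithin] with y hy using (hU x y hy).symm
  · have h := tendsto_neg_rpow_mul_tsum_extProfileDeriv hs0 hs1 hμ hb
      (fun k => h2 s hs0 hs1 k x)
    refine h.congr' ?_
    filter_upwards [self_mem_nhdsWithin] with y hy
    rw [hd1 x y hy]
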